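/- \textbf{Setting.} Let $P$ be a free $\mathbb Z$-module, $P^*=\mathrm{Hom}(P,\mathbb Z)$, $I$ an index set, $\alpha_i\in P$, $h_i\in P^*$ $(i\in I)$, and $(\cdot,\cdot)\colon P\times P\to\mathbb Q$ a symmetric bilinear form such that $(\alpha_i,\alpha_i)>0$, $\langle h_i,\lambda\rangle=2(\alpha_i,\lambda)/(\alpha_i,\alpha_i)$ for $\lambda\in P$, and $(\alpha_i,\alpha_j)\le 0$ for $i\ne j$. Let $d$ be a positive integer with $(\alpha_i,\alpha_i)/2\in d^{-1}\mathbb Z$ for all $i$. Put $K=\mathbb Q(q_s)$, $q=q_s^d$, $q_i=q^{(\alpha_i,\alpha_i)/2}$, $K_{\mathbb Q}=\mathbb Q[q_s^{\pm1}]$, and let $A\subset K$ be the ring of rational functions without pole at $q_s=0$. Let $U_q(\mathfrak g)$ be the $K$-algebra generated by $e_i,f_i$ $(i\in I)$ and $q(h)$ $(h\in d^{-1}P^*)$ with the relations $q(0)=1$, $q(h)q(h')=q(h+h')$, $q(h)e_iq(h)^{-1}=q^{\langle h,\alpha_i\rangle}e_i$, $q(h)f_iq(h)^{-1}=q^{-\langle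 h,\alpha_i\rangle}f_i$, $[e_i,f_j]=\delta_{ij}(t_i-t_i^{-1})/(q_i-q_i^{-1})$ with $t_i=q(\frac{(\alpha_i,\alpha_i)}2h_i)$, and the quantum Serre relations. Put $e_i^{(n)}=e_i^n/[n]_i!$ and $f_i^{(n)}=f_i^n/[n]_i!$. Let $U_q(\mathfrak g)_{\mathbb Q}$ be the $K_{\mathbb Q}$-subalgebra generated by the $e_i^{(n)}$, the $f_i^{(n)}$ and the elements $\prod_{k=1}^n\frac{q^{1-k}q(h)-q^{k-1}q(-h)}{q^k-q^{-k}}$ $(h\in P^*,\ n\ge0)$. Let $a\mapsto\bar a$ denote both the automorphism of $K$ with $\bar q_s=q_s^{-1}$ and the ring automorphism of $U_q(\mathfrak g)$ sending $q_s,q(h),e_i,f_i$ to $q_s^{-1},q(-h),e_i,f_i$. For a $K$-vector space $V$, an $A$-submodule $L_0$, an $\bar A$-submodule $L_\infty$ and a $K_{\mathbb Q}$-submodule $V_{\mathbb Q}$ of $V$, the triple $(L_0,L_\infty,V_{\mathbb Q})$ is \emph{balanced} if each of the three spans $V$ over $K$ and the map $L_0\cap L_\infty\cap V_{\mathbb Q}\to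 L_0/q_sL_0$ is bijective. Let $M$ be an integrable $U_q(\mathfrak g)$-module: $M=\bigoplus_{\xi\in P}M_\xi$, where $M_\xi=\{u: q(h)u=q^{\langle h,\xi\rangle}u\ \forall h\}$, and all $e_i,f_i$ act locally nilpotently. Put $\mathrm{Wt}(M)=\{\xi: M_\xi\ne0\}$, and write $N_\xi=N\cap M_\xi$ for $N\subset M$. Let $u\mapsto\bar u$ be a bar involution of $M$ (an additive involution with $\overline{au}=\bar a\,\bar u$ for $a\in U_q(\mathfrak g)$). Let $(L,B)$ be a (lower) crystal base of $M$, that is: $L$ is a free $A$-submodule that spans $M$ over $K$, with $L=\bigoplus_\xi L_\xi$; $B$ is a $\mathbb Q$-basis of $L/q_sL$ that consists of weight vectors; $L$ and $B\cup\{0\}$ are stable under Kashiwara's operators $\tilde e_i,\tilde f_i$ (given by $\tilde e_i f_i^{(n)}u=f_i^{(n-1)}u$ and $\tilde f_i f_i^{(n)}u=f_i^{(n+1)}u$ for $u\in M_\xi$ with $e_iu=0$ and $0\le n\le\langle h_i,\xi\rangle$, where $f_i^{(-1)}=0$); and $b'=\tilde f_ib$ if and only if $b=\tilde e_ib'$,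 for $b,b'\in B$. Put $\varepsilon_i(b)=\max\{n:\tilde e_i^nb\ne0\}$ and $\varphi_i(b)=\max\{n:\tilde f_i^nb\ne0\}$. A vector $b\in B$ of weight $\lambda$ is \emph{extremal} if there are vectors $b_w$, for the products $w$ of simple reflections $s_i(\mu)=\mu-\langle h_i,\mu\rangle\alpha_i$ (given as words), with $b_1=b$ and such that for all $w$ and $i$: if $\langle h_i,w\lambda\rangle\ge0$ then $\tilde e_ib_w=0$ and $\tilde f_i^{\langle h_i,w\lambda\rangle}b_w=b_{s_iw}$; if $\langle h_i,w\lambda\rangle\le0$ then $\tilde f_ib_w=0$ and $\tilde e_i^{-\langle h_i,w\lambda\rangle}b_w=b_{s_iw}$. The weights of such $b$ are the extremal weights of $B$. \textbf{Theorem.} Let $M_{\mathbb Q}$ be a $U_q(\mathfrak g)_{\mathbb Q}$-submodule of $M$ with $\overline{M_{\mathbb Q}}=M_{\mathbb Q}$, and let $S\subset P$. Assume: (i) $\{(\xi,\xi):\xi\in\mathrm{Wt}(M)\}$ is bounded from above; (ii) $u-\bar u\in(q_s-1)M_{\mathbb Q}$ for every $u\in M_{\mathbb Q}$; (iii) $M_{\mathbb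 Q}$ spans $M$ over $K$; (iv) for every $\xi\in P\setminus S$, $(L_\xi,\bar L_\xi,(M_{\mathbb Q})_\xi)$ is balanced (in $M_\xi$); (v) every extremal weight of $B$ lies in $P\setminus S$; (vi) $q_sL\cap\bar L\cap M_{\mathbb Q}=0$. Then: (a) $(L,\bar L,M_{\mathbb Q})$ is balanced (in $M$), i.e. $M$ has a global basis $\{G(b)\}_{b\in B}$, where $G\colon L/q_sL\to L\cap\bar L\cap M_{\mathbb Q}$ is the inverse of the canonical bijection; (b) for all $i\in I$ and $n\ge0$, $f_i^nM=\bigoplus_{b\in B,\ \varepsilon_i(b)\ge n}K\,G(b)$ and $e_i^nM=\bigoplus_{b\in B,\ \varphi_i(b)\ge n}K\,G(b)$; (c) $M_{\mathbb Q}=\sum_{\xi\in P\setminus S}U_q(\mathfrak g)_{\mathbb Q}(M_{\mathbb Q})_\xi$ and $M=\sum_{\xi\in P\setminus S}U_q(\mathfrak g)M_\xi$. -/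

import Mathlib

open scoped Polynomial

noncomputable section

namespace QG

/-! ## The ground field `K = ℚ(q_s)` and its subrings -/

/-- The field `K = ℚ(q_s)`. -/
abbrev K : Type := RatFunc ℚ

/-- The indeterminate `q_s = q^{1/d}`. -/
def qs : K := RatFunc.X

lemma qs_ne_zero : qs ≠ 0 := RatFunc.X_ne_zero

lemma aeval_inv_injective :
    Function.Injective (Polynomial.aeval (R := ℚ) (qs⁻¹ : K)) := by
  rw [← transcendental_iff_injective]
  intro h
  have h2 := h.inv
  rw [inv_inv] at h2
  have h3 := RatFunc.transcendental_X (K := ℚ)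
  apply h3
  convert h2
  · exact Subsingleton.elim _ _
  · rfl

/-- The automorphism `-` of `K` that sends `q_s` to `q_s⁻¹`. -/
def barK : K →+* K :=
  RatFunc.liftRingHom (Polynomial.aeval (R := ℚ) (qs⁻¹ : K)).toRingHom
    (nonZeroDivisors_le_comap_nonZeroDivisors_of_injective _ aeval_inv_injective)

@[simp] lemma barK_qs : barK qs = qs⁻¹ := by
  have h := RatFunc.liftRingHom_algebraMap (Polynomial.aeval (R := ℚ) (qs⁻¹ : K)).toRingHom
    (nonZeroDivisors_le_comap_nonZeroDivisors_of_injective _ aeval_inv_injective)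
    Polynomial.X
  rw [RatFunc.algebraMap_X] at h
  refine h.trans ?_
  simp

/-- `A`: the rational functions in `q_s` without pole at `q_s = 0`. -/
def ringA : Subalgebra ℚ K where
  carrier := {f | ∃ a b : ℚ[X], b.coeff 0 ≠ 0 ∧
    f = algebraMap ℚ[X] K a / algebraMap ℚ[X] K b}
  mul_mem' := by
    rintro _ _ ⟨a, b, hb, rfl⟩ ⟨a', b', hb', rfl⟩
    refine ⟨a * a', b * b', ?_, ?_⟩
    · rw [Polynomial.mul_coeff_zero]; exact mul_ne_zero hb hb'
    · rw [map_mul, map_mul, div_mul_div_comm]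
  add_mem' := by
    rintro _ _ ⟨a, b, hb, rfl⟩ ⟨a', b', hb', rfl⟩
    have h1 : algebraMap ℚ[X] K b ≠ 0 := by
      intro h
      have : b = 0 := by simpa using h
      simp [this] at hb
    have h2 : algebraMap ℚ[X] K b' ≠ 0 := by
      intro h
      have : b' = 0 := by simpa using h
      simp [this] at hb'
    refine ⟨a * b' + b * a', b * b', ?_, ?_⟩
    · rw [Polynomial.mul_coeff_zero]; exact mul_ne_zero hb hb'
    · rw [div_add_div _ _ h1 h2]; simp only [map_add, map_mul]
  algebraMap_mem' := by
    intro r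
    refine ⟨Polynomial.C r, 1, by simp, ?_⟩
    simp

lemma qs_mem_ringA : qs ∈ ringA :=
  ⟨Polynomial.X, 1, by simp, by simp [qs, RatFunc.algebraMap_X]⟩

/-- `q_s` as an element of `A`. -/
def qsA : ringA := ⟨qs, qs_mem_ringA⟩

/-- `Ā`: the image of `A` under `-`. -/
def ringAbar : Subalgebra ℚ K := ringA.map barK.toRatAlgHom

/-- `K_ℚ = ℚ[q_s, q_s⁻¹]`. -/
def KQ : Subalgebra ℚ K := Algebra.adjoin ℚ {qs, qs⁻¹}

/-! ## Balanced triples -/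

section Balanced

variable {M : Type*} [AddCommGroup M] [Module K M]

/-- The `ℚ`-vector space `L / q_s L` of an `A`-submodule `L`. -/
abbrev Red (L : Submodule ringA M) : Type _ :=
  ↥L ⧸ (Ideal.span {qsA} • (⊤ : Submodule ringA L))

/-- The class in `L / q_s L` of an element of `L`. -/
def red (L : Submodule ringA M) (u : L) : Red L := Submodule.Quotient.mk u

/-- The map `L₀ ∩ L_∞ ∩ V_ℚ → L₀ / q_s L₀`. -/
def balancedMap (L0 : Submodule ringA M) (Linf : Submodule ringAbar M) (VQ : Submodule KQ M) :
    {u : M // u ∈ L0 ∧ u ∈ Linf ∧ u ∈ VQ} → Red L0 :=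
  fun u => red L0 ⟨u.1, u.2.1⟩

/-- The triple `(L₀, L_∞, V_ℚ)` of submodules of the `K`-vector space `V` is balanced
(`V` is a subspace of an ambient space `M`). -/
structure Balanced (V : Submodule K M) (L0 : Submodule ringA M) (Linf : Submodule ringAbar M)
    (VQ : Submodule KQ M) : Prop where
  span_L0 : Submodule.span K (L0 : Set M) = V
  span_Linf : Submodule.span K (Linf : Set M) = V
  span_VQ : Submodule.span K (VQ : Set M) = V
  bijective : Function.Bijective (balancedMap L0 Linf VQ)

/-- The inverse `G : L₀ / q_s L₀ → E ⊆ M` of the bijection `E → L₀ / q_s L₀`,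
`E = L₀ ∩ L_∞ ∩ V_ℚ`, of a balanced triple. -/
def Balanced.G {V : Submodule K M} {L0 : Submodule ringA M} {Linf : Submodule ringAbar M}
    {VQ : Submodule KQ M} (h : Balanced V L0 Linf VQ) (b : Red L0) : M :=
  ((Equiv.ofBijective _ h.bijective).symm b).1

end Balanced

/-! ## The quantized enveloping algebra -/

/-- The data of a weight lattice `P`, simple roots, simple coroots and a symmetric form, together
with a positive integer `d` with `(α_i, α_i)/2 ∈ d⁻¹ℤ`. The integer `r i` is `d (α_i, α_i)/2`, so
that `q_i = q_s ^ (r i)`. -/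
structure RootDatum (I P : Type*) [AddCommGroup P] where
  root : I → P
  coroot : I → Module.Dual ℤ P
  form : P →ₗ[ℤ] P →ₗ[ℤ] ℚ
  form_symm : ∀ x y, form x y = form y x
  form_root_pos : ∀ i, 0 < form (root i) (root i)
  coroot_apply : ∀ i x, (coroot i x : ℚ) = 2 * form (root i) x / form (root i) (root i)
  form_root_nonpos : ∀ i j, i ≠ j → form (root i) (root j) ≤ 0
  d : ℕ
  d_pos : 0 < d
  r : I → ℕ
  r_spec : ∀ i, form (root i) (root i) / 2 = (r i : ℚ) / d

variable {I P : Type*} [AddCommGroup P]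

/-- The generators `e_i`, `f_i` and `q(h)`, `h ∈ d⁻¹P*`. The generator `qh H` with `H ∈ P*` stands
for `q(h)` with `h = H / d`. -/
inductive Gen (I P : Type*) [AddCommGroup P]
  | e (i : I)
  | f (i : I)
  | qh (H : Module.Dual ℤ P)

namespace RootDatum

variable (D : RootDatum I P)

/-- `q = q_s ^ d`. -/
def q : K := qs ^ D.d

/-- `q_i = q^{(α_i, α_i)/2}`. -/
def qi (i : I) : K := qs ^ D.r i

/-- The quantum integer `[k]_i`. -/
def qInt (i : I) (k : ℕ) : K :=
  (D.qi i ^ k - (D.qi i)⁻¹ ^ k) / (D.qi i - (D.qi i)⁻¹)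

/-- The quantum factorial `[k]_i!`. -/
def qFact (i : I) (k : ℕ) : K := ∏ j ∈ Finset.range k, D.qInt i (j + 1)

/-- The element `H` of `P*` such that `t_i = q(((α_i, α_i)/2) h_i)` is `q(H / d)`. -/
def tH (i : I) : Module.Dual ℤ P := D.r i • D.coroot i

/-- The quantum Serre expression
`∑_{k=0}^b (-1)^k x^{(k)} y x^{(b-k)}`, `x^{(k)} = x^k / [k]_i!`. -/
def serre {R : Type*} [Ring R] [Algebra K R] (i : I) (b : ℕ) (x y : R) : R :=
  ∑ k ∈ Finset.range (b + 1),
    ((-1 : K) ^ k * (D.qFact i k)⁻¹ * (D.qFact i (b - k))⁻¹) • (x ^ k * y * x ^ (b - k))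

/-- Abbreviation for the generators in the free algebra. -/
abbrev ge (i : I) : FreeAlgebra K (Gen I P) := FreeAlgebra.ι K (Gen.e i)
/-- Abbreviation for the generators in the free algebra. -/
abbrev gf (i : I) : FreeAlgebra K (Gen I P) := FreeAlgebra.ι K (Gen.f i)
/-- Abbreviation for the generators in the free algebra. -/
abbrev gq (H : Module.Dual ℤ P) : FreeAlgebra K (Gen I P) := FreeAlgebra.ι K (Gen.qh H)

/-- The defining relations of `U_q(g)`. -/
inductive Rel : FreeAlgebra K (Gen I P) → FreeAlgebra K (Gen I P) → Prop
  | q_zero : Rel (gq 0) 1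
  | q_add (H H' : Module.Dual ℤ P) : Rel (gq H * gq H') (gq (H + H'))
  | q_e (H : Module.Dual ℤ P) (i : I) :
      Rel (gq H * ge i * gq (-H)) (qs ^ (H (D.root i)) • ge i)
  | q_f (H : Module.Dual ℤ P) (i : I) :
      Rel (gq H * gf i * gq (-H)) (qs ^ (-(H (D.root i))) • gf i)
  | ef (i : I) :
      Rel (ge i * gf i - gf i * ge i)
        ((D.qi i - (D.qi i)⁻¹)⁻¹ • (gq (D.tH i) - gq (-(D.tH i))))
  | ef_ne (i j : I) (hij : i ≠ j) : Rel (ge i * gf j - gf j * ge i) 0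
  | serre_e (i j : I) (hij : i ≠ j) :
      Rel (D.serre i (1 - D.coroot i (D.root j)).toNat (ge i) (ge j)) 0
  | serre_f (i j : I) (hij : i ≠ j) :
      Rel (D.serre i (1 - D.coroot i (D.root j)).toNat (gf i) (gf j)) 0

/-- The quantized universal enveloping algebra `U_q(g)`. -/
def Uq : Type _ := RingQuot D.Rel

instance : Ring D.Uq := inferInstanceAs (Ring (RingQuot D.Rel))

instance : Algebra K D.Uq := inferInstanceAs (Algebra K (RingQuot D.Rel))

/-- The quotient map from the free algebra. -/
def proj : FreeAlgebra K (Gen I P) →ₐ[K] D.Uq := RingQuot.mkAlgHom K D.Rel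

lemma proj_rel {x y : FreeAlgebra K (Gen I P)} (h : D.Rel x y) : D.proj x = D.proj y :=
  RingQuot.mkAlgHom_rel K h

/-- The generator `e_i`. -/
def e (i : I) : D.Uq := D.proj (ge i)

/-- The generator `f_i`. -/
def f (i : I) : D.Uq := D.proj (gf i)

/-- The generator `q(H / d)`, `H ∈ P*`. -/
def qh (H : Module.Dual ℤ P) : D.Uq := D.proj (gq H)

/-- The divided power `e_i^{(n)}`. -/
def eDiv (i : I) (n : ℕ) : D.Uq := (D.qFact i n)⁻¹ • D.e i ^ n

/-- The divided power `f_i^{(n)}`. -/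
def fDiv (i : I) (n : ℕ) : D.Uq := (D.qFact i n)⁻¹ • D.f i ^ n

/-- `{q^h over n} = ∏_{k=1}^n (q^{1-k} q^h - q^{k-1} q^{-h}) / (q^k - q^{-k})` for `h ∈ P*`;
here `q^h = qh (d • h)`, and the factor number `j` is the one for `k = j + 1`. -/
def qBinom (h : Module.Dual ℤ P) (n : ℕ) : D.Uq :=
  ((List.range n).map fun j =>
    (D.q ^ (j + 1) - D.q⁻¹ ^ (j + 1))⁻¹ •
      (D.q⁻¹ ^ j • D.qh (D.d • h) - D.q ^ j • D.qh (-(D.d • h)))).prod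

/-- The `K_ℚ`-subalgebra `U_q(g)_ℚ`. -/
def UqQ : Subalgebra KQ D.Uq :=
  Algebra.adjoin KQ
    ({x | ∃ i n, x = D.eDiv i n} ∪ {x | ∃ i n, x = D.fDiv i n} ∪ {x | ∃ h n, x = D.qBinom h n})

/-! ### The bar involution of `U_q(g)` -/

/-- `U_q(g)` with the `K`-algebra structure twisted by `-`. -/
def UqTwist : Type _ := D.Uq

instance : Ring D.UqTwist := inferInstanceAs (Ring D.Uq)

instance : Algebra K D.UqTwist :=
  RingHom.toAlgebra' (((algebraMap K D.Uq).comp barK : K →+* D.Uq))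
    (fun c x => Algebra.commutes (A := D.Uq) (barK c) x)

/-- The images of the generators under `-`. -/
def barGen : Gen I P → D.Uq
  | Gen.e i => D.e i
  | Gen.f i => D.f i
  | Gen.qh H => D.qh (-H)

/-- The bar involution on the free algebra, with values in `U_q(g)`. -/
def barFree : FreeAlgebra K (Gen I P) →+* D.Uq :=
  (FreeAlgebra.lift K (A := D.UqTwist) D.barGen).toRingHom

lemma barFree_ι (x : Gen I P) : D.barFree (FreeAlgebra.ι K x) = D.barGen x :=
  FreeAlgebra.lift_ι_apply (A := D.UqTwist) D.barGen x

lemma barFree_algebraMap (c : K) :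
    D.barFree (algebraMap K _ c) = algebraMap K D.Uq (barK c) :=
  AlgHom.commutes (FreeAlgebra.lift K (A := D.UqTwist) D.barGen) c

lemma barFree_smul (c : K) (x : FreeAlgebra K (Gen I P)) :
    D.barFree (c • x) = barK c • D.barFree x := by
  rw [Algebra.smul_def, map_mul, barFree_algebraMap, ← Algebra.smul_def]

lemma barK_qi (i : I) : barK (D.qi i) = (D.qi i)⁻¹ := by
  simp [qi]

lemma barK_qInt (i : I) (k : ℕ) : barK (D.qInt i k) = D.qInt i k := by
  simp only [qInt, map_div₀, map_sub, map_pow, map_inv₀, barK_qi, inv_inv]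
  rw [← neg_sub (D.qi i ^ k), ← neg_sub (D.qi i), neg_div_neg_eq]

lemma barK_qFact (i : I) (k : ℕ) : barK (D.qFact i k) = D.qFact i k := by
  simp [qFact, barK_qInt]

lemma proj_serre (i : I) (b : ℕ) (x y : FreeAlgebra K (Gen I P)) :
    D.proj (D.serre i b x y) = D.serre i b (D.proj x) (D.proj y) := by
  simp [serre]

lemma barFree_serre (i : I) (b : ℕ) (x y : FreeAlgebra K (Gen I P)) :
    D.barFree (D.serre i b x y) = D.serre i b (D.barFree x) (D.barFree y) := by
  simp [serre, barFree_smul, barK_qFact]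

lemma barFree_rel {x y : FreeAlgebra K (Gen I P)} (h : D.Rel x y) :
    D.barFree x = D.barFree y := by
  cases h with
  | q_zero => simpa [barFree_ι, barGen, qh] using D.proj_rel Rel.q_zero
  | q_add H H' =>
    have h := D.proj_rel (Rel.q_add (-H) (-H'))
    rw [map_mul] at h
    rw [map_mul, barFree_ι, barFree_ι, barFree_ι]
    simp only [barGen, qh, neg_add]
    exact h
  | q_e H i =>
    have h := D.proj_rel (Rel.q_e (-H) i)
    simp only [map_mul, map_smul, neg_neg] at h
    simp only [map_mul, barFree_smul, barFree_ι, barGen, qh, e, map_zpow₀, barK_qs, neg_neg]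
    rw [h]; simp
  | q_f H i =>
    have h := D.proj_rel (Rel.q_f (-H) i)
    simp only [map_mul, map_smul, neg_neg] at h
    simp only [map_mul, barFree_smul, barFree_ι, barGen, qh, f, map_zpow₀, barK_qs, neg_neg]
    rw [h]; simp
  | ef i =>
    have h := D.proj_rel (Rel.ef i)
    simp only [map_mul, map_smul, map_sub] at h
    simp only [map_mul, map_sub, barFree_smul, barFree_ι, barGen, qh, e, f, map_inv₀, barK_qi,
      neg_neg, inv_inv]
    rw [h, ← neg_sub (D.qi i), inv_neg, ← neg_sub (D.proj (gq (D.tH i))), smul_neg, neg_smul, neg_neg]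
  | ef_ne i j hij =>
    have h := D.proj_rel (Rel.ef_ne i j hij)
    simpa [barFree_ι, barGen, e, f] using h
  | serre_e i j hij =>
    have h := D.proj_rel (Rel.serre_e i j hij)
    rw [proj_serre, map_zero] at h
    rw [barFree_serre, map_zero, barFree_ι, barFree_ι]
    exact h
  | serre_f i j hij =>
    have h := D.proj_rel (Rel.serre_f i j hij)
    rw [proj_serre, map_zero] at h
    rw [barFree_serre, map_zero, barFree_ι, barFree_ι]
    exact h

/-- The ring automorphism `-` of `U_q(g)`: it sends `q_s`, `q(h)`, `e_i`, `f_i` to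
`q_s⁻¹`, `q(-h)`, `e_i`, `f_i`. -/
def bar : D.Uq →+* D.Uq := RingQuot.lift ⟨D.barFree, fun _ _ h => D.barFree_rel h⟩

lemma bar_proj (x : FreeAlgebra K (Gen I P)) : D.bar (D.proj x) = D.barFree x := by
  have h := RingQuot.lift_mkRingHom_apply D.barFree (fun _ _ h => D.barFree_rel h) x
  have h2 : D.proj x = RingQuot.mkRingHom D.Rel x :=
    DFunLike.congr_fun (RingQuot.mkAlgHom_coe K D.Rel) x
  rw [h2]
  exact h

lemma bar_e (i : I) : D.bar (D.e i) = D.e i := by rw [e, bar_proj, barFree_ι]; rfl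

lemma bar_f (i : I) : D.bar (D.f i) = D.f i := by rw [f, bar_proj, barFree_ι]; rfl

lemma bar_qh (H : Module.Dual ℤ P) : D.bar (D.qh H) = D.qh (-H) := by
  rw [qh, bar_proj, barFree_ι]; rfl

lemma bar_algebraMap (c : K) : D.bar (algebraMap K _ c) = algebraMap K _ (barK c) := by
  rw [← barFree_algebraMap, ← bar_proj, AlgHom.commutes]

/-! ## Integrable modules, bar involutions and crystal bases -/

section Modules

variable (M : Type*) [AddCommGroup M] [Module K M] [Module D.Uq M] [IsScalarTower K D.Uq M]

/-- The weight space `M_ξ = {u ; q(h) u = q^{⟨h, ξ⟩} u for all h ∈ d⁻¹P*}`. -/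
def wtSpace (ξ : P) : Submodule K M where
  carrier := {u | ∀ H : Module.Dual ℤ P, D.qh H • u = (qs ^ H ξ : K) • u}
  add_mem' := by
    intro a b ha hb H
    rw [smul_add, ha H, hb H, smul_add]
  zero_mem' := by
    intro H
    rw [smul_zero, smul_zero]
  smul_mem' := by
    intro c u hu H
    rw [← algebraMap_smul D.Uq c u, ← mul_smul, ← Algebra.commutes, mul_smul, hu H,
      algebraMap_smul, algebraMap_smul, smul_comm]

/-- The set of weights `Wt(M)`. -/
def Wt : Set P := {ξ | D.wtSpace M ξ ≠ ⊥}

/-- `M` is integrable: it is the sum of its weight spaces (the sum is automatically direct), and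
the `e_i` and `f_i` act locally nilpotently. -/
structure Integrable : Prop where
  iSup_wtSpace : ⨆ ξ, D.wtSpace M ξ = ⊤
  e_nilpotent : ∀ (i : I) (u : M), ∃ n : ℕ, D.e i ^ n • u = 0
  f_nilpotent : ∀ (i : I) (u : M), ∃ n : ℕ, D.f i ^ n • u = 0

/-- A bar involution `u ↦ ū` of `M`: an additive involution with `(a u)⁻ = ā ū` for
`a ∈ U_q(g)`. -/
structure BarInvolution where
  hom : M →+ M
  involutive : ∀ u, hom (hom u) = u
  map_smul : ∀ (a : D.Uq) (u : M), hom (a • u) = D.bar a • hom u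

variable {M}

/-- The `Ā`-submodule `L̄`, the image of `L` under the bar involution. -/
def BarInvolution.image (c : D.BarInvolution M) (L : Submodule ringA M) :
    Submodule ringAbar M where
  carrier := c.hom '' (L : Set M)
  add_mem' := by
    rintro _ _ ⟨u, hu, rfl⟩ ⟨v, hv, rfl⟩
    exact ⟨u + v, L.add_mem hu hv, c.hom.map_add u v⟩
  zero_mem' := ⟨0, L.zero_mem, c.hom.map_zero⟩
  smul_mem' := by
    rintro ⟨_, a, ha, rfl⟩ _ ⟨u, hu, rfl⟩
    refine ⟨a • u, L.smul_mem (⟨a, ha⟩ : ringA) hu, ?_⟩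
    rw [← algebraMap_smul D.Uq a u, c.map_smul, bar_algebraMap, algebraMap_smul]
    rfl

/-- The graph of `ẽ_i`: the linear relation spanned by the pairs
`(f_i^{(n)} u, f_i^{(n-1)} u)` with `u` of weight `ξ`, `e_i u = 0` and `0 ≤ n ≤ ⟨h_i, ξ⟩`, where `f_i^{(-1)} = 0`. If `M` is integrable, then every
element of `M` is uniquely a sum of such elements `f_i^{(n)} u`, and this relation is the graph of
the operator `ẽ_i`. -/
def eGraph (i : I) : Submodule K (M × M) :=
  Submodule.span K {p | ∃ (ξ : P) (u : M) (n : ℕ), u ∈ D.wtSpace M ξ ∧ D.e i • u = 0 ∧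
    (n : ℤ) ≤ D.coroot i ξ ∧
    p = (D.fDiv i n • u, if n = 0 then 0 else D.fDiv i (n - 1) • u)}

/-- The graph of `f̃_i`: the linear relation spanned by the pairs
`(f_i^{(n)} u, f_i^{(n+1)} u)` with `u` of weight `ξ`, `e_i u = 0` and `0 ≤ n ≤ ⟨h_i, ξ⟩`. -/
def fGraph (i : I) : Submodule K (M × M) :=
  Submodule.span K {p | ∃ (ξ : P) (u : M) (n : ℕ), u ∈ D.wtSpace M ξ ∧ D.e i • u = 0 ∧
    (n : ℤ) ≤ D.coroot i ξ ∧ p = (D.fDiv i n • u, D.fDiv i (n + 1) • u)}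

/-- Kashiwara's operator `ẽ_i` on an integrable module: `ẽ_i u` is the unique element with
`(u, ẽ_i u)` in the graph. -/
def eTilde (i : I) (u : M) : M := Classical.epsilon fun v => (u, v) ∈ D.eGraph i

/-- Kashiwara's operator `f̃_i` on an integrable module. -/
def fTilde (i : I) (u : M) : M := Classical.epsilon fun v => (u, v) ∈ D.fGraph i

variable (L : Submodule ringA M)

/-- The operator on `L / q_s L` induced by an operator `T` on `M` that preserves `L`
(and `q_s L`): the class of `u` goes to the class of `T u`. -/
def inducedOp {M : Type*} [AddCommGroup M] [Module K M] (L : Submodule ringA M)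
    (T : M → M) (b : Red L) : Red L :=
  Classical.epsilon fun b' => ∃ u v : L, red L u = b ∧ red L v = b' ∧ T u = v

/-- The operator `ẽ_i` on `L / q_s L`. -/
def eRed (i : I) : Red L → Red L := inducedOp L (D.eTilde i)

/-- The operator `f̃_i` on `L / q_s L`. -/
def fRed (i : I) : Red L → Red L := inducedOp L (D.fTilde i)

/-- `ε_i(b) = max {n ; ẽ_i^n b ≠ 0}`. -/
def eps (i : I) (b : Red L) : ℕ := sSup {n : ℕ | (D.eRed L i)^[n] b ≠ 0}

/-- `φ_i(b) = max {n ; f̃_i^n b ≠ 0}`. -/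
def phi (i : I) (b : Red L) : ℕ := sSup {n : ℕ | (D.fRed L i)^[n] b ≠ 0}

/-- `b` belongs to `L_ξ / q_s L_ξ ⊆ L / q_s L`. -/
def HasWt (b : Red L) (ξ : P) : Prop := ∃ u : L, (u : M) ∈ D.wtSpace M ξ ∧ red L u = b

/-- `(L, B)` is a (lower) crystal base of `M`. -/
structure IsCrystalBase (B : Set (Red L)) : Prop where
  /-- `L` is a free `A`-module with `K ⊗_A L ≃ M`. -/
  free : Module.Free ringA L
  span_L : Submodule.span K (L : Set M) = ⊤
  /-- `L` is the direct sum of the `L_ξ = L ∩ M_ξ`. -/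
  weights_L : ⨆ ξ, L ⊓ (D.wtSpace M ξ).restrictScalars ringA = L
  /-- `B` is a basis of the `ℚ`-vector space `L / q_s L`. -/
  basis : ∀ x : Red L, ∃! c : B →₀ ℚ, x = c.sum fun b t => algebraMap ℚ ringA t • (b : Red L)
  /-- `B` is the union of the `B_ξ = B ∩ (L_ξ / q_s L_ξ)`. -/
  weights_B : ∀ b ∈ B, ∃ ξ, D.HasWt L b ξ
  e_mem_L : ∀ i, ∀ u ∈ L, D.eTilde i u ∈ L
  f_mem_L : ∀ i, ∀ u ∈ L, D.fTilde i u ∈ L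
  e_mem_B : ∀ i, ∀ b ∈ B, D.eRed L i b ∈ B ∨ D.eRed L i b = 0
  f_mem_B : ∀ i, ∀ b ∈ B, D.fRed L i b ∈ B ∨ D.fRed L i b = 0
  e_iff_f : ∀ i, ∀ b ∈ B, ∀ b' ∈ B, b' = D.fRed L i b ↔ b = D.eRed L i b'

/-- The simple reflection `s_i` of `P`. -/
def refl (i : I) (ξ : P) : P := ξ - D.coroot i ξ • D.root i

/-- The action of `w = s_{i_1} ⋯ s_{i_l}` on `P`, for a word `[i_1, …, i_l]`. -/
def wordAct (w : List I) (ξ : P) : P := w.foldr D.refl ξ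

/-- A vector `b ∈ B` of weight `ξ` is extremal: there are vectors
`b_w = S_{i_1} ⋯ S_{i_l} b`, for the words `w = s_{i_1} ⋯ s_{i_l}` in the simple reflections, with
`b_1 = b` such that `ẽ_i b_w = 0` and `f̃_i^{⟨h_i, wξ⟩} b_w = b_{s_i w}` if `⟨h_i, wξ⟩ ≥ 0`, and
`f̃_i b_w = 0` and `ẽ_i^{-⟨h_i, wξ⟩} b_w = b_{s_i w}` if `⟨h_i, wξ⟩ ≤ 0`. (The Weyl group acts on
the crystal `B` through the `S_i`, so `b_w` depends only on the Weyl group element of the word.) -/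
def IsExtremal (b : Red L) (ξ : P) : Prop :=
  ∃ x : List I → Red L, x [] = b ∧ ∀ (w : List I) (i : I),
    (0 ≤ D.coroot i (D.wordAct w ξ) →
      D.eRed L i (x w) = 0 ∧
        (D.fRed L i)^[(D.coroot i (D.wordAct w ξ)).toNat] (x w) = x (i :: w)) ∧
    (D.coroot i (D.wordAct w ξ) ≤ 0 →
      D.fRed L i (x w) = 0 ∧
        (D.eRed L i)^[(-D.coroot i (D.wordAct w ξ)).toNat] (x w) = x (i :: w))

/-- `ξ` is an extremal weight of `B`: the weight of an extremal vector of `B`. -/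
def IsExtremalWt (B : Set (Red L)) (ξ : P) : Prop :=
  ∃ b ∈ B, D.HasWt L b ξ ∧ D.IsExtremal L b ξ

/-- A `U_q(g)_ℚ`-submodule, regarded as a `K_ℚ`-submodule. -/
def toKQ (MQ : Submodule D.UqQ M) : Submodule KQ M where
  carrier := MQ
  add_mem' := MQ.add_mem
  zero_mem' := MQ.zero_mem
  smul_mem' := by
    intro c u hu
    have h : (algebraMap KQ D.UqQ c) • u = c • u := algebraMap_smul D.Uq (c : K) u
    rw [← h]
    exact MQ.smul_mem _ hu

end Modules

end RootDatum

end QG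
end

set_option linter.unusedSectionVars false

namespace QG

/-! ### Arithmetic of `K` and `A` -/

/-! Call an element global if it lies in `L` and in a fixed `KQ`-lattice `N` and is bar-invariant.
Here `N` is the part of `M_ℚ` generated over `U_q(g)_ℚ` by the weight spaces outside `S`. The heart
of the proof is one claim: every element of every `L_μ` is congruent modulo `q_s L` to a global
element of weight `μ` (`Lifts`, proved in `lifts_wtSpace`). Uniqueness of such representatives comes
from (vi), and (ii) with (vi) forces elements of `L ∩ L̄ ∩ M_ℚ` to be bar-invariant
(`hom_eq_of_mem`).

The claim is proved by descending induction on `(μ, μ)`, which is bounded by (i) and moves in steps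
of at least `2/d`. By `form_add_smul_root`, the norm grows strictly when one moves along an
`α_i`-string beyond the segment between `μ` and `s_i μ`. The part of `f_i^n M` of weight `μ` comes
from the weights `μ + k α_i` with `k ≥ n`, so the induction hypothesis covers it once these weights
lie outside that segment (`Side.lifts_range`). The mechanism: for global `u`, the divided power
`f_i^{(n)} u` is bar-invariant and agrees with `f̃_i^n u` modulo `f_i^{n+1} M`, and global elements
already found there absorb the discrepancy (`Lifts.exists_correction`). The same holds for `e_i`.

Suppose some `b ∈ B` of weight `μ` has no global lift. If `⟨h_i, μ⟩ ≥ 0` and `ẽ_i b ≠ 0`, then `b =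
f̃_i ẽ_i b` would lift through `f_i M`; so `ẽ_i b = 0`, and symmetrically for `f̃_i`. The weight
`s_i μ` has the same norm, so the induction hypothesis does not reach it, but a global lift of the
reflected vector would produce one of `b` (`Side.hasGlobal_of_refl`). Hence no vector of the Weyl
orbit of `b` lifts, which makes `b` extremal. Then (v) and (iv) provide a lift after all.

Given the claim, global elements span `M_ℚ` over `KQ` (`Lifts.mem_globalSpan`), so `M_ℚ = N`, which
is (c). The same argument inside the images of `f_i^n` and `e_i^n`, with the crystal telling which
`G(b)` lie there, gives (b) (`Side.span_global_eq_range`). -/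

lemma zpow_qs_injective : Function.Injective fun n : ℤ => (qs ^ n : K) := by
  have hT := RatFunc.transcendental_X (K := ℚ)
  have key : ∀ n : ℕ, (qs ^ n : K) = 1 → n = 0 := by
    intro n hn
    by_contra h0
    apply hT
    refine ⟨Polynomial.X ^ n - 1, ?_, ?_⟩
    · exact Polynomial.X_pow_sub_C_ne_zero (Nat.pos_of_ne_zero h0) 1
    · have : (RatFunc.X : K) ^ n = 1 := hn
      simp [this]
  have key' : ∀ n : ℤ, (qs ^ n : K) = 1 → n = 0 := by
    intro n hn
    obtain ⟨k, rfl | rfl⟩ := n.eq_nat_or_neg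
    · simpa using key k (by simpa using hn)
    · simpa using key k (by simpa using hn)
  intro m n h
  have h1 : (qs ^ (m - n) : K) = 1 := by
    rw [zpow_sub₀ qs_ne_zero]
    exact (div_eq_one_iff_eq (zpow_ne_zero _ qs_ne_zero)).mpr h
  have := key' _ h1
  omega

/-- The residue is `t = f(0)/g(0)`, because then `X` divides `f - t g`. -/
lemma exists_rat_add_qs_mul {a : K} (ha : a ∈ ringA) :
    ∃ t : ℚ, ∃ a' ∈ ringA, a = algebraMap ℚ K t + qs * a' := by
  obtain ⟨f, g, hg, rfl⟩ := ha
  have hg' : algebraMap ℚ[X] K g ≠ 0 := by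
    intro h
    have : g = 0 := by simpa using h
    simp [this] at hg
  set t : ℚ := f.coeff 0 / g.coeff 0
  have h0 : (f - Polynomial.C t * g).coeff 0 = 0 := by
    simp [t, div_mul_cancel₀ _ hg]
  obtain ⟨p, hp⟩ := Polynomial.X_dvd_iff.mpr h0
  refine ⟨t, algebraMap ℚ[X] K p / algebraMap ℚ[X] K g, ⟨p, g, hg, rfl⟩, ?_⟩
  have hf : f = Polynomial.C t * g + Polynomial.X * p := by rw [← hp]; ring
  have hC : algebraMap ℚ[X] K (Polynomial.C t) = algebraMap ℚ K t := by
    rw [IsScalarTower.algebraMap_apply ℚ ℚ[X] K]; rfl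
  have hX : algebraMap ℚ[X] K Polynomial.X = qs := RatFunc.algebraMap_X
  rw [hf, map_add, map_mul, map_mul, hC, hX]
  field_simp

lemma exists_qs_pow_mul_mem_ringA (a : K) : ∃ n : ℕ, qs ^ n * a ∈ ringA := by
  obtain ⟨f, g, hg0, rfl⟩ := IsFractionRing.div_surjective (A := ℚ[X]) a
  have hg : g ≠ 0 := nonZeroDivisors.ne_zero hg0
  obtain ⟨h, hh, hX⟩ := Polynomial.exists_eq_pow_rootMultiplicity_mul_and_not_dvd g hg 0
  set n := Polynomial.rootMultiplicity 0 g
  rw [Polynomial.C_0, sub_zero] at hh hX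
  refine ⟨n, f, h, fun h0 => hX (Polynomial.X_dvd_iff.mpr h0), ?_⟩
  have hX' : algebraMap ℚ[X] K Polynomial.X = qs := RatFunc.algebraMap_X
  have hh0 : algebraMap ℚ[X] K h ≠ 0 := by
    intro h0
    apply hX
    have : h = 0 := by simpa using h0
    simp [this]
  rw [hh, map_mul, map_pow, hX']
  field_simp [qs_ne_zero]

/-- `A` is separated in the `q_s`-adic topology: the numerator would be divisible by a power of `X`
exceeding its degree. -/
lemma eq_zero_of_forall_qs_pow {a : K}
    (h : ∀ n : ℕ, ∃ a' ∈ ringA, a = qs ^ n * a') : a = 0 := by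
  obtain ⟨_, ⟨f, g, hg, rfl⟩, ha⟩ := h 0
  rw [pow_zero, one_mul] at ha
  have ne : ∀ g : ℚ[X], g.coeff 0 ≠ 0 → algebraMap ℚ[X] K g ≠ 0 := by
    intro g hg h
    have : g = 0 := by simpa using h
    simp [this] at hg
  by_contra h0
  have hf : f ≠ 0 := by
    rintro rfl
    simp [ha] at h0
  obtain ⟨_, ⟨f', g', hg', rfl⟩, h1⟩ := h (f.natDegree + 1)
  rw [ha, mul_div_assoc', div_eq_div_iff (ne g hg) (ne g' hg')] at h1
  have hX' : qs = algebraMap ℚ[X] K Polynomial.X := RatFunc.algebraMap_X.symm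
  rw [hX', ← map_pow, ← map_mul, ← map_mul, ← map_mul] at h1
  have h2 := RatFunc.algebraMap_injective (K := ℚ) h1
  have h3 : Polynomial.X ^ (f.natDegree + 1) ∣ f * g' := ⟨f' * g, by rw [h2]; ring⟩
  have hcop : IsCoprime (Polynomial.X ^ (f.natDegree + 1)) g' := by
    apply IsCoprime.pow_left
    rw [Polynomial.irreducible_X.coprime_iff_not_dvd]
    exact fun hd => hg' (Polynomial.X_dvd_iff.mp hd)
  have h4 := Polynomial.natDegree_le_of_dvd (hcop.dvd_of_dvd_mul_right h3) hf
  simp at h4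

/-- `q_s - 1` is a unit of `A`, so the division by it in hypothesis (ii) stays inside `L`. -/
lemma inv_qs_sub_one_mem_ringA : (qs - 1)⁻¹ ∈ ringA := by
  refine ⟨1, Polynomial.X - 1, by simp, ?_⟩
  have hX' : algebraMap ℚ[X] K Polynomial.X = qs := RatFunc.algebraMap_X
  simp [hX']

lemma qs_sub_one_ne_zero : qs - 1 ≠ 0 := by
  intro h
  have h1 : (qs ^ (1 : ℤ) : K) = qs ^ (0 : ℤ) := by simpa using sub_eq_zero.mp h
  have := zpow_qs_injective h1
  omega

/-! ### Quantum integers -/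

/-- The quantum integer `[n]` for `n ∈ ℤ`. -/
noncomputable def zInt (t : K) (n : ℤ) : K := (t ^ n - t ^ (-n)) / (t - t⁻¹)

namespace RootDatum

variable {I P : Type*} [AddCommGroup P] (D : RootDatum I P)

lemma r_pos (i : I) : 0 < D.r i := by
  have h := D.r_spec i
  have h1 := D.form_root_pos i
  have hd : (0 : ℚ) < D.d := by exact_mod_cast D.d_pos
  by_contra h0
  have : D.r i = 0 := by omega
  rw [this] at h
  simp at h
  linarith

lemma qi_ne_zero (i : I) : D.qi i ≠ 0 := pow_ne_zero _ qs_ne_zero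

lemma zpow_qi_injective (i : I) : Function.Injective fun n : ℤ => (D.qi i ^ n : K) := by
  intro m n h
  have h1 : (qs ^ ((D.r i : ℤ) * m) : K) = qs ^ ((D.r i : ℤ) * n) := by
    rw [zpow_mul, zpow_mul]; simpa [qi] using h
  have h2 := zpow_qs_injective h1
  have := D.r_pos i
  exact mul_left_cancel₀ (by omega) h2

lemma qi_sub_inv_ne_zero (i : I) : D.qi i - (D.qi i)⁻¹ ≠ 0 := by
  intro h
  have h1 : (D.qi i ^ (1 : ℤ) : K) = D.qi i ^ (-1 : ℤ) := by simpa using sub_eq_zero.mp h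
  have := D.zpow_qi_injective i h1
  omega

lemma zInt_ne_zero (i : I) {n : ℤ} (hn : n ≠ 0) : zInt (D.qi i) n ≠ 0 := by
  refine div_ne_zero (fun h => ?_) (D.qi_sub_inv_ne_zero i)
  have := D.zpow_qi_injective i (sub_eq_zero.mp h)
  omega

lemma zInt_zero (i : I) : zInt (D.qi i) 0 = 0 := by simp [zInt]

lemma qInt_eq_zInt (i : I) (k : ℕ) : D.qInt i k = zInt (D.qi i) k := by
  simp [qInt, zInt]

lemma qInt_ne_zero (i : I) {k : ℕ} (hk : k ≠ 0) : D.qInt i k ≠ 0 := by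
  rw [qInt_eq_zInt]
  exact D.zInt_ne_zero i (by exact_mod_cast hk)

lemma qFact_ne_zero (i : I) (k : ℕ) : D.qFact i k ≠ 0 :=
  Finset.prod_ne_zero_iff.mpr fun _ _ => D.qInt_ne_zero i (Nat.succ_ne_zero _)

lemma qFact_succ (i : I) (k : ℕ) : D.qFact i (k + 1) = D.qFact i k * D.qInt i (k + 1) :=
  Finset.prod_range_succ _ _

/-- `[a][b] + [c] = [a + 1][b - 1]` whenever `c = b - a - 1`. -/
lemma zInt_mul_add (i : I) (a b c : ℤ) (hc : c = b - a - 1) :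
    zInt (D.qi i) a * zInt (D.qi i) b + zInt (D.qi i) c =
      zInt (D.qi i) (a + 1) * zInt (D.qi i) (b - 1) := by
  have h0 := D.qi_ne_zero i
  have h1 := D.qi_sub_inv_ne_zero i
  subst hc
  simp only [zInt]
  rw [div_mul_div_comm, div_mul_div_comm, div_add_div _ _ (mul_ne_zero h1 h1) h1,
    div_eq_div_iff (mul_ne_zero (mul_ne_zero h1 h1) h1) (mul_ne_zero h1 h1)]
  generalize D.qi i = t at *
  have e1 : t ^ (b - a - 1) = t ^ b * (t ^ a)⁻¹ * t⁻¹ := by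
    rw [zpow_sub₀ h0, zpow_sub₀ h0, zpow_one]; field_simp
  have e2 : t ^ (-(b - a - 1)) = (t ^ b)⁻¹ * t ^ a * t := by
    rw [zpow_neg, e1]; simp; ring
  have e3 : t ^ (a + 1) = t ^ a * t := zpow_add_one₀ h0 a
  have e4 : t ^ (-(a + 1)) = (t ^ a)⁻¹ * t⁻¹ := by rw [zpow_neg, e3, mul_inv]
  have e5 : t ^ (b - 1) = t ^ b * t⁻¹ := zpow_sub_one₀ h0 b
  have e6 : t ^ (-(b - 1)) = (t ^ b)⁻¹ * t := by rw [zpow_neg, e5, mul_inv, inv_inv]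
  rw [e1, e2, e3, e4, e5, e6, zpow_neg, zpow_neg]
  have ha := zpow_ne_zero a h0
  have hb := zpow_ne_zero b h0
  field_simp
  ring

/-- The eigenvalues `[k][m - k + 1]` of `f_i e_i` separate the strings through a weight space. -/
lemma zInt_mul_injective (i : I) {l k k' : ℤ} (h : 0 < l + 2 * k + 1) (h' : 0 < l + 2 * k' + 1)
    (e : zInt (D.qi i) k * zInt (D.qi i) (l + k + 1) =
      zInt (D.qi i) k' * zInt (D.qi i) (l + k' + 1)) : k = k' := by
  have h0 := D.qi_ne_zero i
  have h1 := D.qi_sub_inv_ne_zero i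
  have inj := D.zpow_qi_injective i
  simp only [zInt] at e
  rw [div_mul_div_comm, div_mul_div_comm, div_left_inj' (mul_ne_zero h1 h1)] at e
  have expand : ∀ k : ℤ, (D.qi i ^ k - D.qi i ^ (-k)) *
      (D.qi i ^ (l + k + 1) - D.qi i ^ (-(l + k + 1))) =
      D.qi i ^ (l + 2 * k + 1) + D.qi i ^ (-(l + 2 * k + 1)) -
        (D.qi i ^ (l + 1) + D.qi i ^ (-(l + 1))) := by
    intro k
    rw [sub_mul, mul_sub, mul_sub, ← zpow_add₀ h0, ← zpow_add₀ h0, ← zpow_add₀ h0,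
      ← zpow_add₀ h0]
    ring_nf
  rw [expand, expand, sub_left_inj] at e
  set a := l + 2 * k + 1
  set b := l + 2 * k' + 1
  -- The identity `t^a + t^{-a} = t^b + t^{-b}` factors. The second factor cannot vanish, since `a +
  -- b > 0`.
  have hf : (D.qi i ^ a - D.qi i ^ b) * (1 - D.qi i ^ (-(a + b))) = 0 := by
    rw [sub_mul, mul_sub, mul_sub, ← zpow_add₀ h0, ← zpow_add₀ h0]
    have e1 : a + -(a + b) = -b := by ring
    have e2 : b + -(a + b) = -a := by ring
    rw [e1, e2]
    linear_combination e
  rcases mul_eq_zero.mp hf with h2 | h2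
  · have := inj (sub_eq_zero.mp h2)
    omega
  · have h3 : (D.qi i ^ (0 : ℤ) : K) = D.qi i ^ (-(a + b)) := by simpa using sub_eq_zero.mp h2
    have := inj h3
    omega

lemma coroot_root (i : I) : D.coroot i (D.root i) = 2 := by
  have h := D.coroot_apply i (D.root i)
  rw [mul_div_assoc, div_self (D.form_root_pos i).ne'] at h
  exact_mod_cast h

/-- Since `2(α_i, μ) = ⟨h_i, μ⟩(α_i, α_i)`, the growth of the norm along a string is governed by the
sign of `k(⟨h_i, μ⟩ + k)`. The induction on the norm rests on this. -/
lemma form_add_smul_root (i : I) (μ : P) (k : ℤ) :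
    D.form (μ + k • D.root i) (μ + k • D.root i) = D.form μ μ +
      k * (D.coroot i μ + k) * (2 * D.r i / D.d) := by
  have h := D.coroot_apply i μ
  have hr := D.r_spec i
  have hp := (D.form_root_pos i).ne'
  rw [eq_div_iff hp] at h
  simp only [map_add, map_smul, LinearMap.add_apply, LinearMap.smul_apply, zsmul_eq_mul]
  rw [D.form_symm μ (D.root i)]
  have : (2 * D.r i / D.d : ℚ) = D.form (D.root i) (D.root i) := by
    rw [mul_div_assoc, ← hr]; ring
  rw [this]
  linear_combination (-(k : ℚ)) * h

lemma form_refl (i : I) (μ : P) : D.form (D.refl i μ) (D.refl i μ) = D.form μ μ := by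
  have h := D.form_add_smul_root i μ (-D.coroot i μ)
  rw [neg_smul, ← sub_eq_add_neg] at h
  rw [refl, h]
  push_cast
  ring

end RootDatum

/-! ### Abstract strings -/

section Strings

variable {M : Type*} [AddCommGroup M] [Module K M]

/-- `v 0, …, v m` is a string for the operators `x`, `y` (`x v_k = a_{k+1} v_{k+1}`,
`y v_{k+1} = a_{m-k} v_k`) and `X`, `Y` are its unit shifts. -/
structure IsString (X Y x y : Module.End K M) (a : ℕ → K) (m : ℕ) (v : ℕ → M) : Prop where
  X_lt : ∀ k < m, X (v k) = v (k + 1)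
  X_top : X (v m) = 0
  Y_lt : ∀ k < m, Y (v (k + 1)) = v k
  Y_zero : Y (v 0) = 0
  x_lt : ∀ k < m, x (v k) = a (k + 1) • v (k + 1)
  x_top : x (v m) = 0
  y_lt : ∀ k < m, y (v (k + 1)) = a (m - k) • v k
  y_zero : y (v 0) = 0

namespace IsString

variable {X Y x y : Module.End K M} {a : ℕ → K} {m : ℕ} {v : ℕ → M}

/-- Read backwards, a string exchanges the roles of `f_i` and `e_i`, so every fact about `f_i` also
yields one about `e_i`. -/
lemma reverse (h : IsString X Y x y a m v) :
    IsString Y X y x a m (fun k => v (m - k)) where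
  X_lt k hk := by
    have := h.Y_lt (m - (k + 1)) (by omega)
    rwa [show m - (k + 1) + 1 = m - k by omega] at this
  X_top := by simpa using h.Y_zero
  Y_lt k hk := by
    have := h.X_lt (m - (k + 1)) (by omega)
    rwa [show m - (k + 1) + 1 = m - k by omega] at this
  Y_zero := by simpa using h.X_top
  x_lt k hk := by
    have := h.y_lt (m - (k + 1)) (by omega)
    rwa [show m - (k + 1) + 1 = m - k by omega, show m - (m - (k + 1)) = k + 1 by omega] at this
  x_top := by simpa using h.y_zero
  y_lt k hk := by
    have := h.x_lt (m - (k + 1)) (by omega)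
    rwa [show m - (k + 1) + 1 = m - k by omega] at this
  y_zero := by simpa using h.x_top

lemma X_pow (h : IsString X Y x y a m v) (n : ℕ) {k : ℕ} (hk : k + n ≤ m) :
    (X ^ n) (v k) = v (k + n) := by
  induction n with
  | zero => simp
  | succ n ih =>
    rw [pow_succ', Module.End.mul_apply, ih (by omega), h.X_lt _ (by omega)]
    rfl

lemma X_pow_eq_zero (h : IsString X Y x y a m v) {n k : ℕ} (hk : k ≤ m) (hn : m < k + n) :
    (X ^ n) (v k) = 0 := by
  obtain ⟨j, rfl⟩ : ∃ j, n = j + (1 + (m - k)) := ⟨n - (1 + (m - k)), by omega⟩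
  rw [pow_add, pow_add, Module.End.mul_apply, Module.End.mul_apply, h.X_pow (m - k) (by omega),
    show k + (m - k) = m by omega, pow_one, h.X_top, map_zero]

lemma Y_pow (h : IsString X Y x y a m v) (n : ℕ) {k : ℕ} (hk : k + n ≤ m) :
    (Y ^ n) (v (k + n)) = v k := by
  induction n with
  | zero => simp
  | succ n ih =>
    rw [pow_succ, Module.End.mul_apply, ← add_assoc, h.Y_lt _ (by omega), ih (by omega)]

lemma x_pow (h : IsString X Y x y a m v) (n : ℕ) {k : ℕ} (hk : k + n ≤ m) :
    (x ^ n) (v k) = (∏ j ∈ Finset.range n, a (k + j + 1)) • v (k + n) := by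
  induction n with
  | zero => simp
  | succ n ih =>
    rw [pow_succ', Module.End.mul_apply, ih (by omega), map_smul, h.x_lt _ (by omega), smul_smul,
      Finset.prod_range_succ]
    rfl

lemma x_pow_eq_zero (h : IsString X Y x y a m v) {n k : ℕ} (hk : k ≤ m) (hn : m < k + n) :
    (x ^ n) (v k) = 0 := by
  obtain ⟨j, rfl⟩ : ∃ j, n = j + (1 + (m - k)) := ⟨n - (1 + (m - k)), by omega⟩
  rw [pow_add, pow_add, Module.End.mul_apply, Module.End.mul_apply, h.x_pow (m - k) (by omega),
    show k + (m - k) = m by omega, pow_one, map_smul, h.x_top, smul_zero, map_zero]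

/-- The image of `x^n` in the string lies in the span of `v n, …, v m`, where `X^n` undoes `Y^n`. -/
lemma X_pow_Y_pow_x_pow (h : IsString X Y x y a m v) (n : ℕ) {k : ℕ} (hk : k ≤ m) :
    (X ^ n) ((Y ^ n) ((x ^ n) (v k))) = (x ^ n) (v k) := by
  by_cases hn : k + n ≤ m
  · rw [h.x_pow n hn, map_smul, map_smul, h.Y_pow n hn, h.X_pow n hn]
  · rw [h.x_pow_eq_zero hk (by omega), map_zero, map_zero]

lemma X_pow_mem_range (h : IsString X Y x y a m v) (ha : ∀ j, a (j + 1) ≠ 0) (n : ℕ) {k : ℕ}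
    (hk : k ≤ m) : (X ^ n) (v k) ∈ LinearMap.range (x ^ n) := by
  by_cases hn : k + n ≤ m
  · have h0 : (∏ j ∈ Finset.range n, a (k + j + 1)) ≠ 0 :=
      Finset.prod_ne_zero_iff.mpr fun _ _ => ha _
    refine ⟨(∏ j ∈ Finset.range n, a (k + j + 1))⁻¹ • v k, ?_⟩
    rw [map_smul, h.x_pow n hn, h.X_pow n hn, smul_smul, inv_mul_cancel₀ h0, one_smul]
  · rw [h.X_pow_eq_zero hk (by omega)]
    exact zero_mem _

/-- The divided power of `x` and the shift `X^n` agree on `v 0`. On `v (k+1)` both give multiples of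
`v (k+1+n)`, which is already reached from `v k` by `n + 1` steps. -/
lemma sub_mem_range (h : IsString X Y x y a m v) (ha : ∀ j, a (j + 1) ≠ 0) (n : ℕ) {k : ℕ}
    (hk : k ≤ m) : (∏ j ∈ Finset.range n, a (j + 1))⁻¹ • (x ^ n) (v k) - (X ^ n) (v k) ∈
      LinearMap.range (x ^ (n + 1)) := by
  by_cases hn : k + n ≤ m
  · rw [h.x_pow n hn, h.X_pow n hn]
    rcases k with _ | k
    · have h0 : (∏ j ∈ Finset.range n, a (j + 1)) ≠ 0 :=
        Finset.prod_ne_zero_iff.mpr fun _ _ => ha _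
      simp [smul_smul, h0]
    · have h1 := h.X_pow_mem_range ha (n + 1) (k := k) (by omega)
      rw [h.X_pow (n + 1) (by omega), show k + (n + 1) = k + 1 + n by omega] at h1
      exact sub_mem (Submodule.smul_mem _ _ (Submodule.smul_mem _ _ h1)) h1
  · rw [h.X_pow_eq_zero hk (by omega), h.x_pow_eq_zero hk (by omega)]
    simp

end IsString

end Strings

/-! ### The action of the generators -/

/-- Linear maps on the summands of an internal direct sum glue. -/
lemma _root_.DirectSum.IsInternal.exists_linearMap {R ι M : Type*} [Ring R] [DecidableEq ι]
    [AddCommGroup M] [Module R M] {W : ι → Submodule R M} (h : DirectSum.IsInternal W)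
    (T : ι → M →ₗ[R] M) : ∃ F : M →ₗ[R] M, ∀ j, ∀ x ∈ W j, F x = T j x := by
  let e := LinearEquiv.ofBijective (DirectSum.coeLinearMap W) h
  refine ⟨(DirectSum.toModule R ι M fun j => (T j).comp (W j).subtype).comp e.symm.toLinearMap,
    fun j x hx => ?_⟩
  have : e.symm x = DirectSum.lof R ι (fun j => W j) j ⟨x, hx⟩ := by
    rw [LinearEquiv.symm_apply_eq]
    exact (DirectSum.coeLinearMap_lof W j ⟨x, hx⟩).symm
  simp [this]

namespace RootDatum

variable {I P : Type*} [AddCommGroup P] (D : RootDatum I P)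

lemma qh_zero : D.qh 0 = 1 := by
  simpa [qh] using D.proj_rel Rel.q_zero

lemma qh_mul (H H' : Module.Dual ℤ P) : D.qh H * D.qh H' = D.qh (H + H') := by
  simpa [qh] using D.proj_rel (Rel.q_add H H')

lemma qh_neg_mul_qh (H : Module.Dual ℤ P) : D.qh (-H) * D.qh H = 1 := by
  rw [qh_mul, neg_add_cancel, qh_zero]

lemma qh_mul_e (H : Module.Dual ℤ P) (i : I) :
    D.qh H * D.e i = (qs ^ (H (D.root i)) : K) • (D.e i * D.qh H) := by
  have h := D.proj_rel (Rel.q_e H i)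
  simp only [map_mul, map_smul] at h
  change D.qh H * D.e i * D.qh (-H) = (qs ^ (H (D.root i)) : K) • D.e i at h
  have h2 := congrArg (· * D.qh H) h
  simpa [mul_assoc, qh_neg_mul_qh] using h2

lemma qh_mul_f (H : Module.Dual ℤ P) (i : I) :
    D.qh H * D.f i = (qs ^ (-(H (D.root i))) : K) • (D.f i * D.qh H) := by
  have h := D.proj_rel (Rel.q_f H i)
  simp only [map_mul, map_smul] at h
  change D.qh H * D.f i * D.qh (-H) = (qs ^ (-(H (D.root i))) : K) • D.f i at h
  have h2 := congrArg (· * D.qh H) h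
  simpa [mul_assoc, qh_neg_mul_qh] using h2

lemma e_mul_f_sub (i : I) : D.e i * D.f i - D.f i * D.e i =
    (D.qi i - (D.qi i)⁻¹)⁻¹ • (D.qh (D.tH i) - D.qh (-(D.tH i))) := by
  have h := D.proj_rel (Rel.ef i)
  simp only [map_mul, map_smul, map_sub] at h
  exact h

section Modules

variable (M : Type*) [AddCommGroup M] [Module K M] [Module D.Uq M] [IsScalarTower K D.Uq M]

/-- The action of `U_q(g)` on `M` by `K`-linear maps. -/
noncomputable def act : D.Uq →ₐ[K] Module.End K M :=
  letI : SMulCommClass D.Uq K M := IsScalarTower.to_smulCommClass'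
  Algebra.lsmul K K M

variable {M}

lemma act_apply (a : D.Uq) (u : M) : D.act M a u = a • u := rfl

lemma act_pow_apply (a : D.Uq) (n : ℕ) (u : M) : (D.act M a ^ n) u = a ^ n • u := by
  rw [← map_pow, act_apply]

lemma e_smul_mem {i : I} {ξ : P} {u : M} (hu : u ∈ D.wtSpace M ξ) :
    D.e i • u ∈ D.wtSpace M (ξ + D.root i) := by
  intro H
  rw [← mul_smul, qh_mul_e, smul_assoc, mul_smul, hu H, ← D.act_apply (D.e i), map_smul, smul_smul,
    ← zpow_add₀ qs_ne_zero, act_apply, map_add, add_comm]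

lemma f_smul_mem {i : I} {ξ : P} {u : M} (hu : u ∈ D.wtSpace M ξ) :
    D.f i • u ∈ D.wtSpace M (ξ - D.root i) := by
  intro H
  rw [← mul_smul, qh_mul_f, smul_assoc, mul_smul, hu H, ← D.act_apply (D.f i), map_smul, smul_smul,
    ← zpow_add₀ qs_ne_zero, act_apply, map_sub, sub_eq_add_neg, add_comm]

/-- On weight `ξ` the element `t_i` acts by `q_i^{⟨h_i, ξ⟩}`, so the commutator of `e_i` and `f_i`
becomes a quantum integer. -/
lemma e_f_smul {i : I} {ξ : P} {u : M} (hu : u ∈ D.wtSpace M ξ) :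
    D.e i • D.f i • u = D.f i • D.e i • u + zInt (D.qi i) (D.coroot i ξ) • u := by
  have h := congrArg (· • u) (D.e_mul_f_sub i)
  simp only [sub_smul, mul_smul, smul_assoc] at h
  rw [hu, hu] at h
  have e1 : (qs ^ (D.tH i ξ) : K) = D.qi i ^ (D.coroot i ξ) := by
    simp [tH, qi, zpow_mul]
  have e2 : (qs ^ ((-D.tH i) ξ) : K) = D.qi i ^ (-(D.coroot i ξ)) := by
    rw [LinearMap.neg_apply, zpow_neg, e1, zpow_neg]
  rw [e1, e2, ← sub_smul, smul_smul] at h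
  rw [zInt, div_eq_inv_mul, mul_smul, ← h, mul_smul]
  abel

lemma f_pow_smul_mem {i : I} {ξ : P} {u : M} (hu : u ∈ D.wtSpace M ξ) (n : ℕ) :
    D.f i ^ n • u ∈ D.wtSpace M (ξ - n • D.root i) := by
  induction n with
  | zero => simpa using hu
  | succ n ih =>
    rw [pow_succ', mul_smul, succ_nsmul, ← sub_sub]
    exact D.f_smul_mem ih

lemma fDiv_smul (i : I) (n : ℕ) (u : M) :
    D.fDiv i n • u = (D.qFact i n)⁻¹ • D.f i ^ n • u := smul_assoc _ _ _

lemma eDiv_smul (i : I) (n : ℕ) (u : M) :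
    D.eDiv i n • u = (D.qFact i n)⁻¹ • D.e i ^ n • u := smul_assoc _ _ _

lemma smul_comm_act (a : D.Uq) (c : K) (u : M) : a • c • u = c • a • u := by
  rw [← D.act_apply, map_smul, act_apply]

/-- `e_i f_i^{j+1} u = [j+1][⟨h_i,ξ⟩ - j] f_i^j u` when `f_i e_i u = 0`. -/
lemma e_f_pow_succ {i : I} {ξ : P} {u : M} (hu : u ∈ D.wtSpace M ξ)
    (h0 : D.f i • D.e i • u = 0) (j : ℕ) :
    D.e i • D.f i ^ (j + 1) • u =
      (zInt (D.qi i) (j + 1) * zInt (D.qi i) (D.coroot i ξ - j)) • D.f i ^ j • u := by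
  induction j with
  | zero =>
    have h1 : zInt (D.qi i) 1 = 1 := by
      simp [zInt, div_self (D.qi_sub_inv_ne_zero i)]
    simp [e_f_smul D hu, h0, h1]
  | succ j ih =>
    rw [pow_succ', mul_smul, e_f_smul D (D.f_pow_smul_mem hu (j + 1)), ih, smul_comm_act,
      ← mul_smul (D.f i), ← pow_succ', ← add_smul]
    congr 1
    -- With `l = ⟨h_i, ξ⟩` this is `[j+1][l-j] + [l-2(j+1)] = [j+2][l-j-1]`.
    have := D.zInt_mul_add i (j + 1) (D.coroot i ξ - j)
      (D.coroot i (ξ - (j + 1) • D.root i)) (by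
        rw [map_sub, map_nsmul, coroot_root]; simp; ring)
    rw [this]
    push_cast
    ring_nf

/-- Neither factor of `[n+1][⟨h_i, ξ⟩ - n]` vanishes for negative `⟨h_i, ξ⟩`, so `f_i^{n+1} u = 0`
descends to `u = 0`. Only `f_i e_i u = 0` is assumed, since the string decomposition meets vectors
for which `e_i u = 0` is not known. -/
lemma eq_zero_of_coroot_neg (hM : D.Integrable M) {i : I} {ξ : P} {u : M}
    (hu : u ∈ D.wtSpace M ξ) (h0 : D.f i • D.e i • u = 0) (hξ : D.coroot i ξ < 0) : u = 0 := by
  obtain ⟨n, hn⟩ := hM.f_nilpotent i u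
  induction n with
  | zero => simpa using hn
  | succ n ih =>
    apply ih
    have h := D.e_f_pow_succ hu h0 n
    rw [hn, smul_zero, eq_comm, smul_eq_zero] at h
    refine h.resolve_left (mul_ne_zero (D.zInt_ne_zero i ?_) (D.zInt_ne_zero i ?_)) <;> omega

/-- The vector `f_i^{m+1} u` is killed by `e_i` because `[0] = 0`, and `h_i` pairs with its weight
to `-m - 2 < 0`. -/
lemma f_pow_eq_zero (hM : D.Integrable M) {i : I} {ξ : P} {u : M}
    (hu : u ∈ D.wtSpace M ξ) (h0 : D.e i • u = 0) {m : ℕ} (hξ : D.coroot i ξ = m) :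
    D.f i ^ (m + 1) • u = 0 := by
  apply D.eq_zero_of_coroot_neg hM (i := i) (D.f_pow_smul_mem hu (m + 1))
  · rw [D.e_f_pow_succ hu (by rw [h0, smul_zero]), hξ, sub_self, zInt_zero]
    simp
  · rw [map_sub, map_nsmul, coroot_root, hξ]
    simp only [nsmul_eq_mul, Nat.cast_add, Nat.cast_one]
    omega

lemma e_fDiv_succ {i : I} {ξ : P} {u : M} (hu : u ∈ D.wtSpace M ξ)
    (h0 : D.e i • u = 0) (j : ℕ) :
    D.e i • D.fDiv i (j + 1) • u = zInt (D.qi i) (D.coroot i ξ - j) • D.fDiv i j • u := by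
  rw [fDiv_smul, fDiv_smul, smul_comm_act, D.e_f_pow_succ hu (by rw [h0, smul_zero]), smul_smul,
    smul_smul]
  congr 1
  have h1 := D.qInt_ne_zero i (Nat.succ_ne_zero j)
  have h2 := D.qFact_ne_zero i j
  rw [qFact_succ]
  rw [Nat.succ_eq_add_one, qInt_eq_zInt] at h1
  push_cast at h1
  rw [qInt_eq_zInt]
  push_cast
  field_simp

lemma f_fDiv (i : I) (j : ℕ) (u : M) :
    D.f i • D.fDiv i j • u = D.qInt i (j + 1) • D.fDiv i (j + 1) • u := by
  rw [fDiv_smul, fDiv_smul, smul_comm_act, ← mul_smul, ← pow_succ', smul_smul]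
  congr 1
  have h1 := D.qInt_ne_zero i (Nat.succ_ne_zero j)
  have h2 := D.qFact_ne_zero i j
  rw [qFact_succ]
  field_simp

lemma fDiv_zero (i : I) : D.fDiv i 0 = 1 := by simp [fDiv, qFact]

lemma fDiv_smul_mem {i : I} {ξ : P} {u : M} (hu : u ∈ D.wtSpace M ξ) (n : ℕ) :
    D.fDiv i n • u ∈ D.wtSpace M (ξ - n • D.root i) := by
  rw [fDiv_smul]
  exact Submodule.smul_mem _ _ (D.f_pow_smul_mem hu n)

/-- The span of the vectors `f_i^{(k)} w` of weight `μ` that occur in strings. -/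
noncomputable def stringSpan (M : Type*) [AddCommGroup M] [Module K M] [Module D.Uq M] [IsScalarTower K D.Uq M]
    (i : I) (μ : P) : Submodule K M :=
  Submodule.span K {z | ∃ (k : ℕ) (w : M), w ∈ D.wtSpace M (μ + k • D.root i) ∧ D.e i • w = 0 ∧
    (k : ℤ) ≤ D.coroot i (μ + k • D.root i) ∧ z = D.fDiv i k • w}

/-- A string vector is a nonzero multiple of `e_i` applied to the next one, except at the lower end
of its string. Such an end is killed by `f_i` and occurs only where `⟨h_i, ·⟩ ≤ 0`; these ends make
up `l`. -/
lemma exists_e_smul_add (hM : D.Integrable M) {i : I} {μ : P} {z : M}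
    (hz : z ∈ D.stringSpan M i (μ + D.root i)) :
    ∃ t ∈ D.stringSpan M i μ, ∃ l : M, D.f i • l = 0 ∧ z = D.e i • t + l ∧
      (l = 0 ∨ D.coroot i (μ + D.root i) ≤ 0) := by
  induction hz using Submodule.span_induction with
  | mem z hz =>
    obtain ⟨k, w, hw, hew, hk, rfl⟩ := hz
    by_cases hlt : (k : ℤ) < D.coroot i (μ + D.root i + k • D.root i)
    · have hadd : μ + D.root i + k • D.root i = μ + (k + 1) • D.root i := by
        rw [succ_nsmul]; abel
      have hne : zInt (D.qi i) (D.coroot i (μ + D.root i + k • D.root i) - k) ≠ 0 :=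
        D.zInt_ne_zero i (by omega)
      refine ⟨(zInt (D.qi i) (D.coroot i (μ + D.root i + k • D.root i) - k))⁻¹ •
        D.fDiv i (k + 1) • w, Submodule.smul_mem _ _ (Submodule.subset_span
          ⟨k + 1, w, hadd ▸ hw, hew, ?_, rfl⟩), 0, by simp, ?_, Or.inl rfl⟩
      · rw [← hadd]; push_cast; omega
      · rw [smul_comm_act, D.e_fDiv_succ hw hew, smul_smul, inv_mul_cancel₀ hne, one_smul, add_zero]
    · have hk' : D.coroot i (μ + D.root i + k • D.root i) = (k : ℤ) := by omega
      refine ⟨0, zero_mem _, _, ?_, by rw [smul_zero, zero_add], Or.inr ?_⟩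
      · rw [f_fDiv, fDiv_smul, D.f_pow_eq_zero hM hw hew hk', smul_zero, smul_zero]
      · rw [map_add _ _ (k • D.root i), map_nsmul, coroot_root, nsmul_eq_mul] at hk'
        omega
  | zero => exact ⟨0, zero_mem _, 0, by simp, by simp, Or.inl rfl⟩
  | add z z' _ _ h h' =>
    obtain ⟨t, ht, l, hl, rfl, hc⟩ := h
    obtain ⟨t', ht', l', hl', rfl, hc'⟩ := h'
    refine ⟨t + t', add_mem ht ht', l + l', by rw [smul_add, hl, hl', add_zero], ?_, ?_⟩
    · rw [smul_add]; abel
    · rcases hc with rfl | hc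
      · rcases hc' with rfl | hc'
        · simp
        · exact Or.inr hc'
      · exact Or.inr hc
  | smul c z _ h =>
    obtain ⟨t, ht, l, hl, rfl, hc⟩ := h
    refine ⟨c • t, Submodule.smul_mem _ _ ht, c • l, by rw [smul_comm_act, hl, smul_zero], ?_, ?_⟩
    · rw [smul_add, smul_comm_act]
    · rcases hc with rfl | hc
      · simp
      · exact Or.inr hc

lemma stringSpan_le (i : I) (μ : P) : D.stringSpan M i μ ≤ D.wtSpace M μ := by
  refine Submodule.span_le.mpr ?_
  rintro _ ⟨k, w, hw, -, -, rfl⟩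
  simpa using D.fDiv_smul_mem (i := i) hw k

lemma mem_stringSpan_of_e_eq_zero (hM : D.Integrable M) {i : I} {μ : P} {u : M}
    (hu : u ∈ D.wtSpace M μ) (h0 : D.e i • u = 0) : u ∈ D.stringSpan M i μ := by
  by_cases hμ : 0 ≤ D.coroot i μ
  · refine Submodule.subset_span ⟨0, u, by simpa using hu, h0, by simpa using hμ, ?_⟩
    rw [fDiv_zero, one_smul]
  · rw [D.eq_zero_of_coroot_neg hM (i := i) hu (by rw [h0, smul_zero]) (by omega)]
    exact zero_mem _

/-- Every weight vector of an integrable module is a sum of string vectors. -/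
lemma stringSpan_eq (hM : D.Integrable M) (i : I) (μ : P) :
    D.stringSpan M i μ = D.wtSpace M μ := by
  refine le_antisymm (D.stringSpan_le i μ) fun u hu => ?_
  obtain ⟨n, hn⟩ := hM.e_nilpotent i u
  induction n generalizing μ u with
  | zero =>
    have : u = 0 := by simpa using hn
    rw [this]; exact zero_mem _
  | succ n ih =>
    rw [pow_succ, mul_smul] at hn
    -- By induction on the nilpotency order `e_i u` is a sum of string vectors; subtracting `t`
    -- leaves `e_i (u - t) = l` with `f_i l = 0`.
    obtain ⟨t, ht, l, hl, hel, hc⟩ := D.exists_e_smul_add hM (ih _ _ (D.e_smul_mem hu) hn)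
    have hsub : u - t ∈ D.wtSpace M μ := sub_mem hu (D.stringSpan_le i μ ht)
    have he : D.e i • (u - t) = l := by rw [smul_sub, hel]; abel
    have hmem : u - t ∈ D.stringSpan M i μ := by
      -- Either `u - t` is killed by `e_i`, or `⟨h_i, μ⟩ ≤ -2` and `f_i e_i (u - t) = 0`, so that `u
      -- - t = 0`.
      rcases hc with rfl | hc
      · exact D.mem_stringSpan_of_e_eq_zero hM hsub he
      · rw [map_add, coroot_root] at hc
        rw [D.eq_zero_of_coroot_neg hM (i := i) hsub (by rw [he, hl]) (by omega)]
        exact zero_mem _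
    simpa using add_mem hmem ht

end Modules

end RootDatum

/-! ### Independence of weight spaces and strings; Kashiwara's operators as linear maps -/

namespace RootDatum

variable {I P : Type*} [AddCommGroup P] (D : RootDatum I P)
variable {M : Type*} [AddCommGroup M] [Module K M] [Module D.Uq M] [IsScalarTower K D.Uq M]

lemma dual_separates [Module.Free ℤ P] {ξ η : P} (h : ∀ H : Module.Dual ℤ P, H ξ = H η) :
    ξ = η := by
  rw [← sub_eq_zero, ← Module.forall_dual_apply_eq_zero_iff ℤ]
  intro H
  rw [map_sub, h, sub_self]

lemma commute_qh (H H' : Module.Dual ℤ P) : Commute (D.act M (D.qh H)) (D.act M (D.qh H')) := by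
  rw [commute_iff_eq, ← map_mul, ← map_mul, qh_mul, qh_mul, add_comm]

lemma commute_qh_f_e (H : Module.Dual ℤ P) (i : I) :
    Commute (D.act M (D.qh H)) (D.act M (D.f i * D.e i)) := by
  rw [commute_iff_eq, ← map_mul, ← map_mul]
  congr 1
  rw [← mul_assoc, qh_mul_f, smul_mul_assoc, mul_assoc (D.f i), qh_mul_e, mul_smul_comm, smul_smul,
    ← zpow_add₀ qs_ne_zero, neg_add_cancel, zpow_zero, one_smul, mul_assoc]

section Independence

variable [Module.Free ℤ P]

/-- Weight spaces lie in joint generalized eigenspaces of the commuting `q(h)`. Distinct weights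
have distinct eigenvalues because `P` is free, so that `P*` separates points, and `q_s` is not a
root of unity. -/
lemma iSupIndep_wtSpace : iSupIndep (D.wtSpace M) := by
  have h := Module.End.independent_iInf_maxGenEigenspace_of_forall_mapsTo
    (fun H : Module.Dual ℤ P => D.act M (D.qh H)) fun H H' φ =>
      Module.End.mapsTo_maxGenEigenspace_of_comm (D.commute_qh H' H) φ
  have hinj : Function.Injective fun (ξ : P) (H : Module.Dual ℤ P) => (qs ^ H ξ : K) := by
    intro ξ η h
    exact dual_separates fun H => zpow_qs_injective (congrFun h H)
  refine (h.comp hinj).mono fun ξ u hu => ?_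
  simp only [Function.comp, Submodule.mem_iInf]
  intro H
  exact Module.End.mem_maxGenEigenspace _ _ _ |>.mpr ⟨1, by simp [act_apply, hu H]⟩

lemma isInternal_wtSpace [DecidableEq P] (hM : D.Integrable M) :
    DirectSum.IsInternal (D.wtSpace M) :=
  DirectSum.isInternal_submodule_of_iSupIndep_of_iSup_eq_top D.iSupIndep_wtSpace hM.iSup_wtSpace

open Classical in
lemma exists_wtProj (hM : D.Integrable M) (ξ : P) : ∃ p : Module.End K M,
    ∀ η, ∀ u ∈ D.wtSpace M η, p u = if η = ξ then u else 0 := by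
  obtain ⟨p, hp⟩ := (D.isInternal_wtSpace hM).exists_linearMap
    fun η => if η = ξ then LinearMap.id else 0
  refine ⟨p, fun η u hu => ?_⟩
  rw [hp η u hu]
  split_ifs <;> rfl

/-- The index set of the strings: pairs `(ξ, k)` with `0 ≤ k ≤ ⟨h_i, ξ⟩`. -/
def StringIndex (i : I) : Type _ := {p : P × ℕ // (p.2 : ℤ) ≤ D.coroot i p.1}

/-- The joint eigenvalues of the `q(h)` and `f_i e_i` on `f_i^{(k)} w`, for `w` of weight `ξ`
with `e_i w = 0`. -/
noncomputable def stringChar (i : I) (j : D.StringIndex i) : Option (Module.Dual ℤ P) → K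
  | some H => qs ^ H (j.1.1 - j.1.2 • D.root i)
  | none => zInt (D.qi i) j.1.2 * zInt (D.qi i) (D.coroot i j.1.1 - j.1.2 + 1)

/-- The `q(h)` determine the weight of the vector, and at a fixed weight the eigenvalue of `f_i e_i`
determines its position in the string. -/
lemma stringChar_injective (i : I) : Function.Injective (D.stringChar i) := by
  rintro ⟨⟨ξ, k⟩, hk⟩ ⟨⟨η, l⟩, hl⟩ h
  have h1 : ξ - k • D.root i = η - l • D.root i :=
    dual_separates fun H => zpow_qs_injective (congrFun h (some H))
  have h2 := congrFun h none
  simp only [stringChar] at h2 hk hl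
  have hh := congrArg (D.coroot i) h1
  simp only [map_sub, map_nsmul, coroot_root, nsmul_eq_mul] at hh
  have hkl : (k : ℤ) = l := by
    -- Here `l` is the pairing of `h_i` with the common weight `ξ - k α_i`.
    refine D.zInt_mul_injective i (l := D.coroot i ξ - 2 * k) (by omega) (by omega) ?_
    rw [show D.coroot i ξ - 2 * k + k + 1 = D.coroot i ξ - k + 1 by ring, h2]
    congr 2
    omega
  have hkl' : k = l := by exact_mod_cast hkl
  subst hkl'
  rw [sub_left_inj] at h1
  subst h1
  rfl

/-- The joint generalized eigenspace that contains the vectors `f_i^{(k)} w`. -/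
noncomputable def stringSpace (M : Type*) [AddCommGroup M] [Module K M] [Module D.Uq M]
    [IsScalarTower K D.Uq M] (i : I) (j : D.StringIndex i) : Submodule K M :=
  ⨅ o : Option (Module.Dual ℤ P), Module.End.maxGenEigenspace
    (o.elim (D.act M (D.f i * D.e i)) fun H => D.act M (D.qh H)) (D.stringChar i j o)

/-- Independence lets an operator be prescribed separately on each string position, and hence makes
Kashiwara's operators single-valued. -/
lemma iSupIndep_stringSpace (i : I) : iSupIndep (D.stringSpace M i) := by
  refine (Module.End.independent_iInf_maxGenEigenspace_of_forall_mapsTo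
    (fun o : Option (Module.Dual ℤ P) =>
      o.elim (D.act M (D.f i * D.e i)) fun H => D.act M (D.qh H)) ?_).comp
    (D.stringChar_injective i)
  intro o o' φ
  apply Module.End.mapsTo_maxGenEigenspace_of_comm
  rcases o with _ | H <;> rcases o' with _ | H'
  · exact Commute.refl _
  · exact D.commute_qh_f_e H' i
  · exact (D.commute_qh_f_e H i).symm
  · exact D.commute_qh H' H

end Independence

lemma fDiv_smul_mem_stringSpace {i : I} {ξ : P} {w : M} (hw : w ∈ D.wtSpace M ξ)
    (h0 : D.e i • w = 0) {k : ℕ} (hk : (k : ℤ) ≤ D.coroot i ξ) :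
    D.fDiv i k • w ∈ D.stringSpace M i ⟨(ξ, k), hk⟩ := by
  simp only [stringSpace, Submodule.mem_iInf]
  rintro (_ | H)
  · refine Module.End.mem_maxGenEigenspace _ _ _ |>.mpr ⟨1, ?_⟩
    rcases k with _ | k
    · simp [act_apply, stringChar, fDiv_zero, h0, zInt_zero]
    · have h1 := D.e_fDiv_succ hw h0 k
      have h2 := D.f_fDiv i k w
      simp only [Option.elim, pow_one, LinearMap.sub_apply, act_apply, mul_smul, stringChar]
      rw [h1, smul_comm_act, h2, qInt_eq_zInt, smul_smul]
      simp only [Nat.cast_add, Nat.cast_one, LinearMap.smul_apply, Module.End.one_apply]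
      rw [sub_eq_zero, smul_smul]
      congr 1
      rw [mul_comm]
      congr 2
      ring
  · refine Module.End.mem_maxGenEigenspace _ _ _ |>.mpr ⟨1, ?_⟩
    simp [act_apply, stringChar, D.fDiv_smul_mem (i := i) hw k H]

lemma iSup_stringSpace (hM : D.Integrable M) (i : I) : ⨆ j, D.stringSpace M i j = ⊤ := by
  rw [eq_top_iff, ← hM.iSup_wtSpace]
  refine iSup_le fun μ => ?_
  rw [← D.stringSpan_eq hM i μ]
  refine Submodule.span_le.mpr ?_
  rintro _ ⟨k, w, hw, h0, hk, rfl⟩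
  exact Submodule.mem_iSup_of_mem _ (D.fDiv_smul_mem_stringSpace hw h0 hk)

/-- `X` and `Y` are the Kashiwara operators `f̃_i` and `ẽ_i`. -/
structure IsKashiwara (i : I) (X Y : Module.End K M) : Prop where
  fTilde_eq : ∀ u, D.fTilde i u = X u
  eTilde_eq : ∀ u, D.eTilde i u = Y u
  isString : ∀ (ξ : P) (w : M) (m : ℕ), w ∈ D.wtSpace M ξ → D.e i • w = 0 →
    D.coroot i ξ = m → IsString X Y (D.act M (D.f i)) (D.act M (D.e i)) (D.qInt i) m
      fun k => D.fDiv i k • w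

lemma isString_of (hM : D.Integrable M) {i : I} {X Y : Module.End K M}
    (hX : ∀ (ξ : P) (w : M) (k : ℕ), w ∈ D.wtSpace M ξ → D.e i • w = 0 →
      (k : ℤ) ≤ D.coroot i ξ → X (D.fDiv i k • w) = D.fDiv i (k + 1) • w)
    (hY : ∀ (ξ : P) (w : M) (k : ℕ), w ∈ D.wtSpace M ξ → D.e i • w = 0 →
      (k : ℤ) ≤ D.coroot i ξ → Y (D.fDiv i k • w) = if k = 0 then 0 else D.fDiv i (k - 1) • w)
    (ξ : P) (w : M) (m : ℕ) (hw : w ∈ D.wtSpace M ξ) (h0 : D.e i • w = 0)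
    (hm : D.coroot i ξ = m) : IsString X Y (D.act M (D.f i)) (D.act M (D.e i)) (D.qInt i) m
      fun k => D.fDiv i k • w := by
  have hz : D.fDiv i (m + 1) • w = 0 := by
    rw [fDiv_smul, D.f_pow_eq_zero hM hw h0 hm, smul_zero]
  refine ⟨?_, ?_, ?_, ?_, ?_, ?_, ?_, ?_⟩
  · intro k hk
    exact hX ξ w k hw h0 (by omega)
  · rw [hX ξ w m hw h0 (by omega), hz]
  · intro k hk
    rw [hY ξ w (k + 1) hw h0 (by omega)]
    simp
  · rw [hY ξ w 0 hw h0 (by omega)]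
    simp
  · intro k _
    exact D.f_fDiv i k w
  · rw [act_apply, f_fDiv, hz, smul_zero]
  · intro k hk
    rw [act_apply, D.e_fDiv_succ hw h0, qInt_eq_zInt, hm]
    congr 2
    push_cast [hk.le]
    rfl
  · rw [act_apply, fDiv_zero, one_smul, h0]

/-- A relation that is defined everywhere and contained in the graph of `T` leaves only one possible
choice. -/
lemma epsilon_eq_of_le_graph {T : Module.End K M} {G : Submodule K (M × M)} (hG : G ≤ T.graph)
    (hsurj : G.map (LinearMap.fst K M M) = ⊤) (u : M) :
    Classical.epsilon (fun v => (u, v) ∈ G) = T u := by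
  have hu : u ∈ G.map (LinearMap.fst K M M) := hsurj ▸ Submodule.mem_top
  obtain ⟨⟨a, v⟩, hav, rfl⟩ := hu
  have := Classical.epsilon_spec (p := fun v => (a, v) ∈ G) ⟨v, hav⟩
  exact hG this

lemma exists_isKashiwara [Module.Free ℤ P] (hM : D.Integrable M) (i : I) :
    ∃ X Y : Module.End K M, D.IsKashiwara i X Y := by
  classical
  have hint := DirectSum.isInternal_submodule_of_iSupIndep_of_iSup_eq_top
    (D.iSupIndep_stringSpace (M := M) i) (D.iSup_stringSpace hM i)
  -- At position `k` of a string, `f̃_i` is `f_i` divided by `[k+1]`, and `ẽ_i` is `e_i` divided by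
  -- `[⟨h_i, ξ⟩ - k + 1]`, with `ẽ_i = 0` for `k = 0`.
  obtain ⟨X, hX⟩ := hint.exists_linearMap fun j => (D.qInt i (j.1.2 + 1))⁻¹ • D.act M (D.f i)
  obtain ⟨Y, hY⟩ := hint.exists_linearMap fun j => if j.1.2 = 0 then 0 else
    (zInt (D.qi i) (D.coroot i j.1.1 - (j.1.2 - 1 : ℕ)))⁻¹ • D.act M (D.e i)
  have hX' : ∀ (ξ : P) (w : M) (k : ℕ), w ∈ D.wtSpace M ξ → D.e i • w = 0 →
      (k : ℤ) ≤ D.coroot i ξ → X (D.fDiv i k • w) = D.fDiv i (k + 1) • w := by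
    intro ξ w k hw h0 hk
    rw [hX _ _ (D.fDiv_smul_mem_stringSpace hw h0 hk), LinearMap.smul_apply, act_apply, f_fDiv,
      smul_smul, inv_mul_cancel₀ (D.qInt_ne_zero i (Nat.succ_ne_zero k)), one_smul]
  have hY' : ∀ (ξ : P) (w : M) (k : ℕ), w ∈ D.wtSpace M ξ → D.e i • w = 0 →
      (k : ℤ) ≤ D.coroot i ξ →
        Y (D.fDiv i k • w) = if k = 0 then 0 else D.fDiv i (k - 1) • w := by
    intro ξ w k hw h0 hk
    rw [hY _ _ (D.fDiv_smul_mem_stringSpace hw h0 hk)]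
    rcases k with _ | k
    · simp
    · have hne : zInt (D.qi i) (D.coroot i ξ - k) ≠ 0 := D.zInt_ne_zero i (by omega)
      simp only [Nat.succ_ne_zero, if_false, Nat.add_sub_cancel, LinearMap.smul_apply, act_apply]
      rw [D.e_fDiv_succ hw h0, smul_smul, inv_mul_cancel₀ hne, one_smul]
  have htop : ∀ G : Submodule K (M × M), (∀ (ξ : P) (w : M) (k : ℕ), w ∈ D.wtSpace M ξ →
      D.e i • w = 0 → (k : ℤ) ≤ D.coroot i ξ → ∃ v, (D.fDiv i k • w, v) ∈ G) →
      G.map (LinearMap.fst K M M) = ⊤ := by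
    intro G hG
    rw [eq_top_iff, ← hM.iSup_wtSpace]
    refine iSup_le fun μ => ?_
    rw [← D.stringSpan_eq hM i μ]
    refine Submodule.span_le.mpr ?_
    rintro _ ⟨k, w, hw, h0, hk, rfl⟩
    obtain ⟨v, hv⟩ := hG _ w k hw h0 hk
    exact ⟨_, hv, rfl⟩
  refine ⟨X, Y, ?_, ?_, D.isString_of hM hX' hY'⟩
  · refine epsilon_eq_of_le_graph (Submodule.span_le.mpr ?_) (htop _ ?_)
    · rintro _ ⟨ξ, w, k, hw, h0, hk, rfl⟩
      exact (hX' ξ w k hw h0 hk).symm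
    · intro ξ w k hw h0 hk
      exact ⟨_, Submodule.subset_span ⟨ξ, w, k, hw, h0, hk, rfl⟩⟩
  · refine epsilon_eq_of_le_graph (Submodule.span_le.mpr ?_) (htop _ ?_)
    · rintro _ ⟨ξ, w, k, hw, h0, hk, rfl⟩
      exact (hY' ξ w k hw h0 hk).symm
    · intro ξ w k hw h0 hk
      exact ⟨_, Submodule.subset_span ⟨ξ, w, k, hw, h0, hk, rfl⟩⟩

/-- The common properties of `(f_i, f̃_i, ẽ_i)` and `(e_i, ẽ_i, f̃_i)`, with `δ = ± α_i`. -/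
structure ShiftPair (i : I) (δ : P) (x X Y : Module.End K M) : Prop where
  x_mem : ∀ μ, ∀ u ∈ D.wtSpace M μ, x u ∈ D.wtSpace M (μ - δ)
  X_mem : ∀ μ, ∀ u ∈ D.wtSpace M μ, X u ∈ D.wtSpace M (μ - δ)
  Y_mem : ∀ μ, ∀ u ∈ D.wtSpace M μ, Y u ∈ D.wtSpace M (μ + δ)
  X_Y_x : ∀ (n : ℕ) (u : M), (X ^ n) ((Y ^ n) ((x ^ n) u)) = (x ^ n) u
  X_mem_range : ∀ (n : ℕ) (u : M), (X ^ n) u ∈ LinearMap.range (x ^ n)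
  sub_mem_range : ∀ (n : ℕ) (u : M),
    (D.qFact i n)⁻¹ • (x ^ n) u - (X ^ n) u ∈ LinearMap.range (x ^ (n + 1))

/-- A linear condition holds if it holds on the vectors of the strings. -/
lemma string_induction (hM : D.Integrable M) {i : I} {p : M → Prop} (hp0 : p 0)
    (hadd : ∀ u v, p u → p v → p (u + v)) (hsmul : ∀ (c : K) u, p u → p (c • u))
    (h : ∀ (ξ : P) (w : M) (m k : ℕ), w ∈ D.wtSpace M ξ → D.e i • w = 0 →
      D.coroot i ξ = m → k ≤ m → p (D.fDiv i k • w)) (u : M) : p u := by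
  have hu : u ∈ ⨆ ξ, D.wtSpace M ξ := hM.iSup_wtSpace ▸ Submodule.mem_top
  induction hu using Submodule.iSup_induction' with
  | mem μ u hu =>
    rw [← D.stringSpan_eq hM i μ] at hu
    induction hu using Submodule.span_induction with
    | mem z hz =>
      obtain ⟨k, w, hw, h0, hk, rfl⟩ := hz
      obtain ⟨m, hm⟩ := Int.eq_ofNat_of_zero_le (le_trans (Int.natCast_nonneg k) hk)
      exact h _ w m k hw h0 hm (by omega)
    | zero => exact hp0
    | add _ _ _ _ h h' => exact hadd _ _ h h'
    | smul c _ _ h => exact hsmul c _ h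
  | zero => exact hp0
  | add _ _ _ _ h h' => exact hadd _ _ h h'

namespace IsKashiwara

variable {D} {i : I} {X Y : Module.End K M}

lemma X_mem (h : D.IsKashiwara i X Y) (hM : D.Integrable M) (μ : P) (u : M)
    (hu : u ∈ D.wtSpace M μ) : X u ∈ D.wtSpace M (μ - D.root i) := by
  rw [← D.stringSpan_eq hM i μ] at hu
  have : D.stringSpan M i μ ≤ (D.wtSpace M (μ - D.root i)).comap X := by
    refine Submodule.span_le.mpr ?_
    rintro _ ⟨k, w, hw, h0, hk, rfl⟩
    obtain ⟨m, hm⟩ := Int.eq_ofNat_of_zero_le (le_trans (Int.natCast_nonneg k) hk)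
    have hs := h.isString _ w m hw h0 hm
    change X (D.fDiv i k • w) ∈ D.wtSpace M _
    rcases (show k ≤ m by omega).lt_or_eq with hlt | rfl
    · rw [hs.X_lt k hlt]
      have := D.fDiv_smul_mem (i := i) hw (k + 1)
      rwa [succ_nsmul, ← sub_sub, add_sub_cancel_right] at this
    · rw [hs.X_top]
      exact Submodule.zero_mem _
  exact this hu

lemma Y_mem (h : D.IsKashiwara i X Y) (hM : D.Integrable M) (μ : P) (u : M)
    (hu : u ∈ D.wtSpace M μ) : Y u ∈ D.wtSpace M (μ + D.root i) := by
  rw [← D.stringSpan_eq hM i μ] at hu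
  have : D.stringSpan M i μ ≤ (D.wtSpace M (μ + D.root i)).comap Y := by
    refine Submodule.span_le.mpr ?_
    rintro _ ⟨k, w, hw, h0, hk, rfl⟩
    obtain ⟨m, hm⟩ := Int.eq_ofNat_of_zero_le (le_trans (Int.natCast_nonneg k) hk)
    have hs := h.isString _ w m hw h0 hm
    change Y (D.fDiv i k • w) ∈ D.wtSpace M _
    rcases k with _ | k
    · rw [hs.Y_zero]
      exact zero_mem _
    · rw [hs.Y_lt k (by omega)]
      have := D.fDiv_smul_mem (i := i) hw k
      rwa [succ_nsmul, ← add_assoc, add_right_comm, add_sub_cancel_right] at this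
  exact this hu

lemma shiftPair_f (h : D.IsKashiwara i X Y) (hM : D.Integrable M) :
    D.ShiftPair i (D.root i) (D.act M (D.f i)) X Y where
  x_mem _ _ hu := D.f_smul_mem hu
  X_mem := h.X_mem hM
  Y_mem := h.Y_mem hM
  X_Y_x n := by
    refine D.string_induction hM (i := i) (by simp) ?_ ?_ ?_
    · intro u v hu hv
      simp only [map_add, hu, hv]
    · intro c u hu
      simp only [map_smul, hu]
    · intro ξ w m k hw h0 hm hk
      exact (h.isString ξ w m hw h0 hm).X_pow_Y_pow_x_pow n hk
  X_mem_range n := by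
    refine D.string_induction hM (i := i) (by simp) ?_ ?_ ?_
    · intro u v hu hv
      rw [map_add]; exact add_mem hu hv
    · intro c u hu
      rw [map_smul]; exact Submodule.smul_mem _ _ hu
    · intro ξ w m k hw h0 hm hk
      exact (h.isString ξ w m hw h0 hm).X_pow_mem_range
        (fun j => D.qInt_ne_zero i (Nat.succ_ne_zero j)) n hk
  sub_mem_range n := by
    refine D.string_induction hM (i := i) (by simp) ?_ ?_ ?_
    · intro u v hu hv
      rw [map_add, map_add, smul_add, add_sub_add_comm]; exact add_mem hu hv
    · intro c u hu
      rw [map_smul, map_smul, smul_comm, ← smul_sub]; exact Submodule.smul_mem _ _ hu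
    · intro ξ w m k hw h0 hm hk
      exact (h.isString ξ w m hw h0 hm).sub_mem_range
        (fun j => D.qInt_ne_zero i (Nat.succ_ne_zero j)) n hk

lemma shiftPair_e (h : D.IsKashiwara i X Y) (hM : D.Integrable M) :
    D.ShiftPair i (-D.root i) (D.act M (D.e i)) Y X where
  x_mem μ u hu := by
    rw [sub_neg_eq_add]; exact D.e_smul_mem hu
  X_mem μ u hu := by
    rw [sub_neg_eq_add]; exact h.Y_mem hM μ u hu
  Y_mem μ u hu := by
    rw [← sub_eq_add_neg]; exact h.X_mem hM μ u hu
  X_Y_x n := by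
    refine D.string_induction hM (i := i) (by simp) ?_ ?_ ?_
    · intro u v hu hv
      simp only [map_add, hu, hv]
    · intro c u hu
      simp only [map_smul, hu]
    · intro ξ w m k hw h0 hm hk
      have := (h.isString ξ w m hw h0 hm).reverse.X_pow_Y_pow_x_pow n (Nat.sub_le m k)
      simpa only [Nat.sub_sub_self hk] using this
  X_mem_range n := by
    refine D.string_induction hM (i := i) (by simp) ?_ ?_ ?_
    · intro u v hu hv
      rw [map_add]; exact add_mem hu hv
    · intro c u hu
      rw [map_smul]; exact Submodule.smul_mem _ _ hu
    · intro ξ w m k hw h0 hm hk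
      have := (h.isString ξ w m hw h0 hm).reverse.X_pow_mem_range
        (fun j => D.qInt_ne_zero i (Nat.succ_ne_zero j)) n (Nat.sub_le m k)
      simpa only [Nat.sub_sub_self hk] using this
  sub_mem_range n := by
    refine D.string_induction hM (i := i) (by simp) ?_ ?_ ?_
    · intro u v hu hv
      rw [map_add, map_add, smul_add, add_sub_add_comm]; exact add_mem hu hv
    · intro c u hu
      rw [map_smul, map_smul, smul_comm, ← smul_sub]; exact Submodule.smul_mem _ _ hu
    · intro ξ w m k hw h0 hm hk
      have := (h.isString ξ w m hw h0 hm).reverse.sub_mem_range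
        (fun j => D.qInt_ne_zero i (Nat.succ_ne_zero j)) n (Nat.sub_le m k)
      simpa only [Nat.sub_sub_self hk] using! this

/-- On `M_μ` with `⟨h_i, μ⟩ = m ≥ 0`, `ẽ_i^m f̃_i^m = 1`. -/
lemma Y_pow_X_pow (h : D.IsKashiwara i X Y) (hM : D.Integrable M) {μ : P} {m : ℕ}
    (hμ : D.coroot i μ = m) {u : M} (hu : u ∈ D.wtSpace M μ) : (Y ^ m) ((X ^ m) u) = u := by
  rw [← D.stringSpan_eq hM i μ] at hu
  induction hu using Submodule.span_induction with
  | mem z hz =>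
    obtain ⟨k, w, hw, h0, hk, rfl⟩ := hz
    -- The string has length `m + 2k` and the vector sits at position `k`, so `m` further steps stay
    -- inside it.
    have hm : D.coroot i (μ + k • D.root i) = ((m + 2 * k : ℕ) : ℤ) := by
      rw [map_add, map_nsmul, coroot_root, hμ, nsmul_eq_mul]; push_cast; ring
    have hs := h.isString _ w _ hw h0 hm
    rw [hs.X_pow m (by omega), hs.Y_pow m (by omega)]
  | zero => simp
  | add _ _ _ _ h h' => rw [map_add, map_add, h, h']
  | smul c _ _ h => rw [map_smul, map_smul, h]

/-- On `M_μ` with `⟨h_i, μ⟩ = -m ≤ 0`, `f̃_i^m ẽ_i^m = 1`. -/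
lemma X_pow_Y_pow (h : D.IsKashiwara i X Y) (hM : D.Integrable M) {μ : P} {m : ℕ}
    (hμ : D.coroot i μ = -(m : ℤ)) {u : M} (hu : u ∈ D.wtSpace M μ) :
    (X ^ m) ((Y ^ m) u) = u := by
  rw [← D.stringSpan_eq hM i μ] at hu
  induction hu using Submodule.span_induction with
  | mem z hz =>
    obtain ⟨k, w, hw, h0, hk, rfl⟩ := hz
    -- The string has length `2k - m`, so `k ≤ 2k - m` leaves room for `m` steps backwards.
    have hm : D.coroot i (μ + k • D.root i) = 2 * k - m := by
      rw [map_add, map_nsmul, coroot_root, hμ, nsmul_eq_mul]; ring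
    rw [hm] at hk
    have hs := h.isString _ w (2 * k - m) hw h0 (by omega)
    obtain ⟨j, rfl⟩ : ∃ j, k = j + m := ⟨k - m, by omega⟩
    rw [hs.Y_pow m (by omega), hs.X_pow m (by omega)]
  | zero => simp
  | add _ _ _ _ h h' => rw [map_add, map_add, h, h']
  | smul c _ _ h => rw [map_smul, map_smul, h]

lemma Y_nilpotent (h : D.IsKashiwara i X Y) (hM : D.Integrable M) (u : M) :
    ∃ n, (Y ^ n) u = 0 := by
  -- Vanishing from some index on, rather than at one index, is the form that passes to sums.
  have key : ∃ n, ∀ j, n ≤ j → (Y ^ j) u = 0 := by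
    revert u
    refine D.string_induction hM (i := i) ⟨0, by simp⟩ ?_ ?_ ?_
    · rintro u v ⟨a, ha⟩ ⟨b, hb⟩
      refine ⟨max a b, fun j hj => ?_⟩
      rw [map_add, ha j (le_trans (le_max_left _ _) hj), hb j (le_trans (le_max_right _ _) hj),
        add_zero]
    · rintro c u ⟨a, ha⟩
      exact ⟨a, fun j hj => by rw [map_smul, ha j hj, smul_zero]⟩
    · intro ξ w m k hw h0 hm hk
      refine ⟨m + 1, fun j hj => ?_⟩
      have := (h.isString ξ w m hw h0 hm).reverse.X_pow_eq_zero (n := j) (Nat.sub_le m k)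
        (by omega)
      simpa only [Nat.sub_sub_self hk] using this
  obtain ⟨n, hn⟩ := key
  exact ⟨n, hn n le_rfl⟩

lemma X_nilpotent (h : D.IsKashiwara i X Y) (hM : D.Integrable M) (u : M) :
    ∃ n, (X ^ n) u = 0 := by
  have key : ∃ n, ∀ j, n ≤ j → (X ^ j) u = 0 := by
    revert u
    refine D.string_induction hM (i := i) ⟨0, by simp⟩ ?_ ?_ ?_
    · rintro u v ⟨a, ha⟩ ⟨b, hb⟩
      refine ⟨max a b, fun j hj => ?_⟩
      rw [map_add, ha j (le_trans (le_max_left _ _) hj), hb j (le_trans (le_max_right _ _) hj),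
        add_zero]
    · rintro c u ⟨a, ha⟩
      exact ⟨a, fun j hj => by rw [map_smul, ha j hj, smul_zero]⟩
    · intro ξ w m k hw h0 hm hk
      exact ⟨m + 1, fun j hj =>
        (h.isString ξ w m hw h0 hm).X_pow_eq_zero (n := j) hk (by omega)⟩
  obtain ⟨n, hn⟩ := key
  exact ⟨n, hn n le_rfl⟩

end IsKashiwara

end RootDatum

/-! ### Reduction modulo `q_s` -/

lemma qs_mem_KQ : qs ∈ KQ := Algebra.subset_adjoin (by simp)

lemma qs_inv_mem_KQ : qs⁻¹ ∈ KQ := Algebra.subset_adjoin (by simp)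

/-- The residue at `q_s = 0` of an element of `A` is unique. -/
lemma eq_zero_of_add_qs_mul_eq_zero {t : ℚ} {a : K} (ha : a ∈ ringA)
    (h : algebraMap ℚ K t + qs * a = 0) : t = 0 := by
  obtain ⟨f, g, hg, rfl⟩ := ha
  have hg' : algebraMap ℚ[X] K g ≠ 0 := by
    intro h
    have : g = 0 := by simpa using h
    simp [this] at hg
  have hX : algebraMap ℚ[X] K Polynomial.X = qs := RatFunc.algebraMap_X
  have hC : algebraMap ℚ[X] K (Polynomial.C t) = algebraMap ℚ K t := by
    rw [IsScalarTower.algebraMap_apply ℚ ℚ[X] K]; rfl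
  have h2 : algebraMap ℚ[X] K (Polynomial.C t * g + Polynomial.X * f) = 0 := by
    rw [map_add, map_mul, map_mul, hC, hX]
    field_simp at h
    rw [h, mul_zero]
  have h3 := (map_eq_zero_iff _ (RatFunc.algebraMap_injective (K := ℚ))).mp h2
  have h4 := congrArg (fun p => Polynomial.coeff p 0) h3
  simpa [hg] using h4

section Reduction

variable {M : Type*} [AddCommGroup M] [Module K M]

lemma red_eq_red_iff {L : Submodule ringA M} {u v : L} :
    red L u = red L v ↔ ∃ l ∈ L, (u : M) - v = qs • l := by
  rw [red, red, Submodule.Quotient.eq, Submodule.ideal_span_singleton_smul,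
    Submodule.mem_smul_pointwise_iff_exists]
  constructor
  · rintro ⟨l, -, hl⟩
    exact ⟨l, l.2, (congrArg Subtype.val hl).symm⟩
  · rintro ⟨l, hl, h⟩
    exact ⟨⟨l, hl⟩, trivial, Subtype.ext h.symm⟩

lemma red_zero (L : Submodule ringA M) : red L 0 = 0 := rfl

lemma red_surjective (L : Submodule ringA M) : Function.Surjective (red L) :=
  Submodule.Quotient.mk_surjective _

lemma smul_mem_of_mem_ringA {L : Submodule ringA M} {a : K} (ha : a ∈ ringA) {u : M} (hu : u ∈ L) :
    a • u ∈ L :=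
  L.smul_mem (⟨a, ha⟩ : ringA) hu

lemma smul_mem_of_mem_KQ {N : Submodule KQ M} {a : K} (ha : a ∈ KQ) {u : M} (hu : u ∈ N) :
    a • u ∈ N :=
  N.smul_mem (⟨a, ha⟩ : KQ) hu

lemma qs_pow_smul_mem {L : Submodule ringA M} (n : ℕ) {u : M} (hu : u ∈ L) : qs ^ n • u ∈ L :=
  smul_mem_of_mem_ringA (pow_mem qs_mem_ringA n) hu

lemma exists_qs_pow_smul_mem {L : Submodule ringA M} (hL : Submodule.span K (L : Set M) = ⊤)
    (v : M) : ∃ n : ℕ, qs ^ n • v ∈ L := by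
  have hv : v ∈ Submodule.span K (L : Set M) := hL ▸ Submodule.mem_top
  induction hv using Submodule.span_induction with
  | mem v hv => exact ⟨0, by simpa using hv⟩
  | zero => exact ⟨0, by simp⟩
  | add u v _ _ h h' =>
    obtain ⟨n, hn⟩ := h
    obtain ⟨m, hm⟩ := h'
    refine ⟨n + m, ?_⟩
    rw [smul_add]
    refine add_mem ?_ ?_
    · rw [add_comm, pow_add, mul_smul]; exact qs_pow_smul_mem m hn
    · rw [pow_add, mul_smul]; exact qs_pow_smul_mem n hm
  | smul a v _ h =>
    obtain ⟨n, hn⟩ := h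
    obtain ⟨m, hm⟩ := exists_qs_pow_mul_mem_ringA a
    refine ⟨m + n, ?_⟩
    rw [smul_smul, show qs ^ (m + n) * a = (qs ^ m * a) * qs ^ n by ring, mul_smul]
    exact smul_mem_of_mem_ringA hm hn

/-- A `K`-linear operator that preserves `L` also preserves `q_s L`, so the chosen representative
does not matter. -/
lemma inducedOp_red {L : Submodule ringA M} {T : M → M} {X : Module.End K M}
    (hT : ∀ u, T u = X u) (hX : ∀ u ∈ L, X u ∈ L) (u : L) :
    RootDatum.inducedOp L T (red L u) = red L ⟨X u, hX u u.2⟩ := by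
  obtain ⟨u', v, hu, hv, huv⟩ := Classical.epsilon_spec
    (p := fun b' => ∃ u' v : L, red L u' = red L u ∧ red L v = b' ∧ T u' = v)
    ⟨_, u, ⟨X u, hX u u.2⟩, rfl, rfl, hT u⟩
  rw [RootDatum.inducedOp, ← hv, red_eq_red_iff]
  obtain ⟨l, hl, h⟩ := red_eq_red_iff.mp hu
  exact ⟨X l, hX l hl, by rw [← huv, hT, ← map_sub, h, map_smul]⟩

lemma pow_apply_mem {L : Submodule ringA M} {X : Module.End K M} (hX : ∀ u ∈ L, X u ∈ L)
    (n : ℕ) {u : M} (hu : u ∈ L) : (X ^ n) u ∈ L := by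
  induction n with
  | zero => simpa using hu
  | succ n ih => rw [pow_succ']; exact hX _ ih

lemma inducedOp_iterate_red {L : Submodule ringA M} {T : M → M} {X : Module.End K M}
    (hT : ∀ u, T u = X u) (hX : ∀ u ∈ L, X u ∈ L) (n : ℕ) (u : L) :
    (RootDatum.inducedOp L T)^[n] (red L u) = red L ⟨(X ^ n) u, pow_apply_mem hX n u.2⟩ := by
  induction n with
  | zero => rfl
  | succ n ih =>
    rw [Function.iterate_succ_apply', ih, inducedOp_red hT hX]
    congr 2
    exact (by rw [pow_succ', Module.End.mul_apply])

/-- A family in `L` whose reduction is linearly independent over `ℚ` is linearly independent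
over `K`. -/
lemma linearIndependent_of_red {ι : Type*} {L : Submodule ringA M} (v : ι → L)
    (h : ∀ t : ι →₀ ℚ, (t.sum fun j a => algebraMap ℚ ringA a • red L (v j)) = 0 → t = 0) :
    LinearIndependent K fun j => (v j : M) := by
  -- The residues of a relation over `A` give a relation in `L / q_s L` and hence vanish. Dividing
  -- by `q_s` gives another relation over `A`, so all coefficients are infinitely divisible by
  -- `q_s`.
  have main : ∀ (n : ℕ) (a : ι →₀ K), (∀ j, a j ∈ ringA) → (a.sum fun j c => c • (v j : M)) = 0 →
      ∀ j, ∃ a' ∈ ringA, a j = qs ^ n * a' := by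
    intro n
    induction n with
    | zero => exact fun a ha _ j => ⟨a j, ha j, by simp⟩
    | succ n ih =>
      intro a ha hs
      choose t a' ha' hta using fun j => exists_rat_add_qs_mul (ha j)
      have h0 : ∀ j, a j = 0 → t j = 0 ∧ a' j = 0 := by
        intro j hj
        have h1 := hta j
        rw [hj] at h1
        have ht : t j = 0 := eq_zero_of_add_qs_mul_eq_zero (ha' j) h1.symm
        refine ⟨ht, ?_⟩
        rw [ht, map_zero, zero_add] at h1
        exact (mul_eq_zero.mp h1.symm).resolve_left qs_ne_zero
      let tf : ι →₀ ℚ := Finsupp.onFinset a.support t fun j hj => by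
        rw [Finsupp.mem_support_iff]; exact fun h => hj (h0 j h).1
      let af : ι →₀ K := Finsupp.onFinset a.support a' fun j hj => by
        rw [Finsupp.mem_support_iff]; exact fun h => hj (h0 j h).2
      have e1 : (tf.sum fun j c => algebraMap ℚ K c • (v j : M)) +
          qs • (af.sum fun j c => c • (v j : M)) = 0 := by
        rw [← hs, Finsupp.onFinset_sum _ (by simp), Finsupp.onFinset_sum _ (by simp),
          Finsupp.sum, Finset.smul_sum, ← Finset.sum_add_distrib]
        refine Finset.sum_congr rfl fun j _ => ?_
        rw [smul_smul, ← add_smul, ← hta j]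
      have haf : (af.sum fun j c => c • (v j : M)) ∈ L :=
        Submodule.sum_mem _ fun j _ => smul_mem_of_mem_ringA (ha' j) (v j).2
      have htf : tf = 0 := by
        apply h
        have e2 : (tf.sum fun j c => algebraMap ℚ ringA c • red L (v j)) =
            red L (tf.sum fun j c => algebraMap ℚ ringA c • v j) := by
          rw [Finsupp.sum, Finsupp.sum]
          exact (map_sum (Submodule.mkQ _) _ _).symm
        rw [e2, ← red_zero, red_eq_red_iff]
        refine ⟨_, neg_mem haf, ?_⟩
        rw [smul_neg, ← eq_neg_of_add_eq_zero_left e1, Finsupp.sum, Finsupp.sum,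
          Submodule.coe_zero, sub_zero, Submodule.coe_sum]
        rfl
      have e3 : (af.sum fun j c => c • (v j : M)) = 0 := by
        rw [htf, Finsupp.sum_zero_index, zero_add, smul_eq_zero] at e1
        exact e1.resolve_left qs_ne_zero
      intro j
      obtain ⟨b, hb, hab⟩ := ih af ha' e3 j
      refine ⟨b, hb, ?_⟩
      have ht0 : t j = 0 := DFunLike.congr_fun htf j
      have : a' j = qs ^ n * b := hab
      rw [hta j, ht0, map_zero, zero_add, this]
      ring
  rw [linearIndependent_iff]
  intro a ha
  rw [Finsupp.linearCombination_apply] at ha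
  classical
  -- A common power of `q_s` clears the poles at `0` of the finitely many nonzero coefficients.
  have hden : ∃ n : ℕ, ∀ j, qs ^ n * a j ∈ ringA := by
    choose n hn using fun j => exists_qs_pow_mul_mem_ringA (a j)
    refine ⟨∑ j ∈ a.support, n j, fun j => ?_⟩
    by_cases hj : j ∈ a.support
    · rw [← Finset.sum_erase_add _ _ hj, pow_add, mul_assoc]
      exact mul_mem (pow_mem qs_mem_ringA _) (hn j)
    · rw [Finsupp.notMem_support_iff.mp hj, mul_zero]
      exact zero_mem _
  obtain ⟨N, hN⟩ := hden
  ext j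
  have hz : (qs ^ N • a) j = 0 := by
    refine eq_zero_of_forall_qs_pow fun n => main n (qs ^ N • a) (fun j => by simpa using hN j) ?_ j
    rw [Finsupp.sum_smul_index (by simp)]
    simp only [mul_smul]
    rw [← Finsupp.smul_sum, ha, smul_zero]
  simpa [qs_ne_zero] using hz

end Reduction

/-! ### Bar-invariant representatives and corrections -/

namespace RootDatum

variable {I P : Type*} [AddCommGroup P] {D : RootDatum I P}
variable {M : Type*} [AddCommGroup M] [Module K M] [Module D.Uq M] [IsScalarTower K D.Uq M]

lemma BarInvolution.hom_smul (c : D.BarInvolution M) (a : K) (u : M) :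
    c.hom (a • u) = barK a • c.hom u := by
  rw [← algebraMap_smul D.Uq a u, c.map_smul, bar_algebraMap, algebraMap_smul]

lemma BarInvolution.mem_image_iff (c : D.BarInvolution M) (L : Submodule ringA M) (u : M) :
    u ∈ c.image D L ↔ c.hom u ∈ L := by
  constructor
  · rintro ⟨v, hv, rfl⟩
    rwa [c.involutive]
  · exact fun h => ⟨_, h, c.involutive u⟩

variable (c : D.BarInvolution M) (L : Submodule ringA M) (N : Submodule KQ M)

/-- The bar-invariant elements of `L ∩ N`. -/
structure IsGlobal (u : M) : Prop where
  mem_L : u ∈ L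
  mem_N : u ∈ N
  hom_eq : c.hom u = u

/-- Every element of `L ∩ V` is congruent modulo `q_s L` to a bar-invariant element of
`L ∩ N ∩ V`. -/
def Lifts (V : Submodule K M) : Prop :=
  ∀ v ∈ V, v ∈ L → ∃ e ∈ V, IsGlobal c L N e ∧ ∃ l ∈ L, v - e = qs • l

/-- The `K_ℚ`-span of the bar-invariant elements of `L ∩ N ∩ V`. -/
noncomputable def globalSpan (V : Submodule K M) : Submodule KQ M :=
  Submodule.span KQ {e | e ∈ V ∧ IsGlobal c L N e}

variable {c L N}

lemma IsGlobal.add {u v : M} (hu : IsGlobal c L N u) (hv : IsGlobal c L N v) :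
    IsGlobal c L N (u + v) :=
  ⟨add_mem hu.1 hv.1, add_mem hu.2 hv.2, by rw [map_add, hu.3, hv.3]⟩

lemma IsGlobal.sub {u v : M} (hu : IsGlobal c L N u) (hv : IsGlobal c L N v) :
    IsGlobal c L N (u - v) :=
  ⟨sub_mem hu.1 hv.1, sub_mem hu.2 hv.2, by rw [map_sub, hu.3, hv.3]⟩

lemma IsGlobal.zero : IsGlobal c L N 0 := ⟨zero_mem _, zero_mem _, map_zero _⟩

lemma IsGlobal.rat_smul {u : M} (hu : IsGlobal c L N u) (t : ℚ) :
    IsGlobal c L N (algebraMap ℚ K t • u) :=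
  ⟨smul_mem_of_mem_ringA (ringA.algebraMap_mem t) hu.1,
    smul_mem_of_mem_KQ (KQ.algebraMap_mem t) hu.2, by
      rw [c.hom_smul, hu.3]
      congr 1
      exact RingHom.congr_fun (RingHom.ext_rat (barK.comp (algebraMap ℚ K)) (algebraMap ℚ K)) t⟩

lemma globalSpan_le (V : Submodule K M) : globalSpan c L N V ≤ N :=
  Submodule.span_le.mpr fun _ he => he.2.mem_N

lemma mem_of_mem_globalSpan {V : Submodule K M} {p : M} (hp : p ∈ globalSpan c L N V) : p ∈ V := by
  have : globalSpan c L N V ≤ V.restrictScalars KQ := Submodule.span_le.mpr fun _ he => he.1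
  exact this hp

/-- The pole at `q_s = 0` is removed one order at a time: a global `e` congruent to `q_s^{n+1} v`
gives the correction `q_s^{-(n+1)} e`. Its bar conjugate `q_s^{n+1} e` has no pole, so the
corrections can be made symmetric under the bar involution without leaving `L`. -/
lemma Lifts.exists_sub_mem_of_pow {V : Submodule K M} (h : Lifts c L N V) (n : ℕ) (v : M)
    (hv : v ∈ V) (hn : qs ^ n • v ∈ L) : ∃ p ∈ globalSpan c L N V,
      c.hom p ∈ globalSpan c L N V ∧ c.hom p ∈ L ∧ v - p ∈ L := by
  induction n generalizing v with
  | zero => exact ⟨0, zero_mem _, by simp, by simp, by simpa using hn⟩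
  | succ n ih =>
    obtain ⟨e, heV, he, l, hl, hel⟩ := h _ (V.smul_mem _ hv) hn
    have he' : e ∈ globalSpan c L N V := Submodule.subset_span ⟨heV, he⟩
    obtain ⟨p, hp, hcp, hcpL, hpL⟩ := ih (v - (qs⁻¹) ^ (n + 1) • e)
      (sub_mem hv (V.smul_mem _ heV)) (by
        have : qs ^ n • (v - (qs⁻¹) ^ (n + 1) • e) = l := by
          have h1 : qs • (qs ^ n • (v - (qs⁻¹) ^ (n + 1) • e)) = qs • l := by
            rw [← hel, smul_smul, ← pow_succ', smul_sub, smul_smul, ← mul_pow,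
              mul_inv_cancel₀ qs_ne_zero, one_pow, one_smul]
          exact smul_right_injective M qs_ne_zero h1
        rwa [this])
    have hce : c.hom ((qs⁻¹) ^ (n + 1) • e) = qs ^ (n + 1) • e := by
      rw [c.hom_smul, he.hom_eq]; simp
    refine ⟨(qs⁻¹) ^ (n + 1) • e + p, add_mem (smul_mem_of_mem_KQ (pow_mem qs_inv_mem_KQ _) he') hp,
      ?_, ?_, ?_⟩
    · rw [map_add, hce]
      exact add_mem (smul_mem_of_mem_KQ (pow_mem qs_mem_KQ _) he') hcp
    · rw [map_add, hce]
      exact add_mem (qs_pow_smul_mem _ he.mem_L) hcpL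
    · rwa [← sub_sub]

variable (hL : Submodule.span K (L : Set M) = ⊤)
include hL

lemma Lifts.exists_sub_mem {V : Submodule K M} (h : Lifts c L N V) {v : M} (hv : v ∈ V) :
    ∃ p ∈ globalSpan c L N V, c.hom p ∈ globalSpan c L N V ∧ c.hom p ∈ L ∧ v - p ∈ L := by
  obtain ⟨n, hn⟩ := exists_qs_pow_smul_mem hL v
  exact h.exists_sub_mem_of_pow n v hv hn

/-- A bar-invariant element of `N` that is congruent to `l ∈ L` modulo `V` can be corrected by an
element of `V` to a bar-invariant element of `L ∩ N` congruent to `l` modulo `q_s L`. -/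
lemma Lifts.exists_correction {V : Submodule K M} (h : Lifts c L N V) {y l : M} (hyN : y ∈ N)
    (hyc : c.hom y = y) (hl : l ∈ L) (hyl : y - l ∈ V) :
    ∃ z, IsGlobal c L N z ∧ y - z ∈ V ∧ ∃ l' ∈ L, l - z = qs • l' := by
  obtain ⟨p, hp, hcp, hcpL, hpL⟩ := h.exists_sub_mem hL hyl
  have hpV := mem_of_mem_globalSpan hp
  have hcpV := mem_of_mem_globalSpan hcp
  -- Subtracting both `p` and its conjugate keeps `y` bar-invariant, while the conjugate does not
  -- spoil membership in `L`.
  have hL1 : y - l - p - c.hom p ∈ L := sub_mem hpL hcpL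
  have hV1 : y - l - p - c.hom p ∈ V := sub_mem (sub_mem hyl hpV) hcpV
  obtain ⟨e, heV, he, l', hl', hel⟩ := h _ hV1 hL1
  refine ⟨y - p - c.hom p - e, IsGlobal.sub ⟨?_, ?_, ?_⟩ he, ?_, -l', neg_mem hl', ?_⟩
  · have := add_mem hL1 hl
    rwa [show y - l - p - c.hom p + l = y - p - c.hom p by abel] at this
  · exact sub_mem (sub_mem hyN (globalSpan_le V hp)) (globalSpan_le V hcp)
  · rw [map_sub, map_sub, hyc, c.involutive, sub_right_comm]
  · have := add_mem (add_mem hpV hcpV) heV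
    rwa [show p + c.hom p + e = y - (y - p - c.hom p - e) by abel] at this
  · rw [smul_neg, ← hel]; abel

omit hL in
/-- Uniqueness of bar-invariant representatives. -/
lemma IsGlobal.eq_zero {MQ : Submodule KQ M} (hNMQ : N ≤ MQ)
    (h0 : ∀ l ∈ L, qs • l ∈ MQ → c.hom (qs • l) = qs • l → qs • l = 0) {u : M}
    (hu : IsGlobal c L N u) (hl : ∃ l ∈ L, u = qs • l) : u = 0 := by
  obtain ⟨l, hl, rfl⟩ := hl
  exact h0 l hl (hNMQ hu.mem_N) hu.hom_eq

/-- If `V` has enough bar-invariant elements then they span `M_ℚ ∩ V` over `K_ℚ`. -/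
lemma Lifts.mem_globalSpan {MQ : Submodule KQ M} (hNMQ : N ≤ MQ)
    (hbar : ∀ u ∈ L, u ∈ MQ → c.hom u ∈ L → c.hom u = u)
    (h0 : ∀ l ∈ L, qs • l ∈ MQ → c.hom (qs • l) = qs • l → qs • l = 0)
    {V : Submodule K M} (hV : ∀ u ∈ V, c.hom u ∈ V) (h : Lifts c L N V) {u : M} (huV : u ∈ V)
    (huM : u ∈ MQ) : u ∈ globalSpan c L N V := by
  obtain ⟨p, hp, hcp, hcpL, hpL⟩ := h.exists_sub_mem hL huV
  have hpV := mem_of_mem_globalSpan hp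
  have hpM := hNMQ (globalSpan_le V hp)
  -- The first correction removes the pole at `0`. This one, applied to the conjugate, makes the
  -- conjugate of `z` lie in `L`; then `z` is bar-invariant and equals a global element by
  -- uniqueness.
  obtain ⟨p', hp', hcp', hcpL', hpL'⟩ := h.exists_sub_mem hL (hV _ (sub_mem huV hpV))
  have hcpV' := mem_of_mem_globalSpan hcp'
  set z := u - p - c.hom p' with hz
  have hzV : z ∈ V := sub_mem (sub_mem huV hpV) hcpV'
  have hzM : z ∈ MQ := sub_mem (sub_mem huM hpM) (hNMQ (globalSpan_le V hcp'))
  have hzL : z ∈ L := sub_mem hpL hcpL'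
  have hczL : c.hom z ∈ L := by
    rw [hz, map_sub, c.involutive]
    exact hpL'
  have hzc := hbar z hzL hzM hczL
  obtain ⟨e, heV, he, l, hl, hel⟩ := h z hzV hzL
  have hze : z - e = 0 := IsGlobal.eq_zero (N := MQ) le_rfl h0
    (IsGlobal.sub ⟨hzL, hzM, hzc⟩ ⟨he.1, hNMQ he.2, he.3⟩) ⟨l, hl, hel⟩
  have hze' : z ∈ globalSpan c L N V := by
    rw [sub_eq_zero.mp hze]
    exact Submodule.subset_span ⟨heV, he⟩
  have := add_mem (add_mem hze' hcp') hp
  rwa [show z + c.hom p' + p = u by rw [hz]; abel] at this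

/-! ### Lifting through the images of `x^n` -/

section Shift

variable {i : I} {δ : P} {x X Y : Module.End K M}

omit hL in
lemma ShiftPair.X_Y_apply (hs : D.ShiftPair i δ x X Y) {n : ℕ} {v : M}
    (hv : v ∈ LinearMap.range (x ^ n)) : (X ^ n) ((Y ^ n) v) = v := by
  obtain ⟨w, rfl⟩ := hv
  exact hs.X_Y_x n w

omit hL in
lemma ShiftPair.X_pow_mem (hs : D.ShiftPair i δ x X Y) (n : ℕ) {μ : P} {u : M}
    (hu : u ∈ D.wtSpace M (μ + n • δ)) : (X ^ n) u ∈ D.wtSpace M μ := by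
  induction n generalizing μ with
  | zero => simpa using hu
  | succ n ih =>
    rw [pow_succ', Module.End.mul_apply]
    have := hs.X_mem _ _ (ih (μ := μ + δ) (by rwa [succ_nsmul', ← add_assoc] at hu))
    rwa [add_sub_cancel_right] at this

omit hL in
lemma ShiftPair.x_pow_mem (hs : D.ShiftPair i δ x X Y) (n : ℕ) {μ : P} {u : M}
    (hu : u ∈ D.wtSpace M (μ + n • δ)) : (x ^ n) u ∈ D.wtSpace M μ := by
  induction n generalizing μ with
  | zero => simpa using hu
  | succ n ih =>
    rw [pow_succ', Module.End.mul_apply]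
    have := hs.x_mem _ _ (ih (μ := μ + δ) (by rwa [succ_nsmul', ← add_assoc] at hu))
    rwa [add_sub_cancel_right] at this

omit hL in
lemma ShiftPair.Y_pow_mem (hs : D.ShiftPair i δ x X Y) (n : ℕ) {μ : P} {u : M}
    (hu : u ∈ D.wtSpace M μ) : (Y ^ n) u ∈ D.wtSpace M (μ + n • δ) := by
  induction n with
  | zero => simpa using hu
  | succ n ih =>
    rw [pow_succ', Module.End.mul_apply, succ_nsmul, ← add_assoc]
    exact hs.Y_mem _ _ ih

variable (hs : D.ShiftPair i δ x X Y)
  (hxN : ∀ (n : ℕ) (u : M), u ∈ N → (D.qFact i n)⁻¹ • (x ^ n) u ∈ N)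
  (hxc : ∀ (n : ℕ) (u : M),
    c.hom ((D.qFact i n)⁻¹ • (x ^ n) u) = (D.qFact i n)⁻¹ • (x ^ n) (c.hom u))
  (hX : ∀ u ∈ L, X u ∈ L)
include hs hxN hxc hX

/-- The divided power of `x` applied to `u` is bar-invariant and lies in `N`, but perhaps not in
`L`. It differs from `X^n u ∈ L` by an element of the image of `x^{n+1}`, where the correction takes
place. -/
lemma ShiftPair.exists_global (n : ℕ) {μ : P}
    (h : Lifts c L N (LinearMap.range (x ^ (n + 1)) ⊓ D.wtSpace M μ)) {u : M}
    (hu : u ∈ D.wtSpace M (μ + n • δ)) (hg : IsGlobal c L N u) :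
    ∃ y ∈ LinearMap.range (x ^ n) ⊓ D.wtSpace M μ, IsGlobal c L N y ∧
      ∃ l ∈ L, (X ^ n) u - y = qs • l := by
  have hxμ : (D.qFact i n)⁻¹ • (x ^ n) u ∈ D.wtSpace M μ :=
    Submodule.smul_mem _ _ (hs.x_pow_mem n hu)
  obtain ⟨z, hz, hyz, hl⟩ := h.exists_correction hL (hxN n u hg.mem_N) (by rw [hxc, hg.hom_eq])
    (pow_apply_mem hX n hg.mem_L)
    ⟨hs.sub_mem_range n u, sub_mem hxμ (hs.X_pow_mem n hu)⟩
  refine ⟨z, ?_, hz, hl⟩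
  have hle : LinearMap.range (x ^ (n + 1)) ≤ LinearMap.range (x ^ n) := by
    rw [pow_succ]; exact LinearMap.range_comp_le_range _ _
  have hy : (D.qFact i n)⁻¹ • (x ^ n) u ∈ LinearMap.range (x ^ n) ⊓ D.wtSpace M μ :=
    ⟨Submodule.smul_mem _ _ ⟨u, rfl⟩, hxμ⟩
  have := sub_mem hy (show _ ∈ LinearMap.range (x ^ n) ⊓ D.wtSpace M μ from ⟨hle hyz.1, hyz.2⟩)
  rwa [sub_sub_cancel] at this

variable (hY : ∀ u ∈ L, Y u ∈ L)
include hY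

/-- If the weight spaces `M_{λ + kδ}` for `k ≥ n₀` have enough bar-invariant elements, so has
`(x^n M)_λ` for `n ≥ n₀`. -/
lemma ShiftPair.lifts_range {μ : P} {n₀ k₀ : ℕ}
    (hμ : ∀ k, n₀ ≤ k → Lifts c L N (D.wtSpace M (μ + k • δ)))
    (hk₀ : ∀ k, k₀ ≤ k → D.wtSpace M (μ + k • δ) = ⊥) (n : ℕ) (hn : n₀ ≤ n) :
    Lifts c L N (LinearMap.range (x ^ n) ⊓ D.wtSpace M μ) := by
  -- Descending induction on `n`: the lift for `n` is corrected by lifts for `n + 1`. For `n ≥ k₀`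
  -- the space is zero, since `v = X^n Y^n v` factors through a zero weight space.
  have key : ∀ j n, n₀ ≤ n → k₀ ≤ n + j →
      Lifts c L N (LinearMap.range (x ^ n) ⊓ D.wtSpace M μ) := by
    intro j
    induction j with
    | zero =>
      intro n _ hk v hv _
      have h1 := hs.Y_pow_mem n hv.2
      rw [hk₀ n hk, Submodule.mem_bot] at h1
      have h2 := hs.X_Y_apply hv.1
      rw [h1, map_zero] at h2
      exact ⟨0, zero_mem _, IsGlobal.zero, 0, zero_mem _, by rw [← h2]; simp⟩
    | succ j ih =>
      intro n hn hk v hv hvL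
      -- Lift `Y^n v` at the weight `μ + nδ`, then return with `X^n Y^n v = v`.
      obtain ⟨e, heμ, he, l, hl, hel⟩ := hμ n hn _ (hs.Y_pow_mem n hv.2) (pow_apply_mem hY n hvL)
      obtain ⟨y, hy, hyg, l', hl', hyl⟩ := hs.exists_global hL hxN hxc hX n
        (ih (n + 1) (by omega) (by omega)) heμ he
      refine ⟨y, hy, hyg, (X ^ n) l + l', add_mem (pow_apply_mem hX n hl) hl', ?_⟩
      rw [smul_add, ← hyl, ← map_smul, ← hel, map_sub, hs.X_Y_apply hv.1]
      abel
  exact key k₀ n hn (by omega)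

end Shift

end RootDatum

lemma rat_smul_red {M : Type*} [AddCommGroup M] [Module K M] (L : Submodule ringA M) (t : ℚ)
    (u : L) : algebraMap ℚ ringA t • red L u =
      red L ⟨algebraMap ℚ K t • u, smul_mem_of_mem_ringA (ringA.algebraMap_mem t) u.2⟩ := rfl

/-! ### Weight projections and lifts of crystal vectors -/

namespace RootDatum

variable {I P : Type*} [AddCommGroup P] {D : RootDatum I P}
variable {M : Type*} [AddCommGroup M] [Module K M] [Module D.Uq M] [IsScalarTower K D.Uq M]

/-- The projection of an integrable module to a weight space. -/
noncomputable def wtProj [Module.Free ℤ P] (hM : D.Integrable M) (ξ : P) : Module.End K M :=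
  Classical.choose (D.exists_wtProj hM ξ)

section Projection

variable [Module.Free ℤ P] (hM : D.Integrable M)

lemma wtProj_of_mem {ξ : P} {u : M} (hu : u ∈ D.wtSpace M ξ) : wtProj hM ξ u = u := by
  classical
  rw [wtProj, Classical.choose_spec (D.exists_wtProj hM ξ) ξ u hu, if_pos rfl]

lemma wtProj_of_ne {ξ η : P} (h : η ≠ ξ) {u : M} (hu : u ∈ D.wtSpace M η) :
    wtProj hM ξ u = 0 := by
  classical
  rw [wtProj, Classical.choose_spec (D.exists_wtProj hM ξ) η u hu, if_neg h]

include hM in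
/-- A linear condition holds if it holds on the weight vectors. -/
lemma weight_induction {p : M → Prop} (hp0 : p 0) (hadd : ∀ u v, p u → p v → p (u + v))
    (h : ∀ ξ, ∀ u ∈ D.wtSpace M ξ, p u) (u : M) : p u := by
  have hu : u ∈ ⨆ ξ, D.wtSpace M ξ := hM.iSup_wtSpace ▸ Submodule.mem_top
  induction hu using Submodule.iSup_induction' with
  | mem μ u hu => exact h μ u hu
  | zero => exact hp0
  | add _ _ _ _ h h' => exact hadd _ _ h h'

lemma wtProj_mem (ξ : P) (u : M) : wtProj hM ξ u ∈ D.wtSpace M ξ := by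
  revert u
  refine weight_induction hM (by simp) (fun u v hu hv => by rw [map_add]; exact add_mem hu hv) ?_
  intro η u hu
  by_cases h : η = ξ
  · subst h; rwa [wtProj_of_mem hM hu]
  · rw [wtProj_of_ne hM h hu]; exact zero_mem _

lemma exists_sum_wtProj (u : M) : ∃ s : Finset P, ∑ ξ ∈ s, wtProj hM ξ u = u := by
  classical
  suffices ∃ s : Finset P, ∀ t, s ⊆ t → ∑ ξ ∈ t, wtProj hM ξ u = u by
    obtain ⟨s, hs⟩ := this
    exact ⟨s, hs s le_rfl⟩
  revert u
  refine weight_induction hM ⟨∅, by simp⟩ ?_ ?_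
  · rintro u v ⟨s, hs⟩ ⟨t, ht⟩
    refine ⟨s ∪ t, fun r hr => ?_⟩
    simp only [map_add, Finset.sum_add_distrib]
    rw [hs r (Finset.union_subset_left hr), ht r (Finset.union_subset_right hr)]
  · intro η u hu
    refine ⟨{η}, fun t ht => ?_⟩
    rw [Finset.sum_eq_single_of_mem η (ht (Finset.mem_singleton_self η))
      fun ξ _ hξ => wtProj_of_ne hM hξ.symm hu, wtProj_of_mem hM hu]

lemma wtProj_mem_L {L : Submodule ringA M}
    (hL : ⨆ ξ, L ⊓ (D.wtSpace M ξ).restrictScalars ringA = L) (ξ : P) {u : M} (hu : u ∈ L) :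
    wtProj hM ξ u ∈ L := by
  rw [← hL] at hu
  induction hu using Submodule.iSup_induction' with
  | mem η u hu =>
    by_cases h : η = ξ
    · subst h; rw [wtProj_of_mem hM hu.2]; exact hu.1
    · rw [wtProj_of_ne hM h hu.2]; exact zero_mem _
  | zero => simp
  | add _ _ _ _ h h' => rw [map_add]; exact add_mem h h'

/-- `Lifts` can be checked on the weight spaces. -/
lemma lifts_of_wtSpace {c : D.BarInvolution M} {L : Submodule ringA M} {N : Submodule KQ M}
    (hL : ⨆ ξ, L ⊓ (D.wtSpace M ξ).restrictScalars ringA = L) {V : Submodule K M}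
    (hV : ∀ ξ, ∀ u ∈ V, wtProj hM ξ u ∈ V) (h : ∀ ξ, Lifts c L N (V ⊓ D.wtSpace M ξ)) :
    Lifts c L N V := by
  intro v hv hvL
  obtain ⟨s, hs⟩ := exists_sum_wtProj hM v
  choose e heV he l hl hel using fun ξ =>
    h ξ _ ⟨hV ξ v hv, wtProj_mem hM ξ v⟩ (wtProj_mem_L hM hL ξ hvL)
  have hsum : IsGlobal c L N (∑ ξ ∈ s, e ξ) :=
    Finset.sum_induction _ (IsGlobal c L N) (fun _ _ => IsGlobal.add) IsGlobal.zero
      fun ξ _ => he ξ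
  refine ⟨∑ ξ ∈ s, e ξ, sum_mem fun ξ _ => (heV ξ).1, hsum, ∑ ξ ∈ s, l ξ,
    sum_mem fun ξ _ => hl ξ, ?_⟩
  nth_rewrite 1 [← hs]
  rw [Finset.smul_sum, ← Finset.sum_sub_distrib]
  exact Finset.sum_congr rfl fun ξ _ => hel ξ

/-- Consequently the image of `x^n` is a graded subspace and can be treated one weight at a time. -/
lemma wtProj_pow_comm {i : I} {δ : P} {x X Y : Module.End K M} (hs : D.ShiftPair i δ x X Y)
    (n : ℕ) (ξ : P) (u : M) :
    wtProj hM ξ ((x ^ n) u) = (x ^ n) (wtProj hM (ξ + n • δ) u) := by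
  revert u
  refine weight_induction hM (by simp) (fun u v hu hv => by simp only [map_add, hu, hv]) ?_
  intro η u hu
  have h1 : (x ^ n) u ∈ D.wtSpace M (η - n • δ) :=
    hs.x_pow_mem n (by rwa [sub_add_cancel])
  by_cases h : η = ξ + n • δ
  · subst h
    rw [add_sub_cancel_right] at h1
    rw [wtProj_of_mem hM h1, wtProj_of_mem hM hu]
  · rw [wtProj_of_ne hM h hu, map_zero, wtProj_of_ne hM _ h1]
    intro h2
    exact h (by rw [← h2, sub_add_cancel])

end Projection

section Crystal

variable {L : Submodule ringA M} {B : Set (Red L)}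

lemma IsCrystalBase.zero_notMem (hLB : D.IsCrystalBase L B) : (0 : Red L) ∉ B := by
  intro h
  obtain ⟨t, -, ht⟩ := hLB.basis 0
  have h1 := ht 0 (by simp)
  have h2 := ht (Finsupp.single ⟨0, h⟩ 1) (by simp)
  rw [← h1] at h2
  have := DFunLike.congr_fun h2 (⟨0, h⟩ : B)
  simp at this

/-- An additive and `ℚ`-homogeneous condition on `L / q_s L` holds if it holds on `B`. -/
lemma IsCrystalBase.red_induction (hLB : D.IsCrystalBase L B) {p : Red L → Prop} (h0 : p 0)
    (hadd : ∀ x y, p x → p y → p (x + y)) (hsmul : ∀ (t : ℚ) x, p x → p (algebraMap ℚ ringA t • x))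
    (hB : ∀ b ∈ B, p b) (x : Red L) : p x := by
  obtain ⟨t, rfl, -⟩ := hLB.basis x
  exact Finset.sum_induction _ p hadd h0 fun b _ => hsmul _ _ (hB b b.2)

/-- `b` has a bar-invariant representative of weight `μ` in `L ∩ N`. -/
def HasGlobal (c : D.BarInvolution M) (L : Submodule ringA M) (N : Submodule KQ M) (μ : P)
    (b : Red L) : Prop :=
  ∃ u : L, (u : M) ∈ D.wtSpace M μ ∧ IsGlobal c L N u ∧ red L u = b

variable {c : D.BarInvolution M} {N : Submodule KQ M}

lemma lifts_of_hasGlobal [Module.Free ℤ P] (hM : D.Integrable M) (hLB : D.IsCrystalBase L B) {μ : P}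
    (h : ∀ b ∈ B, D.HasWt L b μ → HasGlobal c L N μ b) : Lifts c L N (D.wtSpace M μ) := by
  -- Expansions in `B` may involve all weights, so the statement is about the projection to weight
  -- `μ`; elements of `B` of other weights then contribute zero.
  have key : ∀ x : Red L, ∃ v : L, red L v = x ∧ ∃ e ∈ D.wtSpace M μ, IsGlobal c L N e ∧
      ∃ l ∈ L, wtProj hM μ v - e = qs • l := by
    refine hLB.red_induction ?_ ?_ ?_ ?_
    · exact ⟨0, rfl, 0, zero_mem _, IsGlobal.zero, 0, zero_mem _, by simp⟩
    · rintro _ _ ⟨v, rfl, e, heμ, he, l, hl, hel⟩ ⟨v', rfl, e', heμ', he', l', hl', hel'⟩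
      refine ⟨v + v', rfl, e + e', add_mem heμ heμ', he.add he', l + l', add_mem hl hl', ?_⟩
      rw [smul_add, ← hel, ← hel', Submodule.coe_add, map_add]
      abel
    · rintro t _ ⟨v, rfl, e, heμ, he, l, hl, hel⟩
      refine ⟨_, (rat_smul_red L t v).symm, _, Submodule.smul_mem _ (algebraMap ℚ K t) heμ,
        he.rat_smul t, algebraMap ℚ K t • l,
        smul_mem_of_mem_ringA (ringA.algebraMap_mem t) hl, ?_⟩
      rw [map_smul, ← smul_sub, hel, smul_comm]
    · intro b hb
      obtain ⟨ξ, v, hv, rfl⟩ := hLB.weights_B b hb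
      refine ⟨v, rfl, ?_⟩
      by_cases hξ : ξ = μ
      · subst hξ
        obtain ⟨u, huξ, hu, huv⟩ := h _ hb ⟨v, hv, rfl⟩
        rw [wtProj_of_mem hM hv]
        exact ⟨u, huξ, hu, red_eq_red_iff.mp huv.symm⟩
      · rw [wtProj_of_ne hM hξ hv]
        exact ⟨0, zero_mem _, IsGlobal.zero, 0, zero_mem _, by simp⟩
  intro v hv hvL
  obtain ⟨w, hw, e, heμ, he, l, hl, hel⟩ := key (red L ⟨v, hvL⟩)
  obtain ⟨l', hl', h'⟩ := red_eq_red_iff.mp hw.symm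
  refine ⟨e, heμ, he, wtProj hM μ l' + l,
    add_mem (wtProj_mem_L hM hLB.weights_L μ hl') hl, ?_⟩
  rw [smul_add, ← hel, ← map_smul, ← h', map_sub, wtProj_of_mem hM hv]
  abel

lemma Lifts.hasGlobal {μ : P} {V : Submodule K M} (h : Lifts c L N (V ⊓ D.wtSpace M μ)) {v : L}
    (hv : (v : M) ∈ V ⊓ D.wtSpace M μ) : HasGlobal c L N μ (red L v) := by
  obtain ⟨e, heμ, he, hl⟩ := h _ hv v.2
  exact ⟨⟨e, he.mem_L⟩, heμ.2, he, (red_eq_red_iff.mpr hl).symm⟩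

section Shift

variable {i : I} {δ : P} {x X Y : Module.End K M}
variable (hL : Submodule.span K (L : Set M) = ⊤)
  (hs : D.ShiftPair i δ x X Y)
  (hxN : ∀ (n : ℕ) (u : M), u ∈ N → (D.qFact i n)⁻¹ • (x ^ n) u ∈ N)
  (hxc : ∀ (n : ℕ) (u : M),
    c.hom ((D.qFact i n)⁻¹ • (x ^ n) u) = (D.qFact i n)⁻¹ • (x ^ n) (c.hom u))
  (hX : ∀ u ∈ L, X u ∈ L) (hY : ∀ u ∈ L, Y u ∈ L)
include hL hs hxN hxc hX hY

/-- If `X^n Y^n v = v` and `Y^n v` lifts to a bar-invariant element, so does `v`. -/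
lemma ShiftPair.hasGlobal_of_Y_pow {μ : P} {n : ℕ}
    (h : Lifts c L N (LinearMap.range (x ^ (n + 1)) ⊓ D.wtSpace M μ)) {v : L}
    (hv : (X ^ n) ((Y ^ n) (v : M)) = v)
    (hg : HasGlobal c L N (μ + n • δ) (red L ⟨(Y ^ n) v, pow_apply_mem hY n v.2⟩)) :
    HasGlobal c L N μ (red L v) := by
  obtain ⟨u, huμ, hu, huv⟩ := hg
  obtain ⟨l, hl, h1⟩ := red_eq_red_iff.mp huv
  obtain ⟨y, hy, hyg, l', hl', h2⟩ := hs.exists_global hL hxN hxc hX n h huμ hu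
  refine ⟨⟨y, hyg.mem_L⟩, hy.2, hyg, ?_⟩
  rw [eq_comm, red_eq_red_iff]
  refine ⟨l' - (X ^ n) l, sub_mem hl' (pow_apply_mem hX n hl), ?_⟩
  rw [smul_sub, ← h2, ← map_smul, ← h1, map_sub, hv]
  abel

end Shift

end Crystal

/-! ### Induction on the norm of the weight -/

section NormInduction

variable (D) in
/-- Moving along a root string outside the orbit of the reflection increases the norm. -/
lemma form_lt_of_coroot (i : I) (μ : P) {k : ℤ} (hk : 0 < k * (D.coroot i μ + k)) :
    D.form μ μ + 2 / D.d ≤ D.form (μ + k • D.root i) (μ + k • D.root i) := by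
  rw [D.form_add_smul_root]
  -- The product is a positive integer and so is `r i`, which gives a gap `2/d` that depends on
  -- neither `i` nor `μ`.
  have h1 : (1 : ℚ) ≤ k * (D.coroot i μ + k) := by exact_mod_cast hk
  have h2 : (1 : ℚ) ≤ D.r i := by exact_mod_cast D.r_pos i
  have hd : (0 : ℚ) < D.d := by exact_mod_cast D.d_pos
  have h3 : (2 / D.d : ℚ) ≤ 2 * D.r i / D.d := by
    gcongr; linarith
  have h4 : (0 : ℚ) ≤ 2 * D.r i / D.d := by positivity
  nlinarith

/-- The norm grows quadratically along a root direction, so a bounded norm leaves only finitely many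
weights on each ray. -/
lemma exists_wtSpace_eq_bot (h1 : BddAbove ((fun ξ => D.form ξ ξ) '' D.Wt M)) (i : I) (μ : P)
    (ε : ℤ) (hε : ε = 1 ∨ ε = -1) :
    ∃ k₀ : ℕ, ∀ k : ℕ, k₀ ≤ k → D.wtSpace M (μ + k • ε • D.root i) = ⊥ := by
  obtain ⟨C, hC⟩ := h1
  obtain ⟨m, hm⟩ := exists_nat_gt ((C - D.form μ μ) * D.d)
  -- From here on `ε⟨h_i, μ⟩ + k ≥ m + 1`, so the norm has grown by at least `m/d`, beyond the bound
  -- `C`.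
  refine ⟨m + (D.coroot i μ).natAbs + 1, fun k hk => ?_⟩
  by_contra hne
  have h2 := hC ⟨_, hne, rfl⟩
  have hsm : k • ε • D.root i = ((k : ℤ) * ε) • D.root i := by
    rw [mul_smul, natCast_zsmul]
  simp only [hsm, D.form_add_smul_root] at h2
  have hd : (0 : ℚ) < D.d := by exact_mod_cast D.d_pos
  have h3 : ((m : ℤ) + 1) ≤ (k * ε) * (D.coroot i μ + k * ε) := by
    have hb : ((m : ℤ) + 1) ≤ ε * D.coroot i μ + k := by
      rcases hε with rfl | rfl <;> omega
    have hk1 : (1 : ℤ) ≤ k := by omega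
    have : ((k : ℤ) * ε) * (D.coroot i μ + k * ε) = k * (ε * D.coroot i μ + k) := by
      rcases hε with rfl | rfl <;> ring
    rw [this]
    nlinarith
  have h3' : (m : ℚ) ≤ (k * ε) * (D.coroot i μ + k * ε) := by
    have : (m : ℤ) ≤ (k * ε) * (D.coroot i μ + k * ε) := by omega
    exact_mod_cast this
  have h4 : (1 : ℚ) ≤ D.r i := by exact_mod_cast D.r_pos i
  have h5 : ((m : ℚ)) / D.d ≤ (k * ε) * (D.coroot i μ + k * ε) * (2 * D.r i / D.d) := by
    rw [div_eq_mul_one_div]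
    have h6 : (1 / D.d : ℚ) ≤ 2 * D.r i / D.d := by gcongr; linarith
    have h7 : (0 : ℚ) ≤ 1 / D.d := by positivity
    have h8 : (0 : ℚ) ≤ m := by positivity
    exact mul_le_mul h3' h6 h7 (le_trans h8 h3')
  have h6 : C - D.form μ μ < m / D.d := by
    rw [lt_div_iff₀ hd]; exact hm
  push_cast at h2
  linarith

end NormInduction

end RootDatum

/-! ### Weyl orbits of vectors without a lift -/

namespace RootDatum

variable {I P : Type*} [AddCommGroup P] {D : RootDatum I P}
variable {M : Type*} [AddCommGroup M] [Module K M] [Module D.Uq M] [IsScalarTower K D.Uq M]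
variable {L : Submodule ringA M} {B : Set (Red L)} {c : D.BarInvolution M} {N : Submodule KQ M}

/-- The operators `(f_i, f̃_i, ẽ_i)` (with `ε = 1`) or `(e_i, ẽ_i, f̃_i)` (with `ε = -1`), together
with their compatibility with `L`, `N` and the bar involution. -/
structure Side (c : D.BarInvolution M) (L : Submodule ringA M) (N : Submodule KQ M) (i : I) (ε : ℤ)
    (x X Y : Module.End K M) : Prop where
  sign : ε = 1 ∨ ε = -1
  pair : D.ShiftPair i (ε • D.root i) x X Y
  inv : ∀ (μ : P) (m : ℕ), D.coroot i μ = -(ε * m) → ∀ u ∈ D.wtSpace M μ,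
    (X ^ m) ((Y ^ m) u) = u
  mem_N : ∀ (n : ℕ) (u : M), u ∈ N → (D.qFact i n)⁻¹ • (x ^ n) u ∈ N
  hom_x : ∀ (n : ℕ) (u : M),
    c.hom ((D.qFact i n)⁻¹ • (x ^ n) u) = (D.qFact i n)⁻¹ • (x ^ n) (c.hom u)
  X_mem_L : ∀ u ∈ L, X u ∈ L
  Y_mem_L : ∀ u ∈ L, Y u ∈ L
  Y_nilpotent : ∀ u, ∃ n, (Y ^ n) u = 0

lemma bar_fDiv (i : I) (n : ℕ) : D.bar (D.fDiv i n) = D.fDiv i n := by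
  rw [fDiv, Algebra.smul_def, map_mul, bar_algebraMap, map_inv₀, barK_qFact, map_pow, bar_f]

lemma bar_eDiv (i : I) (n : ℕ) : D.bar (D.eDiv i n) = D.eDiv i n := by
  rw [eDiv, Algebra.smul_def, map_mul, bar_algebraMap, map_inv₀, barK_qFact, map_pow, bar_e]

lemma exists_sides [Module.Free ℤ P] (hM : D.Integrable M) (hLB : D.IsCrystalBase L B)
    (hNf : ∀ i n, ∀ u ∈ N, D.fDiv i n • u ∈ N) (hNe : ∀ i n, ∀ u ∈ N, D.eDiv i n • u ∈ N) (i : I) :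
    ∃ X Y : Module.End K M, D.IsKashiwara i X Y ∧ Side c L N i 1 (D.act M (D.f i)) X Y ∧
      Side c L N i (-1) (D.act M (D.e i)) Y X := by
  obtain ⟨X, Y, h⟩ := D.exists_isKashiwara hM i
  have hX : ∀ u ∈ L, X u ∈ L := fun u hu => h.fTilde_eq u ▸ hLB.f_mem_L i u hu
  have hY : ∀ u ∈ L, Y u ∈ L := fun u hu => h.eTilde_eq u ▸ hLB.e_mem_L i u hu
  have hf : ∀ (n : ℕ) (u : M), (D.qFact i n)⁻¹ • (D.act M (D.f i) ^ n) u = D.fDiv i n • u :=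
    fun n u => by rw [act_pow_apply, fDiv_smul]
  have he : ∀ (n : ℕ) (u : M), (D.qFact i n)⁻¹ • (D.act M (D.e i) ^ n) u = D.eDiv i n • u :=
    fun n u => by rw [act_pow_apply, eDiv_smul]
  refine ⟨X, Y, h, ⟨Or.inl rfl, ?_, ?_, ?_, ?_, hX, hY, h.Y_nilpotent hM⟩,
    ⟨Or.inr rfl, ?_, ?_, ?_, ?_, hY, hX, h.X_nilpotent hM⟩⟩
  · rw [one_smul]; exact h.shiftPair_f hM
  · exact fun μ m hμ u hu => h.X_pow_Y_pow hM (by rw [hμ, one_mul]) hu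
  · exact fun n u hu => by rw [hf]; exact hNf i n u hu
  · exact fun n u => by rw [hf, hf, c.map_smul, bar_fDiv]
  · rw [neg_one_smul]; exact h.shiftPair_e hM
  · exact fun μ m hμ u hu => h.Y_pow_X_pow hM (by rw [hμ]; ring) hu
  · exact fun n u hu => by rw [he]; exact hNe i n u hu
  · exact fun n u => by rw [he, he, c.map_smul, bar_eDiv]

namespace Side

variable {i : I} {ε : ℤ} {x X Y : Module.End K M}

/-- Image vectors of weight `μ` come from the weights `μ + kεα_i` with `k ≥ n`. The inequality `hμ`
places all of these outside the segment from `μ` to `s_i μ`, where the norm is strictly larger. -/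
lemma lifts_range (hs : Side c L N i ε x X Y) (hL : Submodule.span K (L : Set M) = ⊤)
    (h1 : BddAbove ((fun ξ => D.form ξ ξ) '' D.Wt M)) {μ : P}
    (ih : ∀ μ', D.form μ μ + 2 / D.d ≤ D.form μ' μ' → Lifts c L N (D.wtSpace M μ')) {n : ℕ}
    (hn : n ≠ 0) (hμ : 0 < ε * D.coroot i μ + n) :
    Lifts c L N (LinearMap.range (x ^ n) ⊓ D.wtSpace M μ) := by
  obtain ⟨k₀, hk₀⟩ := exists_wtSpace_eq_bot h1 i μ ε hs.sign
  refine hs.pair.lifts_range hL hs.mem_N hs.hom_x hs.X_mem_L hs.Y_mem_L (n₀ := n) ?_ hk₀ n le_rfl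
  intro k hk
  apply ih
  rw [← natCast_zsmul, ← mul_smul]
  apply D.form_lt_of_coroot
  have e1 : (k : ℤ) * ε * (D.coroot i μ + k * ε) = k * (ε * D.coroot i μ + k) := by
    rcases hs.sign with rfl | rfl <;> ring
  rw [e1]
  exact mul_pos (by omega) (by omega)

/-- `X (Y v)` lies in the image of `x`, to which the induction hypothesis applies when `ε⟨h_i, μ⟩ ≥
0`. -/
lemma hasGlobal_of_X_Y (hs : Side c L N i ε x X Y) (hL : Submodule.span K (L : Set M) = ⊤)
    (h1 : BddAbove ((fun ξ => D.form ξ ξ) '' D.Wt M)) {μ : P}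
    (ih : ∀ μ', D.form μ μ + 2 / D.d ≤ D.form μ' μ' → Lifts c L N (D.wtSpace M μ'))
    (hμ : 0 ≤ ε * D.coroot i μ) {v : L} (hv : (v : M) ∈ D.wtSpace M μ)
    (hXY : red L ⟨X (Y v), hs.X_mem_L _ (hs.Y_mem_L _ v.2)⟩ = red L v) :
    HasGlobal c L N μ (red L v) := by
  rw [← hXY]
  refine Lifts.hasGlobal (hs.lifts_range hL h1 ih one_ne_zero (by push_cast; omega)) ⟨?_, ?_⟩
  · have := hs.pair.X_mem_range 1 (Y v)
    rwa [pow_one X] at this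
  · have := hs.pair.X_mem _ _ (hs.pair.Y_mem _ _ hv)
    rwa [add_sub_cancel_right] at this

/-- The weight `s_i μ` has the same norm as `μ`, hence the separate hypothesis `hg`. The correction
terms lie in the image of `x^{m+1}`, which comes from weights strictly beyond `s_i μ`, and these
have larger norm. -/
lemma hasGlobal_of_refl (hs : Side c L N i ε x X Y) (hL : Submodule.span K (L : Set M) = ⊤)
    (h1 : BddAbove ((fun ξ => D.form ξ ξ) '' D.Wt M)) {μ : P}
    (ih : ∀ μ', D.form μ μ + 2 / D.d ≤ D.form μ' μ' → Lifts c L N (D.wtSpace M μ')) {m : ℕ}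
    (hμ : D.coroot i μ = -(ε * m)) {v : L} (hv : (v : M) ∈ D.wtSpace M μ)
    (hg : HasGlobal c L N (D.refl i μ) (red L ⟨(Y ^ m) v, pow_apply_mem hs.Y_mem_L m v.2⟩)) :
    HasGlobal c L N μ (red L v) := by
  have hε : ε * ε = 1 := by rcases hs.sign with rfl | rfl <;> rfl
  have hr : D.refl i μ = μ + m • ε • D.root i := by
    rw [refl, hμ, neg_smul, sub_neg_eq_add, ← natCast_zsmul, ← mul_smul, mul_comm]
  rw [hr] at hg
  refine hs.pair.hasGlobal_of_Y_pow hL hs.mem_N hs.hom_x hs.X_mem_L hs.Y_mem_L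
    (hs.lifts_range hL h1 ih (Nat.succ_ne_zero m) ?_) (hs.inv μ m hμ v hv) hg
  rw [hμ, mul_neg, ← mul_assoc, hε, Nat.cast_succ]
  omega

end Side

lemma form_wordAct (w : List I) (μ : P) :
    D.form (D.wordAct w μ) (D.wordAct w μ) = D.form μ μ := by
  induction w with
  | nil => rfl
  | cons i w ih => exact (D.form_refl i _).trans ih

/-- The candidates for the vectors `b_w`. -/
noncomputable def weylOrbit (D : RootDatum I P) {M : Type*} [AddCommGroup M] [Module K M]
    [Module D.Uq M] [IsScalarTower K D.Uq M] (L : Submodule ringA M) (b : Red L) (μ : P) :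
    List I → Red L
  | [] => b
  | i :: w => if 0 ≤ D.coroot i (D.wordAct w μ) then
      (D.fRed L i)^[(D.coroot i (D.wordAct w μ)).toNat] (weylOrbit D L b μ w)
    else (D.eRed L i)^[(-D.coroot i (D.wordAct w μ)).toNat] (weylOrbit D L b μ w)

lemma hasGlobal_zero (μ : P) : HasGlobal c L N μ 0 :=
  ⟨0, zero_mem _, IsGlobal.zero, rfl⟩

lemma iterate_mem_or_eq_zero {R : Type*} [Zero R] {T : R → R} {B : Set R} (h0 : T 0 = 0)
    (hT : ∀ b ∈ B, T b ∈ B ∨ T b = 0) (n : ℕ) {b : R} (hb : b ∈ B ∨ b = 0) :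
    T^[n] b ∈ B ∨ T^[n] b = 0 := by
  induction n with
  | zero => exact hb
  | succ n ih =>
    rw [Function.iterate_succ_apply']
    rcases ih with h | h
    · exact hT _ h
    · right; rw [h, h0]

/-- Every weight space of `M` has enough bar-invariant elements if this holds for the extremal
weights. -/
theorem lifts_wtSpace [Module.Free ℤ P] (hM : D.Integrable M) (hLB : D.IsCrystalBase L B)
    (hNf : ∀ i n, ∀ u ∈ N, D.fDiv i n • u ∈ N) (hNe : ∀ i n, ∀ u ∈ N, D.eDiv i n • u ∈ N)
    (h1 : BddAbove ((fun ξ => D.form ξ ξ) '' D.Wt M))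
    (hext : ∀ ξ, D.IsExtremalWt L B ξ → Lifts c L N (D.wtSpace M ξ)) (μ : P) :
    Lifts c L N (D.wtSpace M μ) := by
  have hd : (0 : ℚ) < D.d := by exact_mod_cast D.d_pos
  have hL := hLB.span_L
  choose X Y hK hf he using exists_sides (c := c) hM hLB hNf hNe
  have fR : ∀ i (n : ℕ) (u : L), (D.fRed L i)^[n] (red L u) =
      red L ⟨(X i ^ n) u, pow_apply_mem (hf i).X_mem_L n u.2⟩ := fun i n u =>
    inducedOp_iterate_red (hK i).fTilde_eq (hf i).X_mem_L n u
  have eR : ∀ i (n : ℕ) (u : L), (D.eRed L i)^[n] (red L u) =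
      red L ⟨(Y i ^ n) u, pow_apply_mem (hf i).Y_mem_L n u.2⟩ := fun i n u =>
    inducedOp_iterate_red (hK i).eTilde_eq (hf i).Y_mem_L n u
  have fR1 : ∀ i (u : L), D.fRed L i (red L u) = red L ⟨X i u, (hf i).X_mem_L u u.2⟩ :=
    fun i u => inducedOp_red (hK i).fTilde_eq (hf i).X_mem_L u
  have eR1 : ∀ i (u : L), D.eRed L i (red L u) = red L ⟨Y i u, (hf i).Y_mem_L u u.2⟩ :=
    fun i u => inducedOp_red (hK i).eTilde_eq (hf i).Y_mem_L u
  have f0 : ∀ i, D.fRed L i 0 = 0 := fun i => by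
    rw [← red_zero, fR1]
    congr 1
    exact Subtype.ext (map_zero (X i))
  have e0 : ∀ i, D.eRed L i 0 = 0 := fun i => by
    rw [← red_zero, eR1]
    congr 1
    exact Subtype.ext (map_zero (Y i))
  obtain ⟨C, hC⟩ := id h1
  -- Each step up in norm gains at least `2/d`, so `n` bounds the number of steps still possible
  -- below `C`.
  suffices key : ∀ (n : ℕ) (μ : P), (C - D.form μ μ) * D.d < 2 * n →
      Lifts c L N (D.wtSpace M μ) by
    obtain ⟨n, hn⟩ := exists_nat_gt ((C - D.form μ μ) * D.d)
    exact key n μ (by have : (0 : ℚ) ≤ n := by positivity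
                      linarith)
  intro n
  induction n with
  | zero =>
    intro μ hμ v hv _
    have hbot : D.wtSpace M μ = ⊥ := by
      by_contra hne
      have h2 : D.form μ μ ≤ C := hC ⟨μ, hne, rfl⟩
      have : 0 ≤ (C - D.form μ μ) * D.d := mul_nonneg (by linarith) hd.le
      simp only [Nat.cast_zero, mul_zero] at hμ
      linarith
    rw [hbot, Submodule.mem_bot] at hv
    exact ⟨0, zero_mem _, IsGlobal.zero, 0, zero_mem _, by simp [hv]⟩
  | succ n IH =>
    intro μ hμ
    by_contra hcon
    have hb : ∃ b ∈ B, D.HasWt L b μ ∧ ¬ HasGlobal c L N μ b := by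
      by_contra hb
      push Not at hb
      exact hcon (lifts_of_hasGlobal hM hLB hb)
    obtain ⟨b, hbB, hbμ, hbG⟩ := hb
    -- The norm is constant on Weyl orbits, so one induction hypothesis serves every weight in the
    -- orbit of `μ`.
    have ih : ∀ (w : List I) (μ' : P), D.form (D.wordAct w μ) (D.wordAct w μ) + 2 / D.d ≤
        D.form μ' μ' → Lifts c L N (D.wtSpace M μ') := by
      intro w μ' h
      apply IH
      rw [form_wordAct] at h
      have h3 : (C - D.form μ' μ') * D.d ≤ (C - D.form μ μ - 2 / D.d) * D.d :=
        mul_le_mul_of_nonneg_right (by linarith) hd.le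
      have h4 : (2 / D.d : ℚ) * D.d = 2 := by field_simp
      push_cast at hμ
      nlinarith
    set y := D.weylOrbit L b μ with hy
    have hwt : ∀ w, D.HasWt L (y w) (D.wordAct w μ) := by
      intro w
      induction w with
      | nil => exact hbμ
      | cons i w ihw =>
        obtain ⟨v, hv, hvy⟩ := ihw
        have hstep : y (i :: w) = if 0 ≤ D.coroot i (D.wordAct w μ) then
          (D.fRed L i)^[(D.coroot i (D.wordAct w μ)).toNat] (y w)
          else (D.eRed L i)^[(-D.coroot i (D.wordAct w μ)).toNat] (y w) := rfl
        rw [hstep, ← hvy]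
        have hrefl : D.wordAct (i :: w) μ = D.refl i (D.wordAct w μ) := rfl
        rw [hrefl, refl]
        split_ifs with hc
        · rw [fR]
          refine ⟨_, ?_, rfl⟩
          have := (he i).pair.Y_pow_mem (D.coroot i (D.wordAct w μ)).toNat hv
          rwa [← natCast_zsmul, ← mul_smul, Int.toNat_of_nonneg hc, mul_neg_one, neg_smul,
            ← sub_eq_add_neg] at this
        · rw [eR]
          refine ⟨_, ?_, rfl⟩
          have := (hf i).pair.Y_pow_mem (-D.coroot i (D.wordAct w μ)).toNat hv
          rwa [← natCast_zsmul, ← mul_smul, Int.toNat_of_nonneg (by omega), mul_one, neg_smul,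
            ← sub_eq_add_neg] at this
    have hyB : ∀ w, y w ∈ B ∨ y w = 0 := by
      intro w
      induction w with
      | nil => exact Or.inl hbB
      | cons i w ihw =>
        change (if 0 ≤ D.coroot i (D.wordAct w μ) then _ else _) ∈ B ∨
          (if 0 ≤ D.coroot i (D.wordAct w μ) then _ else _) = _
        split_ifs
        · exact iterate_mem_or_eq_zero (f0 i) (hLB.f_mem_B i) _ ihw
        · exact iterate_mem_or_eq_zero (e0 i) (hLB.e_mem_B i) _ ihw
    -- A lift of the reflected vector would give a lift of the vector itself, so failure propagates
    -- along the orbit. A step made with `f̃_i` is undone on the `e_i` side, and conversely.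
    have hnot : ∀ w, ¬ HasGlobal c L N (D.wordAct w μ) (y w) := by
      intro w
      induction w with
      | nil => exact hbG
      | cons i w ihw =>
        intro hg
        apply ihw
        obtain ⟨v, hv, hvy⟩ := hwt w
        have hstep : y (i :: w) = if 0 ≤ D.coroot i (D.wordAct w μ) then
          (D.fRed L i)^[(D.coroot i (D.wordAct w μ)).toNat] (y w)
          else (D.eRed L i)^[(-D.coroot i (D.wordAct w μ)).toNat] (y w) := rfl
        rw [hstep, ← hvy] at hg
        rw [← hvy]
        split_ifs at hg with hc
        · rw [fR] at hg
          exact (he i).hasGlobal_of_refl hL h1 (ih w) (by omega) hv hg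
        · rw [eR] at hg
          exact (hf i).hasGlobal_of_refl hL h1 (ih w) (by omega) hv hg
    -- Zero has a lift, so no vector of the orbit is zero.
    have hyB' : ∀ w, y w ∈ B := fun w => (hyB w).resolve_right fun h0 =>
      hnot w (h0 ▸ hasGlobal_zero _)
    have hextr : D.IsExtremal L b μ := by
      refine ⟨y, rfl, fun w i => ⟨fun hc => ⟨?_, ?_⟩, fun hc => ⟨?_, ?_⟩⟩⟩
      -- If `ẽ_i` did not kill this vector, the vector would equal `f̃_i ẽ_i` of itself and lift
      -- through the image of `f_i`.
      · by_contra hne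
        apply hnot w
        have h2 := (hLB.e_iff_f i (D.eRed L i (y w))
          ((hLB.e_mem_B i _ (hyB' w)).resolve_right hne) (y w) (hyB' w)).mpr rfl
        obtain ⟨v, hv, hvy⟩ := hwt w
        rw [← hvy, eR1, fR1] at h2
        rw [← hvy]
        exact (hf i).hasGlobal_of_X_Y hL h1 (ih w) (by omega) hv h2.symm
      · exact (if_pos hc).symm
      · by_contra hne
        apply hnot w
        have h2 := (hLB.e_iff_f i (y w) (hyB' w) (D.fRed L i (y w))
          ((hLB.f_mem_B i _ (hyB' w)).resolve_right hne)).mp rfl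
        obtain ⟨v, hv, hvy⟩ := hwt w
        rw [← hvy, fR1, eR1] at h2
        rw [← hvy]
        exact (he i).hasGlobal_of_X_Y hL h1 (ih w) (by omega) hv h2.symm
      -- At pairing `0` the orbit is defined by the `f̃_i` branch, but both branches are then the
      -- identity.
      · by_cases hc0 : 0 ≤ D.coroot i (D.wordAct w μ)
        · have h0 : D.coroot i (D.wordAct w μ) = 0 := le_antisymm hc hc0
          have hstep : y (i :: w) =
            (D.fRed L i)^[(D.coroot i (D.wordAct w μ)).toNat] (y w) := if_pos hc0
          rw [hstep, h0]
          rfl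
        · exact (if_neg hc0).symm
    exact hcon (hext μ ⟨b, hbB, hbμ, hextr⟩)

end RootDatum

/-! ### Iterated crystal operators -/

lemma iterate_iterate_eq {R : Type*} [Zero R] {α β : R → R} {B : Set R} (h0 : β 0 = 0)
    (hβ : ∀ b ∈ B, β b ∈ B ∨ β b = 0) (hαβ : ∀ b ∈ B, β b ∈ B → α (β b) = b) (n : ℕ) {b : R}
    (hb : b ∈ B) (hn : β^[n] b ≠ 0) : α^[n] (β^[n] b) = b := by
  induction n with
  | zero => rfl
  | succ n ih =>
    rw [Function.iterate_succ_apply'] at hn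
    have hn' : β^[n] b ≠ 0 := fun h => hn (by rw [h, h0])
    have hnB : β^[n] b ∈ B :=
      (RootDatum.iterate_mem_or_eq_zero h0 hβ n (Or.inl hb)).resolve_right hn'
    rw [Function.iterate_succ_apply, Function.iterate_succ_apply',
      hαβ _ hnB ((hβ _ hnB).resolve_right hn), ih hn']

/-- Nilpotency bounds the set, so its supremum is a true maximum, and vanishing persists under
further iteration. -/
lemma le_sSup_iterate_ne_zero_iff {R : Type*} [Zero R] {β : R → R} (h0 : β 0 = 0) {b : R}
    (hb : b ≠ 0) (hnil : ∃ n, β^[n] b = 0) (n : ℕ) :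
    n ≤ sSup {k : ℕ | β^[k] b ≠ 0} ↔ β^[n] b ≠ 0 := by
  have hmono : ∀ j k, β^[j] b = 0 → β^[k + j] b = 0 := by
    intro j k hj
    rw [Function.iterate_add_apply, hj]
    exact Function.iterate_fixed h0 k
  have hbdd : BddAbove {k : ℕ | β^[k] b ≠ 0} := by
    obtain ⟨m, hm⟩ := hnil
    refine ⟨m, fun k hk => ?_⟩
    by_contra hlt
    apply hk
    have := hmono m (k - m) hm
    rwa [Nat.sub_add_cancel (by omega)] at this
  constructor
  · intro hn h
    have hmem := Nat.sSup_mem ⟨0, hb⟩ hbdd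
    apply hmem
    have := hmono n (sSup {k : ℕ | β^[k] b ≠ 0} - n) h
    rwa [Nat.sub_add_cancel hn] at this
  · exact fun h => le_csSup hbdd h

namespace RootDatum

variable {I P : Type*} [AddCommGroup P] {D : RootDatum I P}
variable {M : Type*} [AddCommGroup M] [Module K M] [Module D.Uq M] [IsScalarTower K D.Uq M]
variable {L : Submodule ringA M} {B : Set (Red L)} {c : D.BarInvolution M} {N : Submodule KQ M}

/-! ### The global basis and the images of `f_i^n` and `e_i^n` -/

section Basis

variable {G : Red L → M}

lemma linearIndependent_global (hLB : D.IsCrystalBase L B) (hG : ∀ b, IsGlobal c L N (G b))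
    (hGr : ∀ b, red L ⟨G b, (hG b).mem_L⟩ = b) (p : Red L → Prop) :
    LinearIndependent K fun b : {b // b ∈ B ∧ p b} => G b.1 := by
  have h : LinearIndependent K fun b : B => G b.1 := by
    refine linearIndependent_of_red (fun b : B => (⟨G b.1, (hG b.1).mem_L⟩ : L)) fun t ht => ?_
    simp only [hGr] at ht
    exact (hLB.basis 0).unique ht.symm (by simp)
  exact h.comp (fun b : {b // b ∈ B ∧ p b} => (⟨b.1, b.2.1⟩ : B)) fun b b' hbb =>
    Subtype.ext (Subtype.mk.inj hbb)

variable {i : I} {ε : ℤ} {x X Y : Module.End K M}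

/-- Once all weight spaces lift, no restriction on `n` is needed, hence `n₀ = 0`. -/
lemma Side.lifts_range_of_forall [Module.Free ℤ P] (hM : D.Integrable M)
    (hLB : D.IsCrystalBase L B) (hs : Side c L N i ε x X Y)
    (h1 : BddAbove ((fun ξ => D.form ξ ξ) '' D.Wt M))
    (h : ∀ μ, Lifts c L N (D.wtSpace M μ)) (n : ℕ) : Lifts c L N (LinearMap.range (x ^ n)) := by
  refine lifts_of_wtSpace hM hLB.weights_L ?_ fun μ => ?_
  · rintro ξ _ ⟨u, rfl⟩
    rw [wtProj_pow_comm hM hs.pair]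
    exact ⟨_, rfl⟩
  · obtain ⟨k₀, hk₀⟩ := exists_wtSpace_eq_bot h1 i μ ε hs.sign
    exact hs.pair.lifts_range hLB.span_L hs.mem_N hs.hom_x hs.X_mem_L hs.Y_mem_L (n₀ := 0)
      (fun k _ => h _) hk₀ n (Nat.zero_le n)

lemma Side.hom_mem_range (hs : Side c L N i ε x X Y) (n : ℕ) {u : M}
    (hu : u ∈ LinearMap.range (x ^ n)) : c.hom u ∈ LinearMap.range (x ^ n) := by
  obtain ⟨w, rfl⟩ := hu
  have h := hs.hom_x n w
  have h2 : (x ^ n) w = D.qFact i n • (D.qFact i n)⁻¹ • (x ^ n) w := by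
    rw [smul_smul, mul_inv_cancel₀ (D.qFact_ne_zero i n), one_smul]
  rw [h2, c.hom_smul, h]
  exact Submodule.smul_mem _ _ (Submodule.smul_mem _ _ ⟨_, rfl⟩)

/-- The global basis is compatible with the filtration by the images of `x^n`. -/
theorem Side.span_global_eq_range (hLB : D.IsCrystalBase L B) (hs : Side c L N i ε x X Y)
    (hspan : Submodule.span K (N : Set M) = ⊤)
    (hbar : ∀ u ∈ L, u ∈ N → c.hom u ∈ L → c.hom u = u)
    (h0 : ∀ l ∈ L, qs • l ∈ N → c.hom (qs • l) = qs • l → qs • l = 0)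
    (hG : ∀ b, IsGlobal c L N (G b)) (hGr : ∀ b, red L ⟨G b, (hG b).mem_L⟩ = b)
    {S T : M → M} (hS : ∀ u, S u = X u) (hT : ∀ u, T u = Y u)
    (hSB : ∀ b ∈ B, inducedOp L S b ∈ B ∨ inducedOp L S b = 0)
    (hTB : ∀ b ∈ B, inducedOp L T b ∈ B ∨ inducedOp L T b = 0)
    (hST : ∀ b ∈ B, ∀ b' ∈ B, b' = inducedOp L S b ↔ b = inducedOp L T b') (n : ℕ)
    (hlift : Lifts c L N (LinearMap.range (x ^ n))) :
    Submodule.span K (G '' {b | b ∈ B ∧ n ≤ sSup {k : ℕ | (inducedOp L T)^[k] b ≠ 0}}) =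
      LinearMap.range (x ^ n) := by
  set α := inducedOp L S with hα
  set β := inducedOp L T with hβ
  have αR : ∀ (n : ℕ) (u : L), α^[n] (red L u) = red L ⟨(X ^ n) u, pow_apply_mem hs.X_mem_L n u.2⟩ :=
    inducedOp_iterate_red hS hs.X_mem_L
  have βR : ∀ (n : ℕ) (u : L), β^[n] (red L u) = red L ⟨(Y ^ n) u, pow_apply_mem hs.Y_mem_L n u.2⟩ :=
    inducedOp_iterate_red hT hs.Y_mem_L
  have α0 : α 0 = 0 := by
    rw [hα, ← red_zero, inducedOp_red hS hs.X_mem_L]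
    congr 1
    exact Subtype.ext (map_zero X)
  have β0 : β 0 = 0 := by
    rw [hβ, ← red_zero, inducedOp_red hT hs.Y_mem_L]
    congr 1
    exact Subtype.ext (map_zero Y)
  have hmem : ∀ b ∈ B, (n ≤ sSup {k : ℕ | β^[k] b ≠ 0} ↔ β^[n] b ≠ 0) := by
    intro b hb
    refine le_sSup_iterate_ne_zero_iff β0 (fun h => hLB.zero_notMem (h ▸ hb)) ?_ n
    obtain ⟨u, rfl⟩ := red_surjective L b
    obtain ⟨k, hk⟩ := hs.Y_nilpotent u
    refine ⟨k, ?_⟩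
    rw [βR, ← red_zero]
    congr 1
    exact Subtype.ext hk
  have huniq : ∀ u, IsGlobal c L N u → (∃ l ∈ L, u = qs • l) → u = 0 :=
    fun u hu hl => IsGlobal.eq_zero le_rfl h0 hu hl
  apply le_antisymm
  · refine Submodule.span_le.mpr ?_
    rintro _ ⟨b, ⟨hbB, hbn⟩, rfl⟩
    rw [hmem b hbB] at hbn
    -- Here `b = α^n β^n b` has a representative in the image of `x^n`, hence a global lift there.
    -- By uniqueness this lift is `G b`.
    have hαβ := iterate_iterate_eq β0 hTB (fun b hb hb' => ((hST _ hb' _ hb).mpr rfl).symm) n hbB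
      hbn
    obtain ⟨u, rfl⟩ := red_surjective L b
    rw [βR, αR] at hαβ
    obtain ⟨e, heV, he, hl⟩ := hlift _ (hs.pair.X_mem_range n ((Y ^ n) (u : M)))
      (pow_apply_mem hs.X_mem_L n (pow_apply_mem hs.Y_mem_L n u.2))
    have h2 : red L ⟨G (red L u), (hG _).mem_L⟩ = red L ⟨e, he.mem_L⟩ := by
      rw [hGr, ← hαβ, red_eq_red_iff]
      exact hl
    have h3 := huniq _ ((hG (red L u)).sub he) (red_eq_red_iff.mp h2)
    rw [sub_eq_zero.mp h3]
    exact heV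
  · have hV : ∀ u ∈ LinearMap.range (x ^ n), u ∈ N →
        u ∈ globalSpan c L N (LinearMap.range (x ^ n)) := fun u huV hu =>
      hlift.mem_globalSpan hLB.span_L le_rfl hbar h0 (fun _ => hs.hom_mem_range n) huV hu
    set W := Submodule.span K (G '' {b | b ∈ B ∧ n ≤ sSup {k : ℕ | β^[k] b ≠ 0}}) with hW
    -- Modulo `q_s L`, the operator `X^n` sends a basis vector `b` to zero or to an element of `B`
    -- on which `β^n` does not vanish, so the image of `L` is represented by global elements of `W`.
    have key : ∀ z : Red L, ∃ w : L, red L w = z ∧ ∃ g ∈ W, IsGlobal c L N g ∧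
        ∃ l ∈ L, (X ^ n) (w : M) - g = qs • l := by
      refine hLB.red_induction ?_ ?_ ?_ ?_
      · exact ⟨0, rfl, 0, zero_mem _, IsGlobal.zero, 0, zero_mem _, by simp⟩
      · rintro _ _ ⟨v, rfl, e, heμ, he, l, hl, hel⟩ ⟨v', rfl, e', heμ', he', l', hl', hel'⟩
        refine ⟨v + v', rfl, e + e', add_mem heμ heμ', he.add he', l + l', add_mem hl hl', ?_⟩
        rw [smul_add, ← hel, ← hel', Submodule.coe_add, map_add]
        abel
      · rintro t _ ⟨v, rfl, e, heμ, he, l, hl, hel⟩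
        refine ⟨_, (rat_smul_red L t v).symm, _, Submodule.smul_mem _ (algebraMap ℚ K t) heμ,
          he.rat_smul t, algebraMap ℚ K t • l,
          smul_mem_of_mem_ringA (ringA.algebraMap_mem t) hl, ?_⟩
        rw [map_smul, ← smul_sub, hel, smul_comm]
      · intro b hb
        obtain ⟨w, rfl⟩ := red_surjective L b
        refine ⟨w, rfl, ?_⟩
        by_cases hz : α^[n] (red L w) = 0
        · refine ⟨0, zero_mem _, IsGlobal.zero, ?_⟩
          rw [αR, ← red_zero, red_eq_red_iff] at hz
          exact hz
        · have hzB := (iterate_mem_or_eq_zero α0 hSB n (Or.inl hb)).resolve_right hz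
          have hβα := iterate_iterate_eq α0 hSB (fun b hb hb' => ((hST _ hb _ hb').mp rfl).symm) n
            hb hz
          have hne : β^[n] (α^[n] (red L w)) ≠ 0 := by
            rw [hβα]; exact fun h => hLB.zero_notMem (h ▸ hb)
          refine ⟨G (α^[n] (red L w)), Submodule.subset_span ⟨_, ⟨hzB, (hmem _ hzB).mpr hne⟩, rfl⟩,
            hG _, ?_⟩
          have h2 := (hGr (α^[n] (red L w))).symm
          nth_rewrite 1 [αR] at h2
          exact red_eq_red_iff.mp h2
    -- A global `e` in the image satisfies `e = X^n Y^n e`, so it is congruent to a global element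
    -- of `W` and equals it by uniqueness.
    have hglob : ∀ e ∈ LinearMap.range (x ^ n), IsGlobal c L N e → e ∈ W := by
      intro e heV he
      obtain ⟨w, hw, g, hgW, hg, l, hl, hlg⟩ :=
        key (red L ⟨(Y ^ n) e, pow_apply_mem hs.Y_mem_L n he.mem_L⟩)
      obtain ⟨l', hl', h'⟩ := red_eq_red_iff.mp hw
      have h3 := huniq _ (he.sub hg) ⟨l - (X ^ n) l', sub_mem hl (pow_apply_mem hs.X_mem_L n hl'), by
        rw [smul_sub, ← hlg, ← map_smul, ← h', map_sub, hs.pair.X_Y_apply heV]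
        abel⟩
      rw [sub_eq_zero.mp h3]
      exact hgW
    have hGS : globalSpan c L N (LinearMap.range (x ^ n)) ≤ W.restrictScalars KQ :=
      Submodule.span_le.mpr fun e he => hglob e he.1 he.2
    rintro _ ⟨u, rfl⟩
    have hu : u ∈ Submodule.span K (N : Set M) := hspan ▸ Submodule.mem_top
    induction hu using Submodule.span_induction with
    -- For `u ∈ N` the divided power of `x` on `u` lies in `N` and in the image, hence in the
    -- `KQ`-span of global elements.
    | mem u hu =>
      have h2 := hGS (hV _ (Submodule.smul_mem _ (D.qFact i n)⁻¹ ⟨u, rfl⟩) (hs.mem_N n u hu))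
      have h3 := W.smul_mem (D.qFact i n) h2
      rwa [smul_smul, mul_inv_cancel₀ (D.qFact_ne_zero i n), one_smul] at h3
    | zero => simp
    | add _ _ _ _ h h' => rw [map_add]; exact add_mem h h'
    | smul a _ _ h => rw [map_smul]; exact W.smul_mem _ h

end Basis

/-! ### Bar-invariance and use of the balanced weight spaces -/

section Assembly

lemma fDiv_mem_UqQ (i : I) (n : ℕ) : D.fDiv i n ∈ D.UqQ :=
  Algebra.subset_adjoin (Or.inl (Or.inr ⟨i, n, rfl⟩))

lemma eDiv_mem_UqQ (i : I) (n : ℕ) : D.eDiv i n ∈ D.UqQ :=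
  Algebra.subset_adjoin (Or.inl (Or.inl ⟨i, n, rfl⟩))

/-- An element of `L ∩ L̄ ∩ M_ℚ` is bar-invariant. -/
lemma hom_eq_of_mem {MQ : Submodule D.UqQ M}
    (h2 : ∀ u ∈ MQ, ∃ v ∈ MQ, u - c.hom u = (qs - 1) • v)
    (h6 : ∀ u ∈ L, qs • u ∈ c.image D L → qs • u ∈ MQ → qs • u = 0) {u : M} (hu : u ∈ L)
    (huM : u ∈ MQ) (huc : c.hom u ∈ L) : c.hom u = u := by
  obtain ⟨v, hv, huv⟩ := h2 u huM
  -- `q_s - 1` is invertible in `A`.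
  have hvL : v ∈ L := by
    have := smul_mem_of_mem_ringA inv_qs_sub_one_mem_ringA (sub_mem hu huc)
    rwa [huv, smul_smul, inv_mul_cancel₀ qs_sub_one_ne_zero, one_smul] at this
  -- Conjugation negates `u - ū = (q_s - 1) v`, and `-(q_s - 1) = (q_s⁻¹ - 1) q_s`. Thus `q_s v` is
  -- the conjugate of `v ∈ L`, to which (vi) applies.
  have hcv : c.hom v = qs • v := by
    have h3 := congrArg c.hom huv
    rw [map_sub, c.involutive, ← neg_sub, huv, c.hom_smul, map_sub, map_one, barK_qs] at h3
    have h4 : qs⁻¹ - 1 ≠ 0 := by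
      intro h
      apply qs_sub_one_ne_zero
      have h5 : qs⁻¹ = 1 := sub_eq_zero.mp h
      rw [← inv_inv qs, h5, inv_one, sub_self]
    apply smul_right_injective M h4
    change (qs⁻¹ - 1) • c.hom v = (qs⁻¹ - 1) • qs • v
    rw [← h3, smul_smul, ← neg_smul, sub_mul, inv_mul_cancel₀ qs_ne_zero, one_mul, neg_sub]
  have hz : qs • v = 0 := by
    refine h6 v hvL ((c.mem_image_iff L _).mpr ?_) ((D.toKQ MQ).smul_mem (⟨qs, qs_mem_KQ⟩ : KQ) hv)
    rwa [← hcv, c.involutive]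
  have hv0 : v = 0 := (smul_eq_zero.mp hz).resolve_left qs_ne_zero
  rw [hv0, smul_zero, sub_eq_zero] at huv
  exact huv.symm

lemma span_image_eq_top (hL : Submodule.span K (L : Set M) = ⊤) :
    Submodule.span K (c.image D L : Set M) = ⊤ := by
  rw [eq_top_iff]
  intro v _
  obtain ⟨n, hn⟩ := exists_qs_pow_smul_mem hL (c.hom v)
  have h1 : c.hom (qs ^ n • c.hom v) ∈ Submodule.span K (c.image D L : Set M) :=
    Submodule.subset_span ⟨_, hn, rfl⟩
  rw [c.hom_smul, c.involutive] at h1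
  have h2 := Submodule.smul_mem _ (barK (qs ^ n))⁻¹ h1
  rwa [smul_smul, inv_mul_cancel₀ ((map_ne_zero barK).mpr (pow_ne_zero n qs_ne_zero)), one_smul]
    at h2

/-- The weight spaces with a balanced triple have enough bar-invariant elements. -/
lemma lifts_of_balanced {MQ : Submodule D.UqQ M}
    (hbar : ∀ u ∈ L, u ∈ D.toKQ MQ → c.hom u ∈ L → c.hom u = u) {ξ : P}
    (hN : ∀ u ∈ MQ, u ∈ D.wtSpace M ξ → u ∈ N)
    (h : Balanced (D.wtSpace M ξ) (L ⊓ (D.wtSpace M ξ).restrictScalars ringA)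
      (c.image D L ⊓ (D.wtSpace M ξ).restrictScalars ringAbar)
      (D.toKQ MQ ⊓ (D.wtSpace M ξ).restrictScalars KQ)) : Lifts c L N (D.wtSpace M ξ) := by
  intro v hv hvL
  obtain ⟨⟨u, hu1, hu2, hu3⟩, hu⟩ := h.bijective.2 (red _ ⟨v, hvL, hv⟩)
  obtain ⟨l, hl, hvl⟩ := red_eq_red_iff.mp hu.symm
  exact ⟨u, hu1.2, ⟨hu1.1, hN u hu3.1 hu3.2,
    hbar u hu1.1 hu3.1 ((c.mem_image_iff L u).mp hu2.1)⟩, l, hl.1, hvl⟩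

end Assembly

end RootDatum
end QG

theorem mainTheorem8 {I P : Type*} [AddCommGroup P] [Module.Free ℤ P] (D : QG.RootDatum I P)
    {M : Type*} [AddCommGroup M] [Module QG.K M] [Module D.Uq M] [IsScalarTower QG.K D.Uq M]
    (hM : D.Integrable M)
    (c : D.BarInvolution M)
    (L : Submodule QG.ringA M) (B : Set (QG.Red L)) (hLB : D.IsCrystalBase L B)
    (MQ : Submodule D.UqQ M) (hMQ : c.hom '' (MQ : Set M) = MQ)
    (S : Set P)
    -- (i) `(ξ, ξ)` is bounded above on the weights of `M`
    (h1 : BddAbove ((fun ξ => D.form ξ ξ) '' D.Wt M))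
    -- (ii) `u - ū ∈ (q_s - 1) M_ℚ`
    (h2 : ∀ u ∈ MQ, ∃ v ∈ MQ, u - c.hom u = (QG.qs - 1) • v)
    -- (iii) `M_ℚ` generates `M` over `K`
    (h3 : Submodule.span QG.K (MQ : Set M) = ⊤)
    -- (iv) the weight spaces outside `S` are balanced
    (h4 : ∀ ξ ∉ S, QG.Balanced (D.wtSpace M ξ)
      (L ⊓ (D.wtSpace M ξ).restrictScalars QG.ringA)
      (c.image D L ⊓ (D.wtSpace M ξ).restrictScalars QG.ringAbar)
      (D.toKQ MQ ⊓ (D.wtSpace M ξ).restrictScalars QG.KQ))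
    -- (v) extremal weights of `B` are outside `S`
    (h5 : ∀ ξ, D.IsExtremalWt L B ξ → ξ ∉ S)
    -- (vi) `q_s L ∩ L̄ ∩ M_ℚ = 0`
    (h6 : ∀ u ∈ L, QG.qs • u ∈ c.image D L → QG.qs • u ∈ MQ → QG.qs • u = 0) :
    -- (a) balancedness and (b) the bases of `f_i^n M` and `e_i^n M`
    (∃ hbal : QG.Balanced ⊤ L (c.image D L) (D.toKQ MQ), ∀ (i : I) (n : ℕ),
      (LinearIndependent QG.K (fun b : {b // b ∈ B ∧ n ≤ D.eps L i b} => hbal.G b.1) ∧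
        (Submodule.span QG.K (hbal.G '' {b | b ∈ B ∧ n ≤ D.eps L i b}) : Set M) =
          Set.range (fun u : M => D.f i ^ n • u)) ∧
      (LinearIndependent QG.K (fun b : {b // b ∈ B ∧ n ≤ D.phi L i b} => hbal.G b.1) ∧
        (Submodule.span QG.K (hbal.G '' {b | b ∈ B ∧ n ≤ D.phi L i b}) : Set M) =
          Set.range (fun u : M => D.e i ^ n • u))) ∧
    -- (c) generation by the weight spaces outside `S`
    MQ = Submodule.span D.UqQ {u : M | u ∈ MQ ∧ ∃ ξ ∉ S, u ∈ D.wtSpace M ξ} ∧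
    Submodule.span D.Uq {u : M | ∃ ξ ∉ S, u ∈ D.wtSpace M ξ} = ⊤ := by
  classical
  -- All lifts are built inside this submodule rather than in `M_ℚ`, so that (c) follows from the
  -- same construction.
  let N' : Submodule D.UqQ M := Submodule.span D.UqQ {u : M | u ∈ MQ ∧ ∃ ξ ∉ S, u ∈ D.wtSpace M ξ}
  let N : Submodule QG.KQ M := D.toKQ N'
  have hNMQ : N ≤ D.toKQ MQ := fun u hu =>
    (Submodule.span_le.mpr fun _ h => h.1 : N' ≤ MQ) hu
  have hNf : ∀ i n, ∀ u ∈ N, D.fDiv i n • u ∈ N := fun i n u hu =>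
    N'.smul_mem (⟨_, QG.RootDatum.fDiv_mem_UqQ i n⟩ : D.UqQ) hu
  have hNe : ∀ i n, ∀ u ∈ N, D.eDiv i n • u ∈ N := fun i n u hu =>
    N'.smul_mem (⟨_, QG.RootDatum.eDiv_mem_UqQ i n⟩ : D.UqQ) hu
  have hbar : ∀ u ∈ L, u ∈ D.toKQ MQ → c.hom u ∈ L → c.hom u = u := fun u hu huM huc =>
    QG.RootDatum.hom_eq_of_mem h2 h6 hu huM huc
  have h0 : ∀ l ∈ L, QG.qs • l ∈ D.toKQ MQ → c.hom (QG.qs • l) = QG.qs • l → QG.qs • l = 0 :=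
    fun l hl hlM hlc => h6 l hl ((c.mem_image_iff L _).mpr
      (hlc.symm ▸ QG.smul_mem_of_mem_ringA QG.qs_mem_ringA hl)) hlM
  have hW : ∀ μ, QG.RootDatum.Lifts c L N (D.wtSpace M μ) :=
    QG.RootDatum.lifts_wtSpace hM hLB hNf hNe h1 fun ξ hξ =>
      QG.RootDatum.lifts_of_balanced hbar
        (fun u hu huξ => Submodule.subset_span ⟨hu, ξ, h5 ξ hξ, huξ⟩) (h4 ξ (h5 ξ hξ))
  have hT : QG.RootDatum.Lifts c L N (⊤ : Submodule QG.K M) :=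
    QG.RootDatum.lifts_of_wtSpace hM hLB.weights_L (fun _ _ _ => Submodule.mem_top)
      fun ξ => by rw [top_inf_eq]; exact hW ξ
  -- Every element of `M_ℚ` is a `KQ`-combination of global elements, and these lie in `N`.
  have hMQN : ∀ u ∈ MQ, u ∈ N := fun u hu => QG.RootDatum.globalSpan_le ⊤
    (hT.mem_globalSpan hLB.span_L hNMQ hbar h0 (fun _ _ => Submodule.mem_top) Submodule.mem_top hu)
  have hbij : Function.Bijective (QG.balancedMap L (c.image D L) (D.toKQ MQ)) := by
    constructor
    · rintro ⟨u, hu1, hu2, hu3⟩ ⟨v, hv1, hv2, hv3⟩ huv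
      have hu : QG.RootDatum.IsGlobal c L (D.toKQ MQ) u :=
        ⟨hu1, hu3, hbar u hu1 hu3 ((c.mem_image_iff L u).mp hu2)⟩
      have hv : QG.RootDatum.IsGlobal c L (D.toKQ MQ) v :=
        ⟨hv1, hv3, hbar v hv1 hv3 ((c.mem_image_iff L v).mp hv2)⟩
      exact Subtype.ext (sub_eq_zero.mp (QG.RootDatum.IsGlobal.eq_zero le_rfl h0 (hu.sub hv)
        (QG.red_eq_red_iff.mp huv)))
    · intro b
      obtain ⟨v, rfl⟩ := QG.red_surjective L b
      obtain ⟨e, -, he, hl⟩ := hT v Submodule.mem_top v.2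
      exact ⟨⟨e, he.mem_L, (c.mem_image_iff L e).mpr (he.hom_eq.symm ▸ he.mem_L), hNMQ he.mem_N⟩,
        (QG.red_eq_red_iff.mpr hl).symm⟩
  have hbal : QG.Balanced ⊤ L (c.image D L) (D.toKQ MQ) :=
    ⟨hLB.span_L, QG.RootDatum.span_image_eq_top hLB.span_L, h3, hbij⟩
  have hG : ∀ b, QG.RootDatum.IsGlobal c L N (hbal.G b) := by
    intro b
    obtain ⟨hu1, hu2, hu3⟩ := ((Equiv.ofBijective _ hbal.bijective).symm b).2
    exact ⟨hu1, hMQN _ hu3, hbar _ hu1 hu3 ((c.mem_image_iff L _).mp hu2)⟩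
  have hGr : ∀ b, QG.red L ⟨hbal.G b, (hG b).mem_L⟩ = b := fun b =>
    Equiv.ofBijective_apply_symm_apply _ hbal.bijective b
  have hspan : Submodule.span QG.K (N : Set M) = ⊤ := by
    rw [eq_top_iff, ← h3]
    exact Submodule.span_mono hMQN
  refine ⟨⟨hbal, fun i n => ?_⟩, ?_, ?_⟩
  · obtain ⟨X, Y, hK, hf, he⟩ := QG.RootDatum.exists_sides (c := c) hM hLB hNf hNe i
    refine ⟨⟨QG.RootDatum.linearIndependent_global hLB hG hGr _, ?_⟩,
      QG.RootDatum.linearIndependent_global hLB hG hGr _, ?_⟩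
    · have h := hf.span_global_eq_range hLB hspan (fun u hu huN => hbar u hu (hNMQ huN))
        (fun l hl hlN => h0 l hl (hNMQ hlN)) hG hGr hK.fTilde_eq hK.eTilde_eq (hLB.f_mem_B i)
        (hLB.e_mem_B i) (hLB.e_iff_f i) n (hf.lifts_range_of_forall hM hLB h1 hW n)
      refine (congrArg (fun V : Submodule QG.K M => (V : Set M)) h).trans ?_
      ext u
      simp [QG.RootDatum.act_pow_apply]
    -- For `e_i` the crystal operators trade places, so the equivalence between them is read
    -- backwards.
    · have h := he.span_global_eq_range hLB hspan (fun u hu huN => hbar u hu (hNMQ huN))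
        (fun l hl hlN => h0 l hl (hNMQ hlN)) hG hGr hK.eTilde_eq hK.fTilde_eq (hLB.e_mem_B i)
        (hLB.f_mem_B i) (fun b hb b' hb' => (hLB.e_iff_f i b' hb' b hb).symm) n
        (he.lifts_range_of_forall hM hLB h1 hW n)
      refine (congrArg (fun V : Submodule QG.K M => (V : Set M)) h).trans ?_
      ext u
      simp [QG.RootDatum.act_pow_apply]
  · exact le_antisymm hMQN hNMQ
  · have hU : ∀ u ∈ N', u ∈ Submodule.span D.Uq {u : M | ∃ ξ ∉ S, u ∈ D.wtSpace M ξ} := by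
      intro u hu
      induction hu using Submodule.span_induction with
      | mem u hu => exact Submodule.subset_span hu.2
      | zero => exact zero_mem _
      | add _ _ _ _ h h' => exact add_mem h h'
      | smul a _ _ h => exact Submodule.smul_mem _ (a : D.Uq) h
    rw [eq_top_iff]
    rintro u -
    have hu : u ∈ Submodule.span QG.K (N : Set M) := hspan ▸ Submodule.mem_top
    induction hu using Submodule.span_induction with
    | mem u hu => exact hU u hu
    | zero => exact zero_mem _
    | add _ _ _ _ h h' => exact add_mem h h'
    | smul a u _ h =>
      rw [← algebraMap_smul D.Uq a u]
      exact Submodule.smul_mem _ _ h
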